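/- **Setting.** Let $g>0$. Consider the shallow water system $$\partial_t h+\partial_x(hu)=0,\qquad \partial_t(hu)+\partial_x\big(h(u^2+\tfrac{gh}{2})\big)+gh\,\partial_x a=0,\qquad \partial_t a=0,$$ for states $U=(h,u,a)$, with Riemann data $U_L=(h_L,u_L,a_L)$ for $x<0$ and $U_R=(h_R,u_R,a_R)$ for $x>0$, $h_L,h_R>0$. Put $\lambda_1=u-\sqrt{gh}$, $\lambda_2=u+\sqrt{gh}$, $G_1=\{\lambda_1>0\}$, $G_2=\{\lambda_1<0<\lambda_2\}$, $\bar G_2=\{\lambda_1\le 0\le\lambda_2\}$, $\mathcal C_-=\{u=-\sqrt{gh}\}$ (all with $h>0$). *Waves.* For $h_0,h$ let $\sigma(h_0,h)=\sqrt{g/2}\,(h-h_0)\sqrt{1/h+1/h_0}$ and $\rho(h_0,h)=2\sqrt g(\sqrt h-\sqrt{h_0})$. A 1-shock goes from $U_0$ to $U$ with $h>h_0$, $u=u_0-\sigma(h_0,h)$; a 2-shock with $h<h_0$, $u=u_0+\sigma(h_0,h)$; the shock speed is $\bar\lambda=[hu]/[h]$. A 1-rarefaction has $0\le h<h_0$,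 $u=u_0-\rho(h_0,h)$; a 2-rarefaction has $0\le h_0<h$, $u=u_0+\rho(h_0,h)$; its edges travel at the characteristic speeds of its end states. In all these waves $a$ is constant. A dry zone joins two states with $h=0$, the same $a$ and velocities $u_-<u_+$, which are the speeds of its edges. A stationary contact (speed $0$) joins $U_0$ to $U$, $h_0,h>0$, when $hu=h_0u_0$ and $\frac{u^2}{2}+g(h+a)=\frac{u_0^2}{2}+g(h_0+a_0)$, and it is admissible if along this curve, between $h_0$ and $h$, the level $a$ is a monotone function of $h$. *Solutions.* A solution of the Riemann problem is a finite sequence of such nontrivial waves leading from $U_L$ to $U_R$, with nondecreasing speeds from left to right (waves of equal speed may touch, and no two neighbouring waves are of the same kind, so that no wave is cut into pieces), all contacts admissible, and with the total variation of $a$ at most $|a_L-a_R|$. A solution is of type (A1) if it consists of a contact, a 1-wave and a 2-wave (either of them possibly trivial), or of a contact, a 1-rarefaction, a dry zone and a 2-rarefaction; of type (A2) if it consists of a contact, a 1-shock (necessarily of speed zero), a contact and a 2-wave (possibly trivial); of type (A3) if it consists of a 1-shock, a contact and a 2-wave (possibly trivial). *Curves and states.* Let $\mathcal W_1(U_0)$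 be the set of all right-hand states (with $h>0$, and including $U_0$) of 1-waves starting from $U_0$. Let $\mathcal W_2^B(U_R)$ be the increasing curve $\Phi_2(U;U_R)=0$ of the left-hand states (with $h>0$, and including $U_R$) of 2-waves ending at $U_R$, where $\Phi_2(U;U_R)=u-u_R-\sigma(h_R,h)$ for $h>h_R$ and $\Phi_2(U;U_R)=u-u_R-\rho(h_R,h)$ for $h\le h_R$; $U$ is above (below) the curve if $\Phi_2(U;U_R)>0$ ($<0$). For a state $U$, put $U^{\#}=(h^\#,uh/h^\#,a)$ with $h^\#=\frac12\big(-h+\sqrt{h^2+8hu^2/g}\big)$; for $U\in G_1$ it is the state reached by the 1-shock of speed zero. Write $U_L^o$ for the state with level $a_R$ reached from $U_L$ by an admissible contact, $U_L^{o\#}=(U_L^o)^\#$, and $U_L^{\#o}$ for the state with level $a_R$ reached from $U_L^\#$ by an admissible contact. Let $a_{\max}(U)=a+h+\frac{u^2}{2g}-\frac{3}{2g^{1/3}}|hu|^{2/3}$, the highest level that a contact from $U$ can reach. Let $\mathcal W_1^a(U_L)$ be the set of all $U^o\in\bar G_2$ with level $a_R$ that are reached by an admissible contact from some $U\in\bar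 G_2$, where $U$ is reached from $U_L$ by a 1-shock with speed $\bar\lambda_1(U_L,U)\le0$. The lower limit state $K$ is the point of $\mathcal W_1(U_L)\cap\mathcal C_-$ if $a_L\ge a_R$, and the point of $\mathcal W_1(U_L)\cap G_2$ with $u\le 0$ and $a_{\max}(K)=a_R$ if $a_L<a_R$; $K^o\in\bar G_2$ is the state with level $a_R$ reached from $K$ by an admissible contact. **Theorem.** Let $U_L\in G_1$ and $h_R>0$. (a) *Existence.* Suppose that $K$ and $K^o$ exist, that $K^o$ lies below or on $\mathcal W_2^B(U_R)$, and that $\bar\lambda_2(U_M^o,U_R)\ge0$ for every $U_M^o\in\mathcal W_1^a(U_L)\cap\mathcal W_2^B(U_R)$ with $u_M^o\le 0$ that is joined to $U_R$ by a 2-shock. Then the Riemann problem has a solution. Suppose for (b) and (c) that $\lambda_2(U_R)>0$ and that $U_L^o$ and $U_L^{\#o}$ exist. (b) *Uniqueness.* The Riemann problem has at most one solution if either $h_L^{\#o}\ge h_L^{o\#}$; or $h_L^{\#o}<h_L^{o\#}$, $U_L^{\#o}\in G_2$, and $U_L^{\#o}$ and $U_L^{o\#}$ lie strictly on the same side of $\mathcal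 W_2^B(U_R)$. (c) *Multiple solutions.* If $h_L^{\#o}<h_L^{o\#}$, $U_L^{\#o}$ lies above $\mathcal W_2^B(U_R)$ and $U_L^{o\#}$ lies below $\mathcal W_2^B(U_R)$, then the Riemann problem has exactly three solutions. One of them is of type (A1) and one of type (A2); the third is of type (A3) whenever $K^o$ lies below or on $\mathcal W_2^B(U_R)$. -/

import Mathlib

noncomputable section

namespace ShallowWater

/-- A state `(h, u, a)`: water height, velocity and bottom level.  The value `h = 0` occurs only at
the two ends of a dry zone inside a wave fan. -/
@[ext]
structure State where
  h : ℝ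
  u : ℝ
  a : ℝ

/-! ### Characteristic speeds and the regions of strict hyperbolicity -/

/-- The first characteristic speed `u - √(g h)`. -/
def lambda1 (g : ℝ) (U : State) : ℝ := U.u - √(g * U.h)

/-- The second characteristic speed `u + √(g h)` (the third one is `0`). -/
def lambda2 (g : ℝ) (U : State) : ℝ := U.u + √(g * U.h)

/-- Supercritical states moving to the right: `λ₁ > λ₃ = 0`. -/
def G1 (g : ℝ) : Set State := {U | 0 < U.h ∧ 0 < lambda1 g U}

/-- Subcritical states: `λ₁ < 0 < λ₂`. -/
def G2 (g : ℝ) : Set State := {U | 0 < U.h ∧ lambda1 g U < 0 ∧ 0 < lambda2 g U}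

/-- The closure of `G2` among the states with water. -/
def closedG2 (g : ℝ) : Set State := {U | 0 < U.h ∧ lambda1 g U ≤ 0 ∧ 0 ≤ lambda2 g U}

/-- The resonance hypersurface `u = - √(g h)`, where `λ₂ = λ₃`. -/
def Cminus (g : ℝ) : Set State := {U | 0 < U.h ∧ U.u = -√(g * U.h)}

/-! ### Shock and rarefaction curves in the `(h, u)`-plane -/

/-- The variation of `u` from height `h₀` to height `h` along a shock curve. -/
def shockJump (g h₀ h : ℝ) : ℝ := √(g / 2) * (h - h₀) * √(1 / h + 1 / h₀)

/-- The variation of `u` from height `h₀` to height `h` along a rarefaction curve. -/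
def rarJump (g h₀ h : ℝ) : ℝ := 2 * √g * (√h - √h₀)

/-- `Ψ₁(U; U₀)`: the forward 1-wave curve from the left-hand state `U₀` is `Ψ₁ = 0`
(a 1-shock for `h > h₀`, a 1-rarefaction wave for `h ≤ h₀`). -/
def psi1 (g : ℝ) (U U₀ : State) : ℝ :=
  U.u - U₀.u + (if U₀.h < U.h then shockJump g U₀.h U.h else rarJump g U₀.h U.h)

/-- `Φ₂(U; U₀)`: the backward 2-wave curve from the right-hand state `U₀` is `Φ₂ = 0`
(a 2-shock for `h > h₀`, a 2-rarefaction wave for `h ≤ h₀`).  The state `U` is above, on, or below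
the curve according to whether `Φ₂(U; U₀)` is positive, zero, or negative. -/
def phi2 (g : ℝ) (U U₀ : State) : ℝ :=
  U.u - U₀.u - (if U₀.h < U.h then shockJump g U₀.h U.h else rarJump g U₀.h U.h)

/-- The forward 1-wave curve through `U₀`, at the bottom level of `U₀`. -/
def W1 (g : ℝ) (U₀ : State) : Set State := {U | 0 < U.h ∧ U.a = U₀.a ∧ psi1 g U U₀ = 0}

/-- The backward 2-wave curve through `U₀`, at the bottom level of `U₀`. -/
def W2B (g : ℝ) (U₀ : State) : Set State := {U | 0 < U.h ∧ U.a = U₀.a ∧ phi2 g U U₀ = 0}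

/-- The speed `[h u] / [h]` of a shock between `U` and `V` (used only when `U.h ≠ V.h`). -/
def shockSpeed (U V : State) : ℝ := (V.h * V.u - U.h * U.u) / (V.h - U.h)

/-- The state `U^#`, reached from `U ∈ G1` by a 1-shock of zero speed. -/
def hash (g : ℝ) (U : State) : State where
  h := (-U.h + √(U.h ^ 2 + 8 * U.h * U.u ^ 2 / g)) / 2
  u := U.u * U.h / ((-U.h + √(U.h ^ 2 + 8 * U.h * U.u ^ 2 / g)) / 2)
  a := U.a

/-! ### Stationary contacts -/

/-- The bottom level, as a function of the height, along the stationary curve through `U₀`. -/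
def levelAlong (g : ℝ) (U₀ : State) (h : ℝ) : ℝ :=
  U₀.a + (U₀.u ^ 2 - (U₀.h * U₀.u / h) ^ 2) / (2 * g) + U₀.h - h

/-- `V` is the right-hand state of an admissible stationary contact with left-hand state `U`:
the jump relations `[h u] = 0`, `[u ^ 2 / 2 + g (h + a)] = 0` hold and, between `U` and `V`, the
bottom level is monotone as a function of `h` along the stationary curve.
(The trivial contact `V = U` is included.) -/
def StationaryContact (g : ℝ) (U V : State) : Prop :=
  0 < U.h ∧ 0 < V.h ∧ U.h * U.u = V.h * V.u ∧
    U.u ^ 2 / 2 + g * (U.h + U.a) = V.u ^ 2 / 2 + g * (V.h + V.a) ∧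
    (MonotoneOn (levelAlong g U) (Set.uIcc U.h V.h) ∨
      AntitoneOn (levelAlong g U) (Set.uIcc U.h V.h))

/-- The largest bottom level that can be reached by a stationary contact from `U`.  The last term
equals `3 (h u) ^ (2 / 3) / (2 g ^ (1 / 3))`. -/
def aMax (g : ℝ) (U : State) : ℝ :=
  U.a + U.h + U.u ^ 2 / (2 * g) - 3 / 2 * ((U.h * U.u) ^ 2 / g) ^ (1 / 3 : ℝ)

/-! ### Wave fans -/

/-- The elementary waves: Lax shocks and rarefaction waves of the families 1 and 2, stationary
contacts, and dry zones. -/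
inductive WaveKind where
  | shock1
  | rar1
  | shock2
  | rar2
  | contact
  | dry

open WaveKind

/-- `Links g k U V`: the states `U` (left) and `V` (right) are joined by a nontrivial wave of kind
`k`.  A 1-rarefaction may end, and a 2-rarefaction may begin, at a dry state `h = 0`; a dry zone
joins two dry states. -/
def Links (g : ℝ) (k : WaveKind) (U V : State) : Prop :=
  match k with
  | shock1 => 0 < U.h ∧ U.h < V.h ∧ V.a = U.a ∧ V.u = U.u - shockJump g U.h V.h
  | rar1 => 0 ≤ V.h ∧ V.h < U.h ∧ V.a = U.a ∧ V.u = U.u - rarJump g U.h V.h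
  | shock2 => 0 < V.h ∧ V.h < U.h ∧ V.a = U.a ∧ V.u = U.u + shockJump g U.h V.h
  | rar2 => 0 ≤ U.h ∧ U.h < V.h ∧ V.a = U.a ∧ V.u = U.u + rarJump g U.h V.h
  | contact => StationaryContact g U V ∧ U.a ≠ V.a
  | dry => U.h = 0 ∧ V.h = 0 ∧ V.a = U.a ∧ U.u < V.u

/-- The speed of the left edge of a wave. -/
def leftSpeed (g : ℝ) (k : WaveKind) (U V : State) : ℝ :=
  match k with
  | shock1 => shockSpeed U V
  | rar1 => lambda1 g U
  | shock2 => shockSpeed U V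
  | rar2 => lambda2 g U
  | contact => 0
  | dry => U.u

/-- The speed of the right edge of a wave. -/
def rightSpeed (g : ℝ) (k : WaveKind) (U V : State) : ℝ :=
  match k with
  | shock1 => shockSpeed U V
  | rar1 => lambda1 g V
  | shock2 => shockSpeed U V
  | rar2 => lambda2 g V
  | contact => 0
  | dry => V.u

/-- A wave fan is described from left to right: each wave is listed with its right-hand state. Its
left-hand state is the preceding state. -/
abbrev Fan := List (WaveKind × State)

/-- Starting from `U`, the waves of the fan lead to the state `V`. -/
def Joins (g : ℝ) : State → Fan → State → Prop
  | U, [], V => U = V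
  | U, (k, W) :: F, V => Links g k U W ∧ Joins g W F V

/-- The waves follow each other with nondecreasing speeds (waves of equal speed may touch).  Two
neighbouring waves of the same kind are not allowed: they would be one wave listed in two pieces,
so that each solution is listed exactly once. -/
def Ordered (g : ℝ) : State → Fan → Prop
  | U, (k, W) :: (k', W') :: F =>
      k ≠ k' ∧ rightSpeed g k U W ≤ leftSpeed g k' W W' ∧ Ordered g W ((k', W') :: F)
  | _, _ => True

/-- The total variation of the bottom level in a fan. -/
def bottomVariation : State → Fan → ℝ
  | _, [] => 0
  | U, (_, W) :: F => |W.a - U.a| + bottomVariation W F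

/-- An admissible (self-similar) solution of the Riemann problem with left-hand data `UL` and
right-hand data `UR`: a fan of elementary waves from `UL` to `UR` with nondecreasing speeds, whose
stationary contacts are admissible and whose bottom level has total variation at most
`|a_L - a_R|`. -/
def IsRiemannSolution (g : ℝ) (UL UR : State) (F : Fan) : Prop :=
  Joins g UL F UR ∧ Ordered g UL F ∧ bottomVariation UL F ≤ |UL.a - UR.a|

/-- At most one wave, of kind `k` or `k'`. -/
def AtMostOneOf (k k' : WaveKind) (ks : List WaveKind) : Prop := ks = [] ∨ ks = [k] ∨ ks = [k']

/-- A stationary contact, then a 1-wave, then a 2-wave (either may be trivial), possibly with a dry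
zone between two rarefaction waves. -/
def IsA1 (F : Fan) : Prop :=
  (∃ k₁ k₂, AtMostOneOf shock1 rar1 k₁ ∧ AtMostOneOf shock2 rar2 k₂ ∧
    F.map Prod.fst = contact :: (k₁ ++ k₂)) ∨
  F.map Prod.fst = [contact, rar1, dry, rar2]

/-- A stationary contact, a 1-shock (of speed zero), a second stationary contact, then a 2-wave
(which may be trivial). -/
def IsA2 (F : Fan) : Prop :=
  ∃ k₂, AtMostOneOf shock2 rar2 k₂ ∧ F.map Prod.fst = contact :: shock1 :: contact :: k₂

/-- A 1-shock, a stationary contact, then a 2-wave (which may be trivial). -/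
def IsA3 (F : Fan) : Prop :=
  ∃ k₂, AtMostOneOf shock2 rar2 k₂ ∧ F.map Prod.fst = shock1 :: contact :: k₂

/-! ### The composite curve and its lower end -/

/-- The curve of the states obtained from `UL` by a 1-shock of nonpositive speed to a (closed)
subcritical state, followed by a stationary contact that shifts the bottom level to `aR` and stays
in the closed subcritical region. -/
def W1a (g : ℝ) (UL : State) (aR : ℝ) : Set State :=
  {V | V.a = aR ∧ V ∈ closedG2 g ∧
    ∃ U ∈ W1 g UL, UL.h < U.h ∧ U ∈ closedG2 g ∧ shockSpeed UL U ≤ 0 ∧ StationaryContact g U V}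

/-- `K` is the lower limit state on the 1-wave curve of `UL` up to which the composite curve `W1a`
makes sense: it lies on `C₋` if `a_L ≥ a_R`; if `a_L < a_R`, it is the lower subcritical state
(`u ≤ 0`) with `aMax K = a_R`. -/
def IsLowerLimit (g : ℝ) (UL : State) (aR : ℝ) (K : State) : Prop :=
  K ∈ W1 g UL ∧
    ((aR ≤ UL.a ∧ K ∈ Cminus g) ∨
      (UL.a < aR ∧ K ∈ G2 g ∧ K.u ≤ 0 ∧ aMax g K = aR))

/-- `Ko` results from `K` by a stationary contact that shifts the bottom level to `aR` and stays in
the closed subcritical region. -/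
def IsContactOfLowerLimit (g : ℝ) (UL : State) (aR : ℝ) (K Ko : State) : Prop :=
  IsLowerLimit g UL aR K ∧ Ko.a = aR ∧ Ko ∈ closedG2 g ∧ StationaryContact g K Ko

end ShallowWater

end

/-! A stationary contact conserves the discharge `disc` (`h u`) and the sum of the bottom level and
the specific head `head` (`h + u² / (2g)`). At fixed discharge `q` the head `specHead g q` falls
with the depth up to the critical depth `hcrit g q` and rises beyond it, so a contact is admissible
exactly if it stays on one side of the critical depth (`stationaryContact_iff`). A shock of speed
zero conserves discharge and level and loses the head `jumpLoss`, which decreases strictly as its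
shallow depth grows towards the critical one (`jumpLoss_strictAnti`). Hence the natural picture is
the plane of discharge and head.

In that plane the two wave curves run in opposite directions. Along the 1-shocks of nonpositive
speed from `U_L` the discharge falls while the head rises (`left_disc_lt`, `left_head_lt`). Along
the backward 2-wave curve of `U_R` both rise together as long as `λ₂ ≥ 0` (`right_mono`). So the
curves cannot meet twice (`right_no_cross`), and a contact only shifts the head by a constant.

When the levels differ and `λ₂(U_R) > 0`, the order of speeds, the preservation of the flow regime
by contacts and the bound on the variation of the bottom leave seven forms of solutions
(`solution_classify`). Two begin with a contact: `IsContactPure` (A1) and `IsResonant` (A2). Four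
begin with a 1-shock and are collected in `IsLower`: (A3) and its continuations beyond the lower
limit state; at most one solution of these four forms exists (`lower_unique`). The last form,
through a critical state of positive velocity, is possible only if `U_L^{#o}` is itself critical and
not above the curve (`shockCritical_sign`).

Parts (b) and (c) are then read off from two signs, `s = Φ₂(U_L^{#o})` and `t = Φ₂(U_L^{o#})`. Form
(A1) needs `t ≤ 0` (`contactPure_sign`), `IsLower` needs `s ≥ 0` (`lower_sign`), and (A2) needs
strictly opposite signs, because its state behind the second contact lies strictly between the two
reference states, at the same positive discharge (`resonant_between`), where `Φ₂` decreases with the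
depth. If `h_L^{o#} < h_L^{#o}`, then `s < t` and the three conditions exclude each other; if the
heights agree, the levels agree and no contact occurs. If `h_L^{#o} < h_L^{o#}`, then `t < s`: on a
common side only one form survives, while for `t < 0 < s` each form occurs exactly once.

Existence is the intermediate value theorem: along the composite curve for (A3), along the states of
fixed discharge for (A2), along the 1-wave curve for (A1). If `K^o` is not available below the
2-wave curve, the third solution of (c) ends its last contact at the critical state of that curve,
and a comparison of heads decides which continuation of (A3) reaches it. -/

noncomputable section
namespace ShallowWater
open Set WaveKind

/-! ### Shock and rarefaction curves as functions of the height -/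

/-- The mass flux coefficient of a shock: `shockJump g h₀ h = (h - h₀) * kap g h₀ h`. -/
def kap (g h₀ h : ℝ) : ℝ := √(g / 2) * √(1 / h + 1 / h₀)

theorem shockJump_eq (g h₀ h : ℝ) : shockJump g h₀ h = (h - h₀) * kap g h₀ h := by
  unfold shockJump kap; ring

theorem kap_pos {g h₀ h : ℝ} (hg : 0 < g) (h0 : 0 < h₀) (hh : 0 < h) : 0 < kap g h₀ h := by
  unfold kap; positivity

theorem kap_comm (g h₀ h : ℝ) : kap g h₀ h = kap g h h₀ := by
  unfold kap; rw [add_comm]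

theorem kap_sq {g h₀ h : ℝ} (hg : 0 < g) (h0 : 0 < h₀) (hh : 0 < h) :
    kap g h₀ h ^ 2 = g / 2 * (1 / h + 1 / h₀) := by
  unfold kap; rw [mul_pow, Real.sq_sqrt (by positivity), Real.sq_sqrt (by positivity)]

theorem kap_sq' {g h₀ h : ℝ} (hg : 0 < g) (h0 : 0 < h₀) (hh : 0 < h) :
    2 * h * h₀ * kap g h₀ h ^ 2 = g * (h + h₀) := by
  rw [kap_sq hg h0 hh]; field_simp; ring

theorem mul_kap_sq {g h₀ h : ℝ} (hg : 0 < g) (h0 : 0 < h₀) (hh : 0 < h) :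
    2 * h₀ * (h * kap g h₀ h) ^ 2 = g * h * (h + h₀) := by
  have := kap_sq' hg h0 hh
  linear_combination h * this

theorem sqrt_mul_sq {g h : ℝ} (hg : 0 < g) (hh : 0 ≤ h) : √(g * h) ^ 2 = g * h :=
  Real.sq_sqrt (by positivity)

/-- `x * kap g h₀ x` is the speed of a shock relative to the flow on its side of depth `h₀` (see
`shock1_speed`). Conditions on the sign of a shock speed thereby become conditions on depths. -/
theorem mul_kap_strictMono {g h₀ x y : ℝ} (hg : 0 < g) (h0 : 0 < h₀) (hx : 0 < x) (hxy : x < y) :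
    x * kap g h₀ x < y * kap g h₀ y := by
  have hy := hx.trans hxy
  have hk := kap_pos hg h0 hy
  refine lt_of_pow_lt_pow_left₀ 2 (by positivity) ?_
  have e1 := mul_kap_sq hg h0 hx
  have e2 := mul_kap_sq hg h0 hy
  have : g * x * (x + h₀) < g * y * (y + h₀) := by
    have : x * (x + h₀) < y * (y + h₀) := by nlinarith
    nlinarith
  rw [← e1, ← e2] at this
  exact lt_of_mul_lt_mul_left this (by positivity)

/-- This bound and the next one imply the Lax inequalities: relative to the shallow side a shock
outruns the characteristics, relative to the deep side it is slower. -/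
theorem sqrt_lt_mul_kap {g h₀ h : ℝ} (hg : 0 < g) (h0 : 0 < h₀) (hh : h₀ < h) :
    √(g * h) < h * kap g h₀ h := by
  have h' := h0.trans hh
  refine lt_of_pow_lt_pow_left₀ 2 (mul_pos h' (kap_pos hg h0 h')).le ?_
  rw [sqrt_mul_sq hg h'.le]
  have e1 := mul_kap_sq hg h0 h'
  have : 0 < g * h * (h - h₀) := mul_pos (by positivity) (by linarith)
  nlinarith

theorem mul_kap_lt_sqrt {g h₀ h : ℝ} (hg : 0 < g) (h0 : 0 < h₀) (hh : h₀ < h) :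
    h₀ * kap g h₀ h < √(g * h₀) := by
  have h' := h0.trans hh
  refine lt_of_pow_lt_pow_left₀ 2 (by positivity) ?_
  rw [sqrt_mul_sq hg h0.le, kap_comm]
  have e1 := mul_kap_sq hg h' h0
  have : 0 < g * h₀ * (h - h₀) := mul_pos (by positivity) (by linarith)
  nlinarith

theorem sqrt_lt_sqrt_mul {g x y : ℝ} (hg : 0 < g) (hx : 0 ≤ x) (hxy : x < y) :
    √(g * x) < √(g * y) :=
  Real.sqrt_lt_sqrt (by positivity) (by nlinarith)

theorem rarJump_eq {g h₀ h : ℝ} (hg : 0 < g) :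
    rarJump g h₀ h = 2 * (√(g * h) - √(g * h₀)) := by
  unfold rarJump; rw [Real.sqrt_mul hg.le, Real.sqrt_mul hg.le]; ring

/-- The increment of velocity along a 2-wave curve. -/
def velJump (g h₀ h : ℝ) : ℝ := if h₀ < h then shockJump g h₀ h else rarJump g h₀ h

theorem phi2_eq (g : ℝ) (U V : State) : phi2 g U V = U.u - V.u - velJump g V.h U.h := rfl

theorem psi1_eq (g : ℝ) (U V : State) : psi1 g U V = U.u - V.u + velJump g V.h U.h := rfl

theorem shockJump_self (g h₀ : ℝ) : shockJump g h₀ h₀ = 0 := by simp [shockJump]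

theorem rarJump_self (g h₀ : ℝ) : rarJump g h₀ h₀ = 0 := by simp [rarJump]

theorem velJump_self (g h₀ : ℝ) : velJump g h₀ h₀ = 0 := by simp [velJump, rarJump]

theorem velJump_of_lt {g h₀ h : ℝ} (hh : h₀ < h) : velJump g h₀ h = shockJump g h₀ h := if_pos hh

theorem velJump_of_le {g h₀ h : ℝ} (hh : h ≤ h₀) : velJump g h₀ h = rarJump g h₀ h :=
  if_neg hh.not_gt

theorem velJump_of_ge {g h₀ h : ℝ} (hh : h₀ ≤ h) : velJump g h₀ h = shockJump g h₀ h := by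
  rcases hh.eq_or_lt with rfl | hh
  · rw [velJump_self, shockJump_self]
  · exact velJump_of_lt hh

/-- Both branches are clamped at `h₀`, where they vanish, so that continuity follows without gluing
and the shock branch never sees a depth below `h₀`. -/
theorem velJump_eq_min_max (g h₀ h : ℝ) :
    velJump g h₀ h = rarJump g h₀ (min h h₀) + shockJump g h₀ (max h h₀) := by
  rcases le_total h h₀ with hh | hh
  · rw [velJump_of_le hh, min_eq_left hh, max_eq_right hh, shockJump_self, add_zero]
  · rw [velJump_of_ge hh, min_eq_right hh, max_eq_left hh, rarJump_self, zero_add]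

theorem continuous_velJump {g h₀ : ℝ} (h0 : 0 < h₀) : Continuous (velJump g h₀) := by
  have : velJump g h₀ = fun h => rarJump g h₀ (min h h₀) + shockJump g h₀ (max h h₀) :=
    funext (velJump_eq_min_max g h₀)
  rw [this]
  unfold rarJump shockJump
  have h1 : ∀ h : ℝ, max h h₀ ≠ 0 := fun h => (lt_max_of_lt_right h0).ne'
  have h2 : Continuous fun h : ℝ => 1 / max h h₀ :=
    continuous_const.div (continuous_id.max continuous_const) h1
  fun_prop

/-- The slope of the shock curve. -/
def shockSlope (g h₀ h : ℝ) : ℝ := kap g h₀ h - (h - h₀) * (g / (4 * h ^ 2 * kap g h₀ h))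

theorem hasDerivAt_shockJump {g h₀ h : ℝ} (hg : 0 < g) (h0 : 0 < h₀) (hh : 0 < h) :
    HasDerivAt (shockJump g h₀) (shockSlope g h₀ h) h := by
  have e : shockJump g h₀ = fun h => (h - h₀) * kap g h₀ h := funext (shockJump_eq g h₀)
  have hs : 0 < 1 / h + 1 / h₀ := by positivity
  have d1 : HasDerivAt (fun x : ℝ => 1 / x + 1 / h₀) (-(h ^ 2)⁻¹) h := by
    simpa [one_div] using (hasDerivAt_inv hh.ne').add_const (1 / h₀)
  have d2 : HasDerivAt (kap g h₀) (√(g / 2) * (-(h ^ 2)⁻¹ / (2 * √(1 / h + 1 / h₀)))) h :=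
    (d1.sqrt hs.ne').const_mul _
  rw [e]
  refine (((hasDerivAt_id h).sub_const h₀).mul d2).congr_deriv ?_
  have hk : kap g h₀ h = √(g / 2) * √(1 / h + 1 / h₀) := rfl
  have s1 : 0 < √(g / 2) := by positivity
  have s2 : 0 < √(1 / h + 1 / h₀) := by positivity
  have q1 : √(g / 2) ^ 2 = g / 2 := Real.sq_sqrt (by positivity)
  unfold shockSlope
  rw [hk]
  generalize √(1 / h + 1 / h₀) = y at *
  have : g = 2 * √(g / 2) ^ 2 := by rw [q1]; ring
  generalize √(g / 2) = x at *
  rw [this]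
  simp only [id]
  field_simp
  ring

/-- A rarefaction curve has slope `g / √(g h)`; the shock curve is at least as steep. After clearing
denominators AM-GM bounds the mixed term, and by `kap_sq'` the rest, multiplied by `h₀`, is `g (h -
h₀)²`. -/
theorem le_shockSlope {g h₀ h : ℝ} (hg : 0 < g) (h0 : 0 < h₀) (hh : h₀ ≤ h) :
    g / √(g * h) ≤ shockSlope g h₀ h := by
  have hp : 0 < h := h0.trans_le hh
  have hk := kap_pos hg h0 hp
  have hks := kap_sq' hg h0 hp
  have hc : 0 < √(g * h) := by positivity
  have hcs := sqrt_mul_sq hg hp.le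
  unfold shockSlope
  generalize kap g h₀ h = k at *
  generalize √(g * h) = c at *
  have e1 : g / c = c / h := by
    rw [div_eq_div_iff hc.ne' hp.ne', ← hcs]; ring
  rw [e1, ← sub_nonneg]
  have e2 : k - (h - h₀) * (g / (4 * h ^ 2 * k)) - c / h
      = (4 * h ^ 2 * k ^ 2 - (h - h₀) * g - 4 * h * (c * k)) / (4 * h ^ 2 * k) := by
    field_simp
  rw [e2]
  refine div_nonneg ?_ (by positivity)
  have a1 : 2 * h * (c * k) ≤ c ^ 2 + h ^ 2 * k ^ 2 := by nlinarith [sq_nonneg (c - h * k)]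
  have e3 : h₀ * (4 * h ^ 2 * k ^ 2 - (h - h₀) * g - 2 * (c ^ 2 + h ^ 2 * k ^ 2))
      = g * (h - h₀) ^ 2 := by
    rw [hcs]; linear_combination h * hks
  have : 0 ≤ 4 * h ^ 2 * k ^ 2 - (h - h₀) * g - 2 * (c ^ 2 + h ^ 2 * k ^ 2) := by
    refine nonneg_of_mul_nonneg_right (a := h₀) ?_ h0
    rw [e3]; positivity
  linarith

theorem rarJump_le_shockJump_sub {g h₀ x y : ℝ} (hg : 0 < g) (h0 : 0 < h₀) (hx : h₀ ≤ x)
    (hxy : x ≤ y) : rarJump g x y ≤ shockJump g h₀ y - shockJump g h₀ x := by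
  have hd : ∀ z ∈ Ici h₀, HasDerivAt (fun z => shockJump g h₀ z - 2 * √(g * z))
      (shockSlope g h₀ z - g / √(g * z)) z := by
    intro z hz
    have hz0 : 0 < z := h0.trans_le hz
    have hgz : g * z ≠ 0 := by positivity
    have d := (((hasDerivAt_id z).const_mul g).sqrt hgz).const_mul 2
    refine ((hasDerivAt_shockJump hg h0 hz0).sub d).congr_deriv ?_
    simp only [id]
    field_simp
  have hm : MonotoneOn (fun z => shockJump g h₀ z - 2 * √(g * z)) (Ici h₀) := by
    refine monotoneOn_of_deriv_nonneg (convex_Ici _)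
      (fun z hz => (hd z hz).continuousAt.continuousWithinAt)
      (fun z hz => (hd z (interior_subset hz)).differentiableAt.differentiableWithinAt) ?_
    intro z hz
    rw [(hd z (interior_subset hz)).deriv]
    exact sub_nonneg.2 (le_shockSlope hg h0 (interior_subset hz))
  have := hm hx (mem_Ici.2 (hx.trans hxy)) hxy
  simp only at this
  rw [rarJump_eq hg]; linarith

/-- The integrated slope bound: on any wave curve the velocity varies at least as fast as `2√(g h)`.
It gives monotonicity of the curves, monotonicity of `λ₂` along 1-waves, and unbounded velocities at
large depth. -/
theorem rarJump_le_velJump_sub {g h₀ x y : ℝ} (hg : 0 < g) (h0 : 0 < h₀) (hxy : x ≤ y) :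
    rarJump g x y ≤ velJump g h₀ y - velJump g h₀ x := by
  rcases le_total x h₀ with h1 | h1
  · rcases le_total y h₀ with h2 | h2
    · rw [velJump_of_le h1, velJump_of_le h2]; simp only [rarJump]; linarith
    · rw [velJump_of_le h1, velJump_of_ge h2]
      have := rarJump_le_shockJump_sub hg h0 le_rfl h2
      rw [shockJump_self] at this
      simp only [rarJump] at *; linarith
  · rw [velJump_of_ge h1, velJump_of_ge (h1.trans hxy)]
    exact rarJump_le_shockJump_sub hg h0 h1 hxy

theorem velJump_strictMono {g h₀ x y : ℝ} (hg : 0 < g) (h0 : 0 < h₀) (hx : 0 ≤ x) (hxy : x < y) :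
    velJump g h₀ x < velJump g h₀ y := by
  have := rarJump_le_velJump_sub hg h0 hxy.le
  rw [rarJump_eq hg] at this
  linarith [sqrt_lt_sqrt_mul hg hx hxy]

theorem velJump_mono {g h₀ x y : ℝ} (hg : 0 < g) (h0 : 0 < h₀) (hx : 0 ≤ x) (hxy : x ≤ y) :
    velJump g h₀ x ≤ velJump g h₀ y := by
  rcases hxy.eq_or_lt with rfl | h
  · exact le_rfl
  · exact (velJump_strictMono hg h0 hx h).le

/-! ### Monotonicity of discharge and head along the wave curves -/

/-- The specific head of a water column of height `h` and velocity `u`. -/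
def colHead (g h u : ℝ) : ℝ := h + u ^ 2 / (2 * g)

/-- Here `hs` says that the 2-shock with depth `x` behind and `(h₀, u₀)` in front has nonnegative
speed. With the sign of `u₀` reversed the same inequality serves 1-shocks of nonpositive speed. -/
theorem shock_head_strictMono {g h₀ u₀ x y : ℝ} (hg : 0 < g) (h0 : 0 < h₀) (hx : h₀ ≤ x)
    (hxy : x < y) (hs : 0 ≤ u₀ + x * kap g h₀ x) :
    colHead g x (u₀ + shockJump g h₀ x) < colHead g y (u₀ + shockJump g h₀ y) := by
  have hx0 : 0 < x := h0.trans_le hx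
  have hy0 : 0 < y := hx0.trans hxy
  rw [shockJump_eq, shockJump_eq]
  have k1 := kap_pos hg h0 hx0
  have k2 := kap_pos hg h0 hy0
  have hmono : (x - h₀) * kap g h₀ x < (y - h₀) * kap g h₀ y := by
    have := velJump_strictMono hg h0 hx0.le hxy
    rwa [velJump_of_ge hx, velJump_of_ge (hx.trans hxy.le), shockJump_eq, shockJump_eq] at this
  have e1 := kap_sq' hg h0 hx0
  have e2 := kap_sq' hg h0 hy0
  generalize kap g h₀ x = k at *
  generalize kap g h₀ y = l at *
  unfold colHead
  have key : 0 < ((u₀ + (y - h₀) * l) ^ 2 - (u₀ + (x - h₀) * k) ^ 2) + 2 * g * (y - x) := by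
    -- The sum of the two velocities is split into twice the shock speed at `x` and a remainder free
    -- of `u₀`; only the first part needs `hs`.
    have f1 : ((u₀ + (y - h₀) * l) ^ 2 - (u₀ + (x - h₀) * k) ^ 2)
        = ((y - h₀) * l - (x - h₀) * k) * (2 * (u₀ + x * k)
          + ((y - h₀) * l - (x + h₀) * k)) := by ring
    have f2 : 0 ≤ ((y - h₀) * l - (x - h₀) * k) * (2 * (u₀ + x * k)) :=
      mul_nonneg (by linarith) (by linarith)
    have f3 : x * (y - h₀) * (2 * (k * l)) ≤ x * (y - h₀) * (k ^ 2 + l ^ 2) := by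
      have := two_mul_le_add_sq k l
      exact mul_le_mul_of_nonneg_left (by linarith) (mul_nonneg hx0.le (by linarith))
    have f4 : ((y - h₀) * l - (x - h₀) * k) * ((y - h₀) * l - (x + h₀) * k)
        = (y - h₀) ^ 2 * l ^ 2 - x * (y - h₀) * (2 * (k * l)) + (x ^ 2 - h₀ ^ 2) * k ^ 2 := by
      ring
    -- The factor `2 x y h₀` turns the squares of `kap` into polynomials; the mixed product has been
    -- removed by AM-GM in `f3`.
    have f5 : (2 * x * y * h₀) * ((y - h₀) ^ 2 * l ^ 2 - x * (y - h₀) * (k ^ 2 + l ^ 2)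
        + (x ^ 2 - h₀ ^ 2) * k ^ 2 + 2 * g * (y - x))
        = g * (y - x) * (x * y * (y - x) + 2 * x * y * h₀ - x * h₀ ^ 2 - h₀ ^ 3) := by
      linear_combination (x * (y - h₀) ^ 2 - x ^ 2 * (y - h₀)) * e2
        + (y * (x ^ 2 - h₀ ^ 2) - x * y * (y - h₀)) * e1
    have f6 : 0 < g * (y - x) * (x * y * (y - x) + 2 * x * y * h₀ - x * h₀ ^ 2 - h₀ ^ 3) := by
      refine mul_pos (mul_pos hg (by linarith)) ?_
      have t1 : 0 < x * y * (y - x) := mul_pos (by positivity) (by linarith)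
      have t2 : h₀ * h₀ ≤ x * y := mul_le_mul hx (hx.trans hxy.le) h0.le hx0.le
      have t3 : x * h₀ ≤ x * y := mul_le_mul_of_nonneg_left (hx.trans hxy.le) hx0.le
      nlinarith
    have f7 : 0 < (y - h₀) ^ 2 * l ^ 2 - x * (y - h₀) * (k ^ 2 + l ^ 2)
        + (x ^ 2 - h₀ ^ 2) * k ^ 2 + 2 * g * (y - x) := by
      rw [← f5] at f6
      exact pos_of_mul_pos_right f6 (by positivity)
    rw [f1, mul_add, f4]; linarith
  have : (y + (u₀ + (y - h₀) * l) ^ 2 / (2 * g)) - (x + (u₀ + (x - h₀) * k) ^ 2 / (2 * g))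
      = (((u₀ + (y - h₀) * l) ^ 2 - (u₀ + (x - h₀) * k) ^ 2) + 2 * g * (y - x)) / (2 * g) := by
    field_simp; ring
  have := div_pos key (show 0 < 2 * g by positivity)
  linarith

theorem shock_flux_strictMono {g h₀ u₀ x y : ℝ} (hg : 0 < g) (h0 : 0 < h₀) (hx : h₀ ≤ x)
    (hxy : x < y) (hs : 0 ≤ u₀ + x * kap g h₀ x) :
    x * (u₀ + shockJump g h₀ x) < y * (u₀ + shockJump g h₀ y) := by
  have hx0 : 0 < x := h0.trans_le hx
  rw [shockJump_eq, shockJump_eq]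
  have m := mul_kap_strictMono hg h0 hx0 hxy
  generalize kap g h₀ x = k at *
  generalize kap g h₀ y = l at *
  nlinarith [mul_nonneg (sub_nonneg.2 hx) (sub_nonneg.2 m.le),
    mul_nonneg (sub_nonneg.2 hxy.le) hs, mul_pos (sub_pos.2 hxy) (sub_pos.2 m)]

/-- In the variable `√(g x)` the velocity is affine with slope 2 and the difference of heads
factors. The hypothesis `hs` is `λ₂ ≥ 0` at the lower end. -/
theorem rar_head_strictMono {g u₀ h₀ x y : ℝ} (hg : 0 < g) (hx : 0 ≤ x) (hxy : x < y)
    (hs : 0 ≤ u₀ + rarJump g h₀ x + √(g * x)) :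
    colHead g x (u₀ + rarJump g h₀ x) < colHead g y (u₀ + rarJump g h₀ y) := by
  have e1 := sqrt_mul_sq hg hx
  have e2 := sqrt_mul_sq hg (hx.trans hxy.le)
  have c1 := sqrt_lt_sqrt_mul hg hx hxy
  have c0 := Real.sqrt_nonneg (g * x)
  rw [rarJump_eq hg] at *
  rw [rarJump_eq hg]
  unfold colHead
  generalize √(g * x) = c at *
  generalize √(g * y) = d at *
  generalize √(g * h₀) = b at *
  have : (y + (u₀ + 2 * (d - b)) ^ 2 / (2 * g)) - (x + (u₀ + 2 * (c - b)) ^ 2 / (2 * g))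
      = ((d - c) * ((u₀ + 2 * (d - b)) + (u₀ + 2 * (c - b)) + c + d)) / g := by
    have : y = d ^ 2 / g := by field_simp; linarith
    have : x = c ^ 2 / g := by field_simp; linarith
    subst x y
    field_simp; ring
  have := div_pos (mul_pos (sub_pos.2 c1)
    (show 0 < (u₀ + 2 * (d - b)) + (u₀ + 2 * (c - b)) + c + d by linarith)) hg
  linarith

theorem rar_flux_strictMono {g u₀ h₀ x y : ℝ} (hg : 0 < g) (hx : 0 ≤ x) (hxy : x < y)
    (hs : 0 ≤ u₀ + rarJump g h₀ x + √(g * x)) :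
    x * (u₀ + rarJump g h₀ x) < y * (u₀ + rarJump g h₀ y) := by
  have e1 := sqrt_mul_sq hg hx
  have e2 := sqrt_mul_sq hg (hx.trans hxy.le)
  have c1 := sqrt_lt_sqrt_mul hg hx hxy
  have c0 := Real.sqrt_nonneg (g * x)
  rw [rarJump_eq hg] at *
  rw [rarJump_eq hg]
  generalize √(g * x) = c at *
  generalize √(g * y) = d at *
  generalize √(g * h₀) = b at *
  have hv : -c ≤ u₀ + 2 * (c - b) := by linarith
  have hw : u₀ + 2 * (d - b) = (u₀ + 2 * (c - b)) + 2 * (d - c) := by ring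
  rw [hw]
  generalize u₀ + 2 * (c - b) = v at *
  have key : 0 < d ^ 2 * (v + 2 * (d - c)) - c ^ 2 * v := by
    have : d ^ 2 * (v + 2 * (d - c)) - c ^ 2 * v
        = (d - c) * ((d + c) * (v + c) + (d - c) * (2 * d + c)) := by ring
    rw [this]
    exact mul_pos (by linarith) (add_pos_of_nonneg_of_pos
      (mul_nonneg (by linarith) (by linarith)) (mul_pos (by linarith) (by linarith)))
  rw [e1, e2] at key
  nlinarith

/-! ### Discharge, specific head and the flow regimes -/

/-- The discharge `h u`. -/
def disc (U : State) : ℝ := U.h * U.u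

/-- The specific head of a state. -/
def head (g : ℝ) (U : State) : ℝ := colHead g U.h U.u

/-- The specific head at discharge `q` and height `h`. -/
def specHead (g q h : ℝ) : ℝ := colHead g h (q / h)

/-- The critical height at discharge `q`. -/
def hcrit (g q : ℝ) : ℝ := (q ^ 2 / g) ^ (1 / 3 : ℝ)

theorem hcrit_nonneg {g : ℝ} (hg : 0 < g) (q : ℝ) : 0 ≤ hcrit g q :=
  Real.rpow_nonneg (by positivity) _

theorem hcrit_pos {g q : ℝ} (hg : 0 < g) (hq : q ≠ 0) : 0 < hcrit g q :=
  Real.rpow_pos_of_pos (by positivity) _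

theorem hcrit_cube {g : ℝ} (hg : 0 < g) (q : ℝ) : hcrit g q ^ 3 = q ^ 2 / g := by
  unfold hcrit
  rw [← Real.rpow_natCast, ← Real.rpow_mul (by positivity)]
  norm_num

theorem hcrit_cube' {g : ℝ} (hg : 0 < g) (q : ℝ) : g * hcrit g q ^ 3 = q ^ 2 := by
  rw [hcrit_cube hg]; field_simp

theorem head_eq_specHead {g : ℝ} {U : State} (hU : 0 < U.h) :
    head g U = specHead g (disc U) U.h := by
  unfold head specHead disc
  rw [mul_div_cancel_left₀ _ hU.ne']

/-- A contact conserves level plus head, and `3 / 2 * hcrit` is the least head possible at the given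
discharge. -/
theorem aMax_eq (g : ℝ) (U : State) : aMax g U = U.a + head g U - 3 / 2 * hcrit g (disc U) := by
  unfold aMax head hcrit disc colHead; ring

theorem le_cube_iff {g h u : ℝ} (hh : 0 < h) : u ^ 2 ≤ g * h ↔ (h * u) ^ 2 ≤ g * h ^ 3 := by
  rw [← mul_le_mul_iff_right₀ (show 0 < h ^ 2 by positivity)]
  ring_nf

theorem cube_le_iff {g h u : ℝ} (hh : 0 < h) : g * h ≤ u ^ 2 ↔ g * h ^ 3 ≤ (h * u) ^ 2 := by
  rw [← mul_le_mul_iff_right₀ (show 0 < h ^ 2 by positivity)]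
  ring_nf

theorem le_hcrit_iff {g q h : ℝ} (hg : 0 < g) (hh : 0 ≤ h) :
    h ≤ hcrit g q ↔ g * h ^ 3 ≤ q ^ 2 := by
  rw [← hcrit_cube' hg, mul_le_mul_iff_right₀ hg, pow_le_pow_iff_left₀ hh (hcrit_nonneg hg q)]
  norm_num

theorem hcrit_le_iff {g q h : ℝ} (hg : 0 < g) (hh : 0 ≤ h) :
    hcrit g q ≤ h ↔ q ^ 2 ≤ g * h ^ 3 := by
  rw [← hcrit_cube' hg, mul_le_mul_iff_right₀ hg, pow_le_pow_iff_left₀ (hcrit_nonneg hg q) hh]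
  norm_num

/-- This and its companions translate the flow regime, given by the speeds `λ₁` and `λ₂`, into the
position of the depth relative to the critical depth of the conserved discharge. -/
theorem hcrit_disc_le_iff {g : ℝ} {U : State} (hg : 0 < g) (hU : 0 < U.h) :
    hcrit g (disc U) ≤ U.h ↔ U.u ^ 2 ≤ g * U.h := by
  rw [hcrit_le_iff hg hU.le, le_cube_iff hU]; rfl

theorem le_hcrit_disc_iff {g : ℝ} {U : State} (hg : 0 < g) (hU : 0 < U.h) :
    U.h ≤ hcrit g (disc U) ↔ g * U.h ≤ U.u ^ 2 := by
  rw [le_hcrit_iff hg hU.le, cube_le_iff hU]; rfl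

theorem hcrit_disc_lt_iff {g : ℝ} {U : State} (hg : 0 < g) (hU : 0 < U.h) :
    hcrit g (disc U) < U.h ↔ U.u ^ 2 < g * U.h := by
  rw [← not_le, ← not_le, le_hcrit_disc_iff hg hU]

theorem lt_hcrit_disc_iff {g : ℝ} {U : State} (hg : 0 < g) (hU : 0 < U.h) :
    U.h < hcrit g (disc U) ↔ g * U.h < U.u ^ 2 := by
  rw [← not_le, ← not_le, hcrit_disc_le_iff hg hU]

theorem mem_closedG2_iff {g : ℝ} {U : State} (hg : 0 < g) :
    U ∈ closedG2 g ↔ 0 < U.h ∧ U.u ^ 2 ≤ g * U.h := by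
  refine and_congr_right fun h => ?_
  unfold lambda1 lambda2
  rw [Real.sq_le (by positivity)]
  constructor <;> rintro ⟨h1, h2⟩ <;> constructor <;> linarith

theorem mem_G2_iff {g : ℝ} {U : State} :
    U ∈ G2 g ↔ 0 < U.h ∧ U.u ^ 2 < g * U.h := by
  refine and_congr_right fun h => ?_
  unfold lambda1 lambda2
  rw [Real.sq_lt]
  constructor <;> rintro ⟨h1, h2⟩ <;> constructor <;> linarith

theorem lambda1_pos_iff {g : ℝ} {U : State} (hU : 0 ≤ g * U.h) :
    0 < lambda1 g U ↔ 0 < U.u ∧ g * U.h < U.u ^ 2 := by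
  have hc := Real.sqrt_nonneg (g * U.h)
  have hc2 := Real.sq_sqrt hU
  unfold lambda1
  generalize √(g * U.h) = c at *
  constructor
  · intro h; constructor <;> nlinarith
  · rintro ⟨h1, h2⟩; nlinarith

theorem lambda1_nonneg_iff {g : ℝ} {U : State} (hU : 0 ≤ g * U.h) :
    0 ≤ lambda1 g U ↔ 0 ≤ U.u ∧ g * U.h ≤ U.u ^ 2 := by
  have hc := Real.sqrt_nonneg (g * U.h)
  have hc2 := Real.sq_sqrt hU
  unfold lambda1
  generalize √(g * U.h) = c at *
  constructor
  · intro h; constructor <;> nlinarith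
  · rintro ⟨h1, h2⟩; nlinarith

theorem lambda2_neg_iff {g : ℝ} {U : State} (hU : 0 ≤ g * U.h) :
    lambda2 g U < 0 ↔ U.u < 0 ∧ g * U.h < U.u ^ 2 := by
  have hc := Real.sqrt_nonneg (g * U.h)
  have hc2 := Real.sq_sqrt hU
  unfold lambda2
  generalize √(g * U.h) = c at *
  constructor
  · intro h; constructor <;> nlinarith
  · rintro ⟨h1, h2⟩; nlinarith

theorem lambda2_nonpos_iff {g : ℝ} {U : State} (hU : 0 ≤ g * U.h) :
    lambda2 g U ≤ 0 ↔ U.u ≤ 0 ∧ g * U.h ≤ U.u ^ 2 := by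
  have hc := Real.sqrt_nonneg (g * U.h)
  have hc2 := Real.sq_sqrt hU
  unfold lambda2
  generalize √(g * U.h) = c at *
  constructor
  · intro h; constructor <;> nlinarith
  · rintro ⟨h1, h2⟩; nlinarith

theorem mem_G1_iff {g : ℝ} {U : State} (hg : 0 < g) :
    U ∈ G1 g ↔ 0 < U.h ∧ 0 < U.u ∧ g * U.h < U.u ^ 2 :=
  and_congr_right fun h => lambda1_pos_iff (by positivity)

/-! ### The head along a stationary curve -/

/-- The sign of the last factor is decided by comparing `q²` with `g x³` or `g y³`, that is, a depth
with `hcrit`. The monotonicity of the head on either side of the critical depth follows. -/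
theorem specHead_sub {g q x y : ℝ} (hg : 0 < g) (hx : 0 < x) (hy : 0 < y) :
    (specHead g q y - specHead g q x) * (2 * g * x ^ 2 * y ^ 2)
      = (y - x) * (2 * g * x ^ 2 * y ^ 2 - q ^ 2 * (x + y)) := by
  unfold specHead colHead
  field_simp
  ring

theorem specHead_lt_of_hcrit_le {g q x y : ℝ} (hg : 0 < g) (hx : 0 < x) (hc : hcrit g q ≤ x)
    (hxy : x < y) : specHead g q x < specHead g q y := by
  have hy := hx.trans hxy
  rw [hcrit_le_iff hg hx.le] at hc
  have e := specHead_sub (q := q) hg hx hy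
  have h1 : q ^ 2 * (x + y) < 2 * g * x ^ 2 * y ^ 2 := by
    have a1 : q ^ 2 * (x + y) ≤ g * x ^ 3 * (x + y) :=
      mul_le_mul_of_nonneg_right hc (by positivity)
    have a2 : 0 < (g * x ^ 2) * ((y - x) * (2 * y + x)) :=
      mul_pos (by positivity) (mul_pos (by linarith) (by linarith))
    nlinarith
  have h2 : 0 < (specHead g q y - specHead g q x) * (2 * g * x ^ 2 * y ^ 2) := by
    rw [e]; exact mul_pos (by linarith) (by linarith)
  linarith [pos_of_mul_pos_left h2 (by positivity)]

theorem specHead_lt_of_le_hcrit {g q x y : ℝ} (hg : 0 < g) (hx : 0 < x) (hc : y ≤ hcrit g q)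
    (hxy : x < y) : specHead g q y < specHead g q x := by
  have hy := hx.trans hxy
  rw [le_hcrit_iff hg hy.le] at hc
  have e := specHead_sub (q := q) hg hx hy
  have h1 : 2 * g * x ^ 2 * y ^ 2 < q ^ 2 * (x + y) := by
    have a1 : g * y ^ 3 * (x + y) ≤ q ^ 2 * (x + y) :=
      mul_le_mul_of_nonneg_right hc (by positivity)
    have a2 : 0 < (g * y ^ 2) * ((y - x) * (2 * x + y)) :=
      mul_pos (by positivity) (mul_pos (by linarith) (by linarith))
    nlinarith
  have h2 : 0 < (specHead g q x - specHead g q y) * (2 * g * x ^ 2 * y ^ 2) := by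
    have : (specHead g q x - specHead g q y) * (2 * g * x ^ 2 * y ^ 2)
        = (y - x) * (q ^ 2 * (x + y) - 2 * g * x ^ 2 * y ^ 2) := by linear_combination -e
    rw [this]; exact mul_pos (by linarith) (by linarith)
  linarith [pos_of_mul_pos_left h2 (by positivity)]

theorem specHead_le_of_hcrit_le {g q x y : ℝ} (hg : 0 < g) (hx : 0 < x) (hc : hcrit g q ≤ x)
    (hxy : x ≤ y) : specHead g q x ≤ specHead g q y := by
  rcases hxy.eq_or_lt with rfl | h
  · exact le_rfl
  · exact (specHead_lt_of_hcrit_le hg hx hc h).le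

theorem specHead_le_of_le_hcrit {g q x y : ℝ} (hg : 0 < g) (hx : 0 < x) (hc : y ≤ hcrit g q)
    (hxy : x ≤ y) : specHead g q y ≤ specHead g q x := by
  rcases hxy.eq_or_lt with rfl | h
  · exact le_rfl
  · exact (specHead_lt_of_le_hcrit hg hx hc h).le

theorem specHead_hcrit {g q : ℝ} (hg : 0 < g) (hq : q ≠ 0) :
    specHead g q (hcrit g q) = 3 / 2 * hcrit g q := by
  have hc := hcrit_pos hg hq
  have h3 := hcrit_cube' hg q
  unfold specHead colHead
  generalize hcrit g q = c at *
  rw [div_pow, ← h3]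
  field_simp
  ring

theorem specHead_zero (g x : ℝ) : specHead g 0 x = x := by simp [specHead, colHead]

theorem specHead_mono_disc {g q q' x : ℝ} (hg : 0 < g) (hq : q ^ 2 ≤ q' ^ 2) :
    specHead g q x ≤ specHead g q' x := by
  unfold specHead colHead
  rw [div_pow, div_pow]
  gcongr

theorem hcrit_mono {g q q' : ℝ} (hg : 0 < g) (hq : q ^ 2 ≤ q' ^ 2) : hcrit g q ≤ hcrit g q' := by
  unfold hcrit
  gcongr

theorem specHead_ge {g q x : ℝ} (hg : 0 < g) (hx : 0 < x) :
    3 / 2 * hcrit g q ≤ specHead g q x := by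
  -- Without discharge the head is the depth and the critical depth is `0`, which is not a depth at
  -- which `specHead_hcrit` applies.
  rcases eq_or_ne q 0 with rfl | hq
  · rw [specHead_zero]
    simp only [hcrit]
    norm_num
    exact hx.le
  rw [← specHead_hcrit hg hq]
  rcases le_total x (hcrit g q) with h | h
  · exact specHead_le_of_le_hcrit hg hx le_rfl h
  · exact specHead_le_of_hcrit_le hg (hcrit_pos hg hq) le_rfl h

theorem specHead_gt {g q x : ℝ} (hg : 0 < g) (hx : 0 < x) (hne : x ≠ hcrit g q) :
    3 / 2 * hcrit g q < specHead g q x := by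
  rcases eq_or_ne q 0 with rfl | hq
  · rw [specHead_zero]
    simp only [hcrit]
    norm_num
    exact hx
  rw [← specHead_hcrit hg hq]
  rcases lt_or_gt_of_ne hne with h | h
  · exact specHead_lt_of_le_hcrit hg hx le_rfl h
  · exact specHead_lt_of_hcrit_le hg (hcrit_pos hg hq) le_rfl h

theorem subcritical_depth_unique {g q x y : ℝ} (hg : 0 < g) (hx : 0 < x) (hy : 0 < y)
    (hcx : hcrit g q ≤ x) (hcy : hcrit g q ≤ y) (h : specHead g q x = specHead g q y) : x = y := by
  rcases lt_trichotomy x y with h' | h' | h'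
  · exact absurd h (specHead_lt_of_hcrit_le hg hx hcx h').ne
  · exact h'
  · exact absurd h (specHead_lt_of_hcrit_le hg hy hcy h').ne'

theorem supercritical_depth_unique {g q x y : ℝ} (hg : 0 < g) (hx : 0 < x) (hy : 0 < y)
    (hcx : x ≤ hcrit g q) (hcy : y ≤ hcrit g q) (h : specHead g q x = specHead g q y) :
    x = y := by
  rcases lt_trichotomy x y with h' | h' | h'
  · exact absurd h (specHead_lt_of_le_hcrit hg hx hcy h').ne'
  · exact h'
  · exact absurd h (specHead_lt_of_le_hcrit hg hy hcx h').ne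

theorem lt_of_specHead_lt_sub {g q x y : ℝ} (hg : 0 < g) (hy : 0 < y)
    (hcy : hcrit g q ≤ y) (h : specHead g q x < specHead g q y) : x < y := by
  by_contra! hn
  exact absurd h (specHead_le_of_hcrit_le hg hy hcy hn).not_gt

theorem lt_of_specHead_lt_super {g q x y : ℝ} (hg : 0 < g) (hy : 0 < y)
    (hcx : x ≤ hcrit g q) (h : specHead g q y < specHead g q x) : x < y := by
  by_contra! hn
  exact absurd h (specHead_le_of_le_hcrit hg hy hcx hn).not_gt

theorem continuousOn_specHead (g q : ℝ) : ContinuousOn (specHead g q) (Ioi 0) := by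
  unfold specHead colHead
  refine continuousOn_id.add (((continuousOn_const.div continuousOn_id ?_).pow 2).div_const _)
  exact fun x hx => (mem_Ioi.1 hx).ne'

/-! ### Stationary contacts -/

theorem levelAlong_eq (g : ℝ) (U : State) (h : ℝ) :
    levelAlong g U h = U.a + head g U - specHead g (disc U) h := by
  unfold levelAlong head specHead disc colHead
  ring

/-- The level along the stationary curve is a constant minus `specHead`, which turns only at the
critical depth. Monotonicity between the two depths thus means that the critical depth does not
separate them strictly. -/
theorem stationaryContact_iff {g : ℝ} (hg : 0 < g) {U V : State} :
    StationaryContact g U V ↔ 0 < U.h ∧ 0 < V.h ∧ disc U = disc V ∧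
      U.a + head g U = V.a + head g V ∧
      ((hcrit g (disc U) ≤ U.h ∧ hcrit g (disc U) ≤ V.h) ∨
        (U.h ≤ hcrit g (disc U) ∧ V.h ≤ hcrit g (disc U))) := by
  have hE : U.u ^ 2 / 2 + g * (U.h + U.a) = V.u ^ 2 / 2 + g * (V.h + V.a) ↔
      U.a + head g U = V.a + head g V := by
    unfold head colHead
    rw [← mul_right_inj' hg.ne']
    field_simp
    constructor <;> intro h <;> linarith
  have hl : levelAlong g U = fun h => U.a + head g U - specHead g (disc U) h :=
    funext (levelAlong_eq g U)
  unfold StationaryContact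
  rw [hE]
  refine and_congr_right fun hU => and_congr_right fun hV => and_congr_right fun hq =>
    and_congr_right fun _ => ?_
  have hmin : 0 < min U.h V.h := lt_min hU hV
  rw [hl]
  constructor
  -- With the critical depth strictly inside, the level is higher there than at both ends, which
  -- contradicts either monotonicity.
  · have key : ∀ x y, 0 < x → x < hcrit g (disc U) → hcrit g (disc U) < y →
        uIcc U.h V.h = Icc x y →
        ¬ (MonotoneOn (fun h => U.a + head g U - specHead g (disc U) h) (uIcc U.h V.h) ∨
        AntitoneOn (fun h => U.a + head g U - specHead g (disc U) h) (uIcc U.h V.h)) := by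
      intro x y hx hxc hcy hI
      rw [hI]
      have l1 := specHead_lt_of_le_hcrit hg hx le_rfl hxc
      have l2 := specHead_lt_of_hcrit_le hg (hx.trans hxc) le_rfl hcy
      have m1 : x ∈ Icc x y := ⟨le_rfl, (hxc.trans hcy).le⟩
      have m2 : hcrit g (disc U) ∈ Icc x y := ⟨hxc.le, hcy.le⟩
      have m3 : y ∈ Icc x y := ⟨(hxc.trans hcy).le, le_rfl⟩
      rintro (h | h)
      · have := h m2 m3 hcy.le; simp only at this; linarith
      · have := h m1 m2 hxc.le; simp only at this; linarith
    intro hm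
    by_contra! hn
    rcases le_or_gt (hcrit g (disc U)) U.h with h1 | h1
    · have h2 := hn.1 h1
      rcases h1.eq_or_lt with h3 | h3
      · exact absurd (hn.2 h3.ge) h2.not_gt
      · exact key _ _ hV h2 h3 (uIcc_of_ge (h2.trans h3).le) hm
    · exact key _ _ hU h1 (hn.2 h1.le) (uIcc_of_le (h1.trans (hn.2 h1.le)).le) hm
  · rintro (⟨h1, h2⟩ | ⟨h1, h2⟩)
    · right
      intro x hx y hy hxy
      have := specHead_le_of_hcrit_le hg (hmin.trans_le hx.1) ((le_min h1 h2).trans hx.1) hxy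
      simp only; linarith
    · left
      intro x hx y hy hxy
      have := specHead_le_of_le_hcrit hg (hmin.trans_le hx.1) (hy.2.trans (max_le h1 h2)) hxy
      simp only; linarith

/-! ### Depths with prescribed discharge and head -/

/-- The subcritical height with `h + p / (2 h ^ 2) = e`, by Cardano's trigonometric formula. -/
def subDepth (p e : ℝ) : ℝ := e / 3 * (1 + 2 * Real.cos (Real.arccos (1 - 27 * p / (4 * e ^ 3)) / 3))

/-- The angle `arccos _ / 3` is at most `π / 3`. The bound `2 e / 3` is the depth of a critical
state of head `e`, so the formula selects the subcritical root. -/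
theorem subDepth_ge {p e : ℝ} (he : 0 < e) : 2 * e / 3 ≤ subDepth p e := by
  have h : 1 / 2 ≤ Real.cos (Real.arccos (1 - 27 * p / (4 * e ^ 3)) / 3) := by
    rw [← Real.cos_pi_div_three]
    refine Real.cos_le_cos_of_nonneg_of_le_pi ?_ ?_ ?_
    · have := Real.arccos_nonneg (1 - 27 * p / (4 * e ^ 3)); positivity
    · linarith [Real.pi_pos]
    · linarith [Real.arccos_le_pi (1 - 27 * p / (4 * e ^ 3))]
  unfold subDepth
  nlinarith

/-- The formula reduces the cubic to `cos 3θ = 4 cos³ θ - 3 cos θ`; the hypotheses on `p` keep the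
argument of `arccos` in `[-1, 1]`. -/
theorem subDepth_cubic {p e : ℝ} (he : 0 < e) (hp : 0 ≤ p) (hpe : 27 * p ≤ 8 * e ^ 3) :
    2 * subDepth p e ^ 3 - 2 * e * subDepth p e ^ 2 + p = 0 := by
  unfold subDepth
  set t := Real.arccos (1 - 27 * p / (4 * e ^ 3)) with ht
  have h3 : Real.cos (3 * (t / 3)) = 1 - 27 * p / (4 * e ^ 3) := by
    rw [mul_div_cancel₀ _ (by norm_num : (3 : ℝ) ≠ 0), ht]
    refine Real.cos_arccos ?_ ?_
    · have : 27 * p / (4 * e ^ 3) ≤ 2 := by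
        rw [div_le_iff₀ (by positivity)]; linarith
      linarith
    · have : 0 ≤ 27 * p / (4 * e ^ 3) := by positivity
      linarith
  rw [Real.cos_three_mul] at h3
  generalize Real.cos (t / 3) = z at *
  field_simp at h3
  linear_combination (1 / 27) * h3

theorem subDepth_specHead {g q e : ℝ} (hg : 0 < g) (he : 0 < e)
    (hpe : 27 * (q ^ 2 / g) ≤ 8 * e ^ 3) : specHead g q (subDepth (q ^ 2 / g) e) = e := by
  have h1 := subDepth_cubic he (by positivity) hpe
  have h2 : 0 < subDepth (q ^ 2 / g) e := lt_of_lt_of_le (by positivity) (subDepth_ge he)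
  unfold specHead colHead
  generalize subDepth (q ^ 2 / g) e = x at *
  field_simp at h1 ⊢
  linear_combination h1

theorem hcrit_le_subDepth {g q e : ℝ} (hg : 0 < g) (he : 0 < e)
    (hpe : 27 * (q ^ 2 / g) ≤ 8 * e ^ 3) : hcrit g q ≤ subDepth (q ^ 2 / g) e := by
  have h1 := subDepth_ge (p := q ^ 2 / g) he
  refine le_trans ?_ h1
  rw [hcrit_le_iff hg (by positivity)]
  have : q ^ 2 = g * (q ^ 2 / g) := by field_simp
  rw [this]
  have : q ^ 2 / g ≤ (2 * e / 3) ^ 3 := by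
    have : (2 * e / 3) ^ 3 = 8 * e ^ 3 / 27 := by ring
    rw [this]; linarith
  exact mul_le_mul_of_nonneg_left this hg.le

theorem hcrit_le_iff_cubic {g q e : ℝ} (hg : 0 < g) :
    3 / 2 * hcrit g q ≤ e ↔ 27 * (q ^ 2 / g) ≤ 8 * e ^ 3 := by
  rw [← hcrit_cube hg]
  have h := (Odd.strictMono_pow (R := ℝ) (n := 3) (by decide)).le_iff_le
    (a := 3 / 2 * hcrit g q) (b := e)
  rw [← h]
  simp only [mul_pow]
  constructor <;> intro h <;> linarith

/-- The purpose of the closed formula: the depth behind a contact is jointly continuous in discharge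
and head, critical states included, as the intermediate value argument along the composite curve
requires. -/
theorem continuousAt_subDepth {p e : ℝ} (he : 0 < e) :
    ContinuousAt (fun z : ℝ × ℝ => subDepth z.1 z.2) (p, e) := by
  unfold subDepth
  have h0 : (4 : ℝ) * e ^ 3 ≠ 0 := by positivity
  have : ContinuousAt (fun z : ℝ × ℝ => 27 * z.1 / (4 * z.2 ^ 3)) (p, e) :=
    ContinuousAt.div (by fun_prop) (by fun_prop) h0
  have := Real.continuous_arccos.continuousAt.comp (continuousAt_const.sub this)
    (f := fun z : ℝ × ℝ => 1 - 27 * z.1 / (4 * z.2 ^ 3))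
  have := Real.continuous_cos.continuousAt.comp (this.div_const 3)
  exact (continuousAt_snd.div_const 3).mul (continuousAt_const.add (continuousAt_const.mul this))

theorem exists_supercritical_depth {g q e : ℝ} (hg : 0 < g) (hq : q ≠ 0)
    (he : 3 / 2 * hcrit g q ≤ e) : ∃ x, 0 < x ∧ x ≤ hcrit g q ∧ specHead g q x = e := by
  have hc := hcrit_pos hg hq
  have he0 : 0 < e := by linarith
  -- At the depth `√(q² / (2 g e))` the kinetic part of the head alone equals `e`.
  set y := min (hcrit g q) (√(q ^ 2 / (2 * g * e))) with hy
  have hy0 : 0 < y := lt_min hc (by positivity)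
  have h1 : e ≤ specHead g q y := by
    have h2 : y ^ 2 ≤ q ^ 2 / (2 * g * e) := by
      rw [← Real.sq_sqrt (show 0 ≤ q ^ 2 / (2 * g * e) by positivity)]
      exact pow_le_pow_left₀ hy0.le (min_le_right _ _) 2
    rw [le_div_iff₀ (by positivity)] at h2
    have : e ≤ (q / y) ^ 2 / (2 * g) := by
      rw [div_pow, le_div_iff₀ (by positivity), le_div_iff₀ (by positivity)]
      linarith
    unfold specHead colHead
    linarith
  have hsub : Icc y (hcrit g q) ⊆ Ioi 0 := fun x hx => hy0.trans_le hx.1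
  obtain ⟨x, hx, hxe⟩ := intermediate_value_Icc' (min_le_left _ _)
    ((continuousOn_specHead g q).mono hsub) ⟨(specHead_hcrit hg hq).trans_le he, h1⟩
  exact ⟨x, hsub hx, hx.2, hxe⟩

/-! ### Hydraulic jumps -/

/-- The height conjugate to `z` in a stationary shock of discharge `q`. -/
def jumpDepth (g q z : ℝ) : ℝ := (-z + √(z ^ 2 + 8 * q ^ 2 / (g * z))) / 2

theorem jumpDepth_pos {g q z : ℝ} (hg : 0 < g) (hq : q ≠ 0) (hz : 0 < z) :
    0 < jumpDepth g q z := by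
  have : z < √(z ^ 2 + 8 * q ^ 2 / (g * z)) := by
    refine Real.lt_sqrt_of_sq_lt ?_
    have : 0 < 8 * q ^ 2 / (g * z) := by positivity
    linarith
  unfold jumpDepth; linarith

/-- The relation is symmetric in the two conjugate depths. All monotonicity of stationary shocks is
derived from it. -/
theorem jumpDepth_rel {g q z : ℝ} (hg : 0 < g) (hz : 0 < z) :
    g * (z * jumpDepth g q z * (z + jumpDepth g q z)) = 2 * q ^ 2 := by
  have h : √(z ^ 2 + 8 * q ^ 2 / (g * z)) ^ 2 = z ^ 2 + 8 * q ^ 2 / (g * z) :=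
    Real.sq_sqrt (by positivity)
  have e : √(z ^ 2 + 8 * q ^ 2 / (g * z)) = 2 * jumpDepth g q z + z := by
    unfold jumpDepth; ring
  rw [e] at h
  generalize jumpDepth g q z = x at *
  field_simp at h
  linear_combination h / 4

theorem eq_jumpDepth {g q z x : ℝ} (hg : 0 < g) (hq : q ≠ 0) (hz : 0 < z) (hx : 0 < x)
    (h : g * (z * x * (z + x)) = 2 * q ^ 2) : x = jumpDepth g q z := by
  have h1 := jumpDepth_rel (q := q) hg hz
  have h2 := jumpDepth_pos hg hq hz
  generalize jumpDepth g q z = y at *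
  have h3 : z * x * (z + x) = z * y * (z + y) :=
    mul_left_cancel₀ hg.ne' (h.trans h1.symm)
  have h4 : (x - y) * (z * (z + x + y)) = 0 := by linear_combination h3
  rcases mul_eq_zero.1 h4 with h5 | h5
  · linarith
  · exact absurd h5 (by positivity)

theorem jumpDepth_strictAnti {g q z w : ℝ} (hg : 0 < g) (hq : q ≠ 0) (hz : 0 < z) (hzw : z < w) :
    jumpDepth g q w < jumpDepth g q z := by
  have hw := hz.trans hzw
  have h1 := jumpDepth_rel (q := q) hg hz
  have h2 := jumpDepth_pos hg hq hz
  have h3 := jumpDepth_rel (q := q) hg hw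
  have h4 := jumpDepth_pos hg hq hw
  generalize jumpDepth g q z = x at *
  generalize jumpDepth g q w = y at *
  by_contra! hn
  have h5 : z * x * (z + x) = w * y * (w + y) := mul_left_cancel₀ hg.ne' (h1.trans h3.symm)
  have h6 : z * x < w * y := mul_lt_mul hzw hn h2 hw.le
  have h7 : z * x * (z + x) < w * y * (w + y) :=
    mul_lt_mul h6 (by linarith) (by positivity) (by positivity)
  linarith

theorem jumpDepth_hcrit {g q : ℝ} (hg : 0 < g) (hq : q ≠ 0) :
    jumpDepth g q (hcrit g q) = hcrit g q := by
  have hc := hcrit_pos hg hq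
  refine (eq_jumpDepth hg hq hc hc ?_).symm
  rw [← hcrit_cube' hg q]; ring

theorem hcrit_lt_jumpDepth {g q z : ℝ} (hg : 0 < g) (hq : q ≠ 0) (hz : 0 < z)
    (h : z < hcrit g q) : hcrit g q < jumpDepth g q z := by
  have := jumpDepth_strictAnti hg hq hz h
  rwa [jumpDepth_hcrit hg hq] at this

theorem hcrit_le_jumpDepth {g q z : ℝ} (hg : 0 < g) (hq : q ≠ 0) (hz : 0 < z)
    (h : z ≤ hcrit g q) : hcrit g q ≤ jumpDepth g q z := by
  rcases h.eq_or_lt with rfl | h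
  · rw [jumpDepth_hcrit hg hq]
  · exact (hcrit_lt_jumpDepth hg hq hz h).le

/-- The loss of head in a stationary shock. -/
def jumpLoss (g q z : ℝ) : ℝ := specHead g q z - specHead g q (jumpDepth g q z)

theorem jumpLoss_eq {g q z : ℝ} (hg : 0 < g) (hq : q ≠ 0) (hz : 0 < z) :
    jumpLoss g q z = (jumpDepth g q z - z) ^ 3 / (4 * (z * jumpDepth g q z)) := by
  have h1 := jumpDepth_rel (q := q) hg hz
  have h2 := jumpDepth_pos hg hq hz
  unfold jumpLoss specHead colHead
  generalize jumpDepth g q z = x at *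
  have h3 : (q / z) ^ 2 / (2 * g) = x * (z + x) / (4 * z) := by
    field_simp
    linear_combination -2 * h1
  have h4 : (q / x) ^ 2 / (2 * g) = z * (z + x) / (4 * x) := by
    field_simp
    linear_combination -2 * h1
  rw [h3, h4]
  field_simp
  ring

theorem jumpLoss_hcrit {g q : ℝ} (hg : 0 < g) (hq : q ≠ 0) : jumpLoss g q (hcrit g q) = 0 := by
  unfold jumpLoss; rw [jumpDepth_hcrit hg hq, sub_self]

/-- Conjugate depths `z, x` keep `z x (z + x)` fixed. As `z` approaches the critical depth, their
difference shrinks and their product grows, and `jumpLoss_eq` depends on these two only. -/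
theorem jumpLoss_strictAnti {g q z w : ℝ} (hg : 0 < g) (hq : q ≠ 0) (hz : 0 < z) (hzw : z < w)
    (hw' : w ≤ hcrit g q) : jumpLoss g q w < jumpLoss g q z := by
  have hw := hz.trans hzw
  rw [jumpLoss_eq hg hq hz, jumpLoss_eq hg hq hw]
  have h1 := jumpDepth_rel (q := q) hg hz
  have h2 := jumpDepth_pos hg hq hz
  have h3 := jumpDepth_rel (q := q) hg hw
  have h4 := jumpDepth_pos hg hq hw
  have h5 := jumpDepth_strictAnti hg hq hz hzw
  have h6 := hw'.trans (hcrit_le_jumpDepth hg hq hw hw')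
  generalize jumpDepth g q z = x at *
  generalize jumpDepth g q w = y at *
  have e : z * x * (z + x) = w * y * (w + y) := mul_left_cancel₀ hg.ne' (h1.trans h3.symm)
  -- If the sum did not drop, the product would not grow, and `(x - z)² = (z + x)² - 4 z x` could
  -- not drop either.
  have hS : w + y < z + x := by
    by_contra! hn
    have a1 : w * y ≤ z * x := by
      by_contra! hlt
      have := mul_lt_mul hlt hn (by positivity) (by positivity)
      linarith
    have a2 : (z + x) ^ 2 ≤ (w + y) ^ 2 := pow_le_pow_left₀ (by positivity) hn 2
    have a3 : (y - w) ^ 2 < (x - z) ^ 2 := pow_lt_pow_left₀ (by linarith) (by linarith) (by norm_num)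
    nlinarith
  have hP : z * x < w * y := by
    by_contra! hn
    have := mul_lt_mul' hn hS (by positivity) (by positivity)
    linarith
  refine div_lt_div₀ (pow_lt_pow_left₀ (by linarith) (by linarith) (by norm_num)) (by linarith)
    (pow_nonneg (by linarith) 3) (by positivity)

theorem jumpLoss_pos {g q z : ℝ} (hg : 0 < g) (hq : q ≠ 0) (hz : 0 < z) (h : z < hcrit g q) :
    0 < jumpLoss g q z := by
  rw [← jumpLoss_hcrit hg hq]
  exact jumpLoss_strictAnti hg hq hz h le_rfl

theorem continuousOn_jumpLoss {g q : ℝ} (hg : 0 < g) (hq : q ≠ 0) :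
    ContinuousOn (jumpLoss g q) (Ioi 0) := by
  refine (continuousOn_specHead g q).sub ((continuousOn_specHead g q).comp ?_ ?_)
  · unfold jumpDepth
    refine ContinuousOn.div_const (ContinuousOn.add (by fun_prop) (ContinuousOn.sqrt
      (ContinuousOn.add (by fun_prop) (ContinuousOn.div (by fun_prop) (by fun_prop) ?_)))) _
    intro x hx
    exact (mul_pos hg (mem_Ioi.1 hx)).ne'
  · exact fun x hx => jumpDepth_pos hg hq hx

theorem hash_h {g : ℝ} {U : State} (hU : U.h ≠ 0) :
    (hash g U).h = jumpDepth g (disc U) U.h := by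
  unfold hash jumpDepth disc
  have : 8 * (U.h * U.u) ^ 2 / (g * U.h) = 8 * U.h * U.u ^ 2 / g := by
    rcases eq_or_ne g 0 with rfl | hg
    · simp
    · field_simp
  rw [this]

theorem hash_u {g : ℝ} {U : State} : (hash g U).u = disc U / (hash g U).h := by
  unfold hash disc
  rw [mul_comm U.h U.u]

theorem hash_a (g : ℝ) (U : State) : (hash g U).a = U.a := rfl

theorem disc_hash {g : ℝ} {U : State} (hg : 0 < g) (hU : 0 < U.h) (hq : disc U ≠ 0) :
    disc (hash g U) = disc U := by
  have h : (hash g U).h ≠ 0 := by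
    rw [hash_h hU.ne']; exact (jumpDepth_pos hg hq hU).ne'
  unfold disc at *
  rw [hash_u]
  exact mul_div_cancel₀ _ h

theorem head_hash {g : ℝ} {U : State} (hg : 0 < g) (hU : 0 < U.h) (hq : disc U ≠ 0) :
    head g (hash g U) = head g U - jumpLoss g (disc U) U.h := by
  have h : 0 < (hash g U).h := by
    rw [hash_h hU.ne']; exact jumpDepth_pos hg hq hU
  rw [head_eq_specHead h, disc_hash hg hU hq, hash_h hU.ne', head_eq_specHead hU]
  unfold jumpLoss; ring

/-- The conjugate depth is the one at which the relative shock speed balances the flow. The absolute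
value covers stationary 1-shocks (`u > 0`) and 2-shocks (`u < 0`) at once. -/
theorem jumpDepth_mul_kap {g h u : ℝ} (hg : 0 < g) (hh : 0 < h) (hu : u ≠ 0) :
    jumpDepth g (h * u) h * kap g h (jumpDepth g (h * u) h) = |u| := by
  have hq : h * u ≠ 0 := mul_ne_zero hh.ne' hu
  have h1 := jumpDepth_rel (q := h * u) hg hh
  have h2 := jumpDepth_pos hg hq hh
  generalize jumpDepth g (h * u) h = x at *
  have h3 := mul_kap_sq hg hh h2
  have h4 := kap_pos hg hh h2
  rw [← abs_of_pos (mul_pos h2 h4), ← sq_eq_sq_iff_abs_eq_abs]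
  have : (2 * h ^ 2) * ((x * kap g h x) ^ 2 - u ^ 2) = 0 := by linear_combination h * h3 + h1
  rcases mul_eq_zero.1 this with h5 | h5
  · exact absurd h5 (by positivity)
  · linarith

theorem mul_kap_le_iff {g h₀ x y : ℝ} (hg : 0 < g) (h0 : 0 < h₀) (hx : 0 < x) (hy : 0 < y) :
    x * kap g h₀ x ≤ y * kap g h₀ y ↔ x ≤ y := by
  constructor
  · intro h; by_contra! hn; exact absurd h (mul_kap_strictMono hg h0 hy hn).not_ge
  · intro h
    rcases h.eq_or_lt with rfl | h
    · exact le_rfl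
    · exact (mul_kap_strictMono hg h0 hx h).le

/-! ### The wave curves in the plane of discharge and head -/

/-- The state of height `h` on the forward 1-wave curve of `U`. -/
def wave1State (g : ℝ) (U : State) (h : ℝ) : State := ⟨h, U.u - velJump g U.h h, U.a⟩

theorem mem_W1_iff {g : ℝ} {U V : State} : V ∈ W1 g U ↔ 0 < V.h ∧ V = wave1State g U V.h := by
  unfold W1
  refine and_congr_right fun _ => ?_
  rw [psi1_eq, State.ext_iff]
  simp only [wave1State, true_and]
  constructor
  · rintro ⟨h1, h2⟩; exact ⟨by linarith, h1⟩
  · rintro ⟨h1, h2⟩; exact ⟨h2, by linarith⟩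

/-- A 1-shock is the mirror image of a 2-shock: reversing the velocities turns `hs`, a nonpositive
shock speed, into the hypothesis of `shock_flux_strictMono`. The head is even in the velocity, so it
keeps its direction while the discharge reverses. -/
theorem left_disc_lt {g : ℝ} {U : State} {x y : ℝ} (hg : 0 < g) (h0 : 0 < U.h) (hx : U.h ≤ x)
    (hxy : x < y) (hs : U.u ≤ x * kap g U.h x) :
    disc (wave1State g U y) < disc (wave1State g U x) := by
  have := shock_flux_strictMono (u₀ := -U.u) hg h0 hx hxy (by linarith)
  simp only [disc, wave1State]
  rw [velJump_of_ge hx, velJump_of_ge (hx.trans hxy.le)]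
  nlinarith

theorem left_head_lt {g : ℝ} {U : State} {x y : ℝ} (hg : 0 < g) (h0 : 0 < U.h) (hx : U.h ≤ x)
    (hxy : x < y) (hs : U.u ≤ x * kap g U.h x) :
    head g (wave1State g U x) < head g (wave1State g U y) := by
  have := shock_head_strictMono (u₀ := -U.u) hg h0 hx hxy (by linarith)
  simp only [head, wave1State]
  rw [velJump_of_ge hx, velJump_of_ge (hx.trans hxy.le)]
  convert this using 1 <;> unfold colHead <;> ring

theorem left_lambda2_lt {g : ℝ} {U : State} {x y : ℝ} (hg : 0 < g) (h0 : 0 < U.h) (hx : 0 ≤ x)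
    (hxy : x < y) : lambda2 g (wave1State g U y) < lambda2 g (wave1State g U x) := by
  have := rarJump_le_velJump_sub hg h0 hxy.le
  rw [rarJump_eq hg] at this
  have h2 := sqrt_lt_sqrt_mul hg hx hxy
  simp only [lambda2, wave1State]
  linarith

theorem left_lambda1_neg {g : ℝ} {U : State} {x : ℝ} (hg : 0 < g) (h0 : 0 < U.h) (hx : U.h < x)
    (hs : U.u ≤ x * kap g U.h x) : lambda1 g (wave1State g U x) < 0 := by
  have hx0 := h0.trans hx
  have h1 := mul_kap_lt_sqrt hg h0 hx
  have h2 := sqrt_lt_sqrt_mul hg h0.le hx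
  simp only [lambda1, wave1State]
  rw [velJump_of_lt hx, shockJump_eq]
  nlinarith

theorem continuous_wave1State {g : ℝ} {U : State} (h0 : 0 < U.h) :
    Continuous fun h => (wave1State g U h).u :=
  continuous_const.sub (continuous_velJump h0)

/-- In the plane of discharge and head the part `λ₂ ≥ 0` of the backward 2-wave curve is increasing.
The rarefaction and shock branches are joined at `R`, and `λ₂(R) > 0` makes all the shocks move to
the right. -/
theorem right_mono {g : ℝ} {R V V' : State} (hg : 0 < g) (hR : 0 < R.h) (hR2 : 0 < lambda2 g R)
    (hV0 : 0 ≤ V.h) (hV : phi2 g V R = 0) (hV' : phi2 g V' R = 0) (hl : 0 ≤ lambda2 g V)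
    (hlt : V.h < V'.h) : disc V < disc V' ∧ head g V < head g V' := by
  rw [phi2_eq] at hV hV'
  have hu : V.u = R.u + velJump g R.h V.h := by linarith
  have hu' : V'.u = R.u + velJump g R.h V'.h := by linarith
  have shock : ∀ x y, R.h ≤ x → x < y →
      x * (R.u + velJump g R.h x) < y * (R.u + velJump g R.h y) ∧
      colHead g x (R.u + velJump g R.h x) < colHead g y (R.u + velJump g R.h y) := by
    intro x y hx hxy
    have hs : 0 ≤ R.u + x * kap g R.h x := by
      have h1 : √(g * R.h) ≤ √(g * x) := Real.sqrt_le_sqrt (by nlinarith)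
      unfold lambda2 at hR2
      -- At zero strength the relative shock speed is `√(g R.h)`, so `hs` reduces to `λ₂(R) ≥ 0`.
      rcases hx.eq_or_lt with h | h
      · have := mul_kap_sq hg hR hR
        have h3 : √(g * R.h) = R.h * kap g R.h R.h := by
          rw [Real.sqrt_eq_iff_mul_self_eq (by positivity)
            (mul_pos hR (kap_pos hg hR hR)).le]
          have : (2 * R.h) * (R.h * kap g R.h R.h * (R.h * kap g R.h R.h) - g * R.h) = 0 := by
            linear_combination this
          rcases mul_eq_zero.1 this with h5 | h5
          · exact absurd h5 (by positivity)
          · linarith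
        rw [← h, ← h3]; linarith
      · linarith [sqrt_lt_mul_kap hg hR h]
    rw [velJump_of_ge hx, velJump_of_ge (hx.trans hxy.le)]
    exact ⟨shock_flux_strictMono hg hR hx hxy hs, shock_head_strictMono hg hR hx hxy hs⟩
  have rar : ∀ y, y ≤ R.h → V.h < y →
      V.h * (R.u + velJump g R.h V.h) < y * (R.u + velJump g R.h y) ∧
      colHead g V.h (R.u + velJump g R.h V.h) < colHead g y (R.u + velJump g R.h y) := by
    intro y hy hxy
    unfold lambda2 at hl
    rw [hu] at hl
    rw [velJump_of_le hy, velJump_of_le (hxy.le.trans hy)]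
    rw [velJump_of_le (hxy.le.trans hy)] at hl
    exact ⟨rar_flux_strictMono hg hV0 hxy hl, rar_head_strictMono hg hV0 hxy hl⟩
  unfold disc head
  rw [hu, hu']
  rcases le_or_gt V'.h R.h with h1 | h1
  · exact rar _ h1 hlt
  rcases le_or_gt R.h V.h with h2 | h2
  · exact shock _ _ h2 hlt
  · have a := rar _ le_rfl h2
    have b := shock _ _ le_rfl h1
    exact ⟨a.1.trans b.1, a.2.trans b.2⟩

theorem eq_of_phi2 {g : ℝ} {R V V' : State} (hV : phi2 g V R = 0) (hV' : phi2 g V' R = 0)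
    (hh : V.h = V'.h) (ha : V.a = V'.a) : V = V' := by
  rw [phi2_eq] at hV hV'
  rw [hh] at hV
  exact State.ext hh (by linarith) ha

/-! ### Speeds of single waves -/

theorem shock1_speed {g : ℝ} {U W : State} (h : Links g shock1 U W) :
    shockSpeed U W = U.u - W.h * kap g U.h W.h ∧ shockSpeed U W = W.u - U.h * kap g U.h W.h := by
  obtain ⟨h0, h1, -, h2⟩ := h
  have h3 : W.h - U.h ≠ 0 := (sub_pos.2 h1).ne'
  rw [shockJump_eq] at h2
  unfold shockSpeed
  rw [h2]
  constructor <;> (rw [div_eq_iff h3]; ring)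

theorem shock2_speed {g : ℝ} {U W : State} (h : Links g shock2 U W) :
    shockSpeed U W = U.u + W.h * kap g W.h U.h ∧ shockSpeed U W = W.u + U.h * kap g W.h U.h := by
  obtain ⟨h0, h1, -, h2⟩ := h
  have h3 : W.h - U.h ≠ 0 := (sub_neg.2 h1).ne
  rw [shockJump_eq, kap_comm] at h2
  unfold shockSpeed
  rw [h2]
  constructor <;> (rw [div_eq_iff h3]; ring)

theorem shock1_lax {g : ℝ} {U W : State} (hg : 0 < g) (h : Links g shock1 U W) :
    shockSpeed U W < lambda1 g U ∧ lambda1 g W < shockSpeed U W ∧ shockSpeed U W < W.u := by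
  have e := shock1_speed h
  obtain ⟨h0, h1, -, -⟩ := h
  have a := sqrt_lt_mul_kap hg h0 h1
  have b := mul_kap_lt_sqrt hg h0 h1
  have c := sqrt_lt_sqrt_mul hg h0.le h1
  have d := mul_pos h0 (kap_pos hg h0 (h0.trans h1))
  unfold lambda1
  refine ⟨?_, ?_, ?_⟩ <;> linarith

theorem shock2_lax {g : ℝ} {U W : State} (hg : 0 < g) (h : Links g shock2 U W) :
    lambda2 g W < shockSpeed U W ∧ shockSpeed U W < lambda2 g U ∧ U.u < shockSpeed U W ∧
      W.u < shockSpeed U W := by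
  have e := shock2_speed h
  obtain ⟨h0, h1, -, -⟩ := h
  have a := sqrt_lt_mul_kap hg h0 h1
  have b := mul_kap_lt_sqrt hg h0 h1
  have c := sqrt_lt_sqrt_mul hg h0.le h1
  have d := mul_pos h0 (kap_pos hg h0 (h0.trans h1))
  have d' := mul_pos (h0.trans h1) (kap_pos hg h0 (h0.trans h1))
  unfold lambda2
  refine ⟨?_, ?_, ?_, ?_⟩ <;> linarith

theorem rar1_lambda1 {g : ℝ} {U W : State} (hg : 0 < g) (h : Links g rar1 U W) :
    lambda1 g U < lambda1 g W := by
  obtain ⟨h0, h1, -, h2⟩ := h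
  have c := sqrt_lt_sqrt_mul hg h0 h1
  rw [rarJump_eq hg] at h2
  unfold lambda1; linarith

theorem rar2_lambda2 {g : ℝ} {U W : State} (hg : 0 < g) (h : Links g rar2 U W) :
    lambda2 g U < lambda2 g W := by
  obtain ⟨h0, h1, -, h2⟩ := h
  have c := sqrt_lt_sqrt_mul hg h0 h1
  rw [rarJump_eq hg] at h2
  unfold lambda2; linarith

theorem lambda1_lt_u {g : ℝ} {U : State} (hg : 0 < g) (hU : 0 < U.h) : lambda1 g U < U.u := by
  have : 0 < √(g * U.h) := by positivity
  unfold lambda1; linarith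

theorem u_lt_lambda2 {g : ℝ} {U : State} (hg : 0 < g) (hU : 0 < U.h) : U.u < lambda2 g U := by
  have : 0 < √(g * U.h) := by positivity
  unfold lambda2; linarith

theorem links_wave1 {g : ℝ} {k : WaveKind} {U W : State} (hk : k = shock1 ∨ k = rar1)
    (h : Links g k U W) : W = wave1State g U W.h ∧ 0 < U.h ∧ 0 ≤ W.h := by
  rcases hk with rfl | rfl <;> obtain ⟨h0, h1, h2, h3⟩ := h
  · refine ⟨?_, h0, (h0.trans h1).le⟩
    unfold wave1State; rw [velJump_of_lt h1]; exact State.ext rfl h3 h2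
  · refine ⟨?_, h0.trans_lt h1, h0⟩
    unfold wave1State; rw [velJump_of_le h1.le]; exact State.ext rfl h3 h2

theorem links_wave2 {g : ℝ} {k : WaveKind} {U W : State} (hk : k = shock2 ∨ k = rar2)
    (h : Links g k U W) : phi2 g U W = 0 ∧ W.a = U.a ∧ 0 < W.h ∧ 0 ≤ U.h := by
  rcases hk with rfl | rfl <;> obtain ⟨h0, h1, h2, h3⟩ := h
  · refine ⟨?_, h2, h0, (h0.trans h1).le⟩
    rw [phi2_eq, velJump_of_lt h1, h3, shockJump_eq, shockJump_eq, kap_comm]; ring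
  · refine ⟨?_, h2, h0.trans_lt h1, h0⟩
    rw [phi2_eq, velJump_of_le h1.le, h3]; unfold rarJump; ring

theorem links_rar1_wave1State {g : ℝ} {U : State} {h : ℝ} (h0 : 0 ≤ h) (hU : h < U.h) :
    Links g rar1 U (wave1State g U h) :=
  ⟨h0, hU, rfl, by simp only [wave1State]; rw [velJump_of_le hU.le]⟩

theorem links_shock1_wave1State {g : ℝ} {U : State} {h : ℝ} (h0 : 0 < U.h) (hU : U.h < h) :
    Links g shock1 U (wave1State g U h) :=
  ⟨h0, hU, rfl, by simp only [wave1State]; rw [velJump_of_lt hU]⟩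

theorem links_rar2_of_phi2 {g : ℝ} {U W : State} (h0 : 0 ≤ U.h) (h : U.h < W.h)
    (hp : phi2 g U W = 0) (ha : W.a = U.a) : Links g rar2 U W := by
  rw [phi2_eq, velJump_of_le h.le] at hp
  refine ⟨h0, h, ha, ?_⟩
  unfold rarJump at *; linarith

theorem links_shock2_of_phi2 {g : ℝ} {U W : State} (h0 : 0 < W.h) (h : W.h < U.h)
    (hp : phi2 g U W = 0) (ha : W.a = U.a) : Links g shock2 U W := by
  rw [phi2_eq, velJump_of_lt h, shockJump_eq, kap_comm] at hp
  refine ⟨h0, h, ha, ?_⟩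
  rw [shockJump_eq]; linarith

/-! ### Fans without contacts -/

/-- The 1-wave from `U` to `M`, if it is not trivial. -/
def wave1Fan (U M : State) : Fan :=
  if M.h < U.h then [(rar1, M)] else if U.h < M.h then [(shock1, M)] else []

/-- The 2-wave from `U` to `R`, if it is not trivial. -/
def wave2Fan (U R : State) : Fan :=
  if U.h < R.h then [(rar2, R)] else if R.h < U.h then [(shock2, R)] else []

theorem wave2Fan_rar {U R : State} (h : U.h < R.h) : wave2Fan U R = [(rar2, R)] := if_pos h

theorem wave2Fan_shock {U R : State} (h : R.h < U.h) : wave2Fan U R = [(shock2, R)] := by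
  unfold wave2Fan; rw [if_neg h.not_gt, if_pos h]

theorem wave2Fan_self (U : State) : wave2Fan U U = [] := by simp [wave2Fan]

theorem wave1Fan_rar {U M : State} (h : M.h < U.h) : wave1Fan U M = [(rar1, M)] := if_pos h

theorem wave1Fan_shock {U M : State} (h : U.h < M.h) : wave1Fan U M = [(shock1, M)] := by
  unfold wave1Fan; rw [if_neg h.not_gt, if_pos h]

theorem wave1Fan_self (U : State) : wave1Fan U U = [] := by simp [wave1Fan]

theorem wave2Fan_of_links {g : ℝ} {k : WaveKind} {U W : State} (hk : k = shock2 ∨ k = rar2)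
    (h : Links g k U W) : wave2Fan U W = [(k, W)] := by
  rcases hk with rfl | rfl <;> obtain ⟨h0, h1, h2, h3⟩ := h
  · exact wave2Fan_shock h1
  · exact wave2Fan_rar h1

theorem wave1Fan_of_links {g : ℝ} {k : WaveKind} {U W : State} (hk : k = shock1 ∨ k = rar1)
    (h : Links g k U W) : wave1Fan U W = [(k, W)] := by
  rcases hk with rfl | rfl <;> obtain ⟨h0, h1, h2, h3⟩ := h
  · exact wave1Fan_shock h1
  · exact wave1Fan_rar h1

/-- The dry state from which a 2-rarefaction wave leads to `R`. -/
def dryState (g : ℝ) (R : State) : State := ⟨0, R.u + velJump g R.h 0, R.a⟩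

theorem phi2_dryState (g : ℝ) (R : State) : phi2 g (dryState g R) R = 0 := by
  rw [phi2_eq]; simp [dryState]

/-- A fan from `V` to `R` without contacts: a 1-wave and a 2-wave, or two rarefaction waves
separated by a dry zone. -/
def IsPureFan (g : ℝ) (V R : State) (F : Fan) : Prop :=
  V.a = R.a ∧
  ((∃ h, 0 ≤ h ∧ phi2 g (wave1State g V h) R = 0 ∧
      F = wave1Fan V (wave1State g V h) ++ wave2Fan (wave1State g V h) R) ∨
    (phi2 g (wave1State g V 0) R < 0 ∧
      F = [(rar1, wave1State g V 0), (dry, dryState g R), (rar2, R)]))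

theorem phi2_wave1State_lt {g : ℝ} {V R : State} {x y : ℝ} (hg : 0 < g) (hV : 0 < V.h)
    (hR : 0 < R.h) (hx : 0 ≤ x) (hxy : x < y) :
    phi2 g (wave1State g V y) R < phi2 g (wave1State g V x) R := by
  have h1 := velJump_strictMono hg hV hx hxy
  have h2 := velJump_strictMono hg hR hx hxy
  rw [phi2_eq, phi2_eq]
  simp only [wave1State]
  linarith

theorem phi2_wave1State_le {g : ℝ} {V R : State} {x y : ℝ} (hg : 0 < g) (hV : 0 < V.h)
    (hR : 0 < R.h) (hx : 0 ≤ x) (hxy : x ≤ y) :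
    phi2 g (wave1State g V y) R ≤ phi2 g (wave1State g V x) R := by
  rcases hxy.eq_or_lt with rfl | h
  · exact le_rfl
  · exact (phi2_wave1State_lt hg hV hR hx h).le

/-- `Φ₂` decreases strictly along the 1-wave curve, so it has at most one zero there. A dry zone
occurs exactly when it is already negative at depth `0`. -/
theorem IsPureFan.unique {g : ℝ} {V R : State} {F F' : Fan} (hg : 0 < g) (hV : 0 < V.h)
    (hR : 0 < R.h) (h : IsPureFan g V R F) (h' : IsPureFan g V R F') : F = F' := by
  obtain ⟨-, ⟨x, hx, hpx, rfl⟩ | ⟨hp, rfl⟩⟩ := h <;>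
    obtain ⟨-, ⟨y, hy, hpy, rfl⟩ | ⟨hp', rfl⟩⟩ := h'
  · have : x = y := by
      rcases lt_trichotomy x y with h | h | h
      · linarith [phi2_wave1State_lt hg hV hR hx h]
      · exact h
      · linarith [phi2_wave1State_lt hg hV hR hy h]
    rw [this]
  · linarith [phi2_wave1State_le hg hV hR le_rfl hx]
  · linarith [phi2_wave1State_le hg hV hR le_rfl hy]
  · rfl

/-! ### Passing to the tail of a solution -/

/-- The speed condition between a wave and the fan that follows it. -/
def Follows (g : ℝ) (k : WaveKind) (U W : State) : Fan → Prop
  | [] => True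
  | (k', W') :: _ => k ≠ k' ∧ rightSpeed g k U W ≤ leftSpeed g k' W W'

theorem ordered_cons {g : ℝ} {k : WaveKind} {U W : State} {F : Fan} :
    Ordered g U ((k, W) :: F) ↔ Follows g k U W F ∧ Ordered g W F := by
  cases F with
  | nil => simp [Follows, Ordered]
  | cons p F => obtain ⟨k', W'⟩ := p; simp [Follows, Ordered, and_assoc]

theorem abs_le_bottomVariation {g : ℝ} {R : State} : ∀ (F : Fan) (U : State), Joins g U F R →
    |U.a - R.a| ≤ bottomVariation U F
  | [], U, h => by obtain rfl : U = R := h; simp [bottomVariation]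
  | (k, W) :: F, U, h => by
    have := abs_le_bottomVariation F W h.2
    have h2 := abs_sub_le U.a W.a R.a
    have h3 := abs_sub_comm U.a W.a
    simp only [bottomVariation]
    linarith

/-- The remaining fan varies the bottom by at least `|W.a - R.a|`, so the bound on the total
variation splits into the same bound for the tail and the condition that the level of `W` lies
between those of `U` and `R`. -/
theorem solution_cons {g : ℝ} {k : WaveKind} {U W R : State} {F : Fan} :
    IsRiemannSolution g U R ((k, W) :: F) ↔ Links g k U W ∧ Follows g k U W F ∧
      IsRiemannSolution g W R F ∧ |W.a - U.a| + |W.a - R.a| ≤ |U.a - R.a| := by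
  unfold IsRiemannSolution
  rw [ordered_cons]
  simp only [Joins, bottomVariation]
  constructor
  · rintro ⟨⟨h1, h2⟩, ⟨h3, h4⟩, h5⟩
    have h6 := abs_le_bottomVariation F W h2
    have h7 := abs_sub_le U.a W.a R.a
    have h8 := abs_sub_comm U.a W.a
    exact ⟨h1, h3, ⟨h2, h4, by linarith⟩, by linarith⟩
  · rintro ⟨h1, h3, ⟨h2, h4, h5⟩, h6⟩
    exact ⟨⟨h1, h2⟩, ⟨h3, h4⟩, by linarith⟩

theorem solution_nil {g : ℝ} {U R : State} : IsRiemannSolution g U R [] ↔ U = R := by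
  unfold IsRiemannSolution
  simp [Joins, Ordered, bottomVariation]

theorem contact_h_pos {g : ℝ} {U W : State} (h : Links g contact U W) : 0 < U.h ∧ 0 < W.h :=
  ⟨h.1.1, h.1.2.1⟩

/-- Behind a 2-wave a 1-wave is too slow, and a 2-wave of the other kind contradicts the Lax
inequalities. Only a contact may follow, and then the 2-wave must have nonpositive speed. -/
theorem after_wave2 {g : ℝ} {k : WaveKind} {U W R : State} {F : Fan} (hg : 0 < g)
    (hk : k = shock2 ∨ k = rar2) (hl : Links g k U W) (hf : Follows g k U W F)
    (hs : IsRiemannSolution g W R F) :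
    (F = [] ∧ W = R) ∨ (rightSpeed g k U W ≤ 0 ∧ lambda2 g W ≤ 0 ∧
      ∃ V F', F = (contact, V) :: F') := by
  have hW := (links_wave2 hk hl).2.2.1
  have hr : lambda2 g W ≤ rightSpeed g k U W := by
    rcases hk with rfl | rfl
    · exact (shock2_lax hg hl).1.le
    · exact le_rfl
  have hr' : W.u < rightSpeed g k U W := (u_lt_lambda2 hg hW).trans_le hr
  cases F with
  | nil => exact .inl ⟨rfl, solution_nil.1 hs⟩
  | cons p F =>
    obtain ⟨k', W'⟩ := p
    right
    obtain ⟨hl', -, -, -⟩ := solution_cons.1 hs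
    obtain ⟨hne, hsp⟩ := hf
    cases k' with
    | contact => exact ⟨hsp, hr.trans hsp, W', F, rfl⟩
    | shock1 =>
      have := (shock1_lax hg hl').1
      have := lambda1_lt_u hg hW
      simp only [leftSpeed] at hsp; linarith
    | rar1 =>
      have := lambda1_lt_u hg hW
      simp only [leftSpeed] at hsp; linarith
    | dry => exact absurd hl'.1 hW.ne'
    | shock2 =>
      rcases hk with rfl | rfl
      · exact absurd rfl hne
      · have := (shock2_lax hg hl').2.1
        simp only [leftSpeed, rightSpeed] at hsp; linarith
    | rar2 =>
      rcases hk with rfl | rfl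
      · have := (shock2_lax hg hl).1
        simp only [leftSpeed, rightSpeed] at hsp; linarith
      · exact absurd rfl hne

theorem after_shock1 {g : ℝ} {U W R : State} {F : Fan} (hg : 0 < g)
    (hl : Links g shock1 U W) (hf : Follows g shock1 U W F) (hs : IsRiemannSolution g W R F) :
    (F = [] ∧ W = R) ∨ (∃ V F', F = (contact, V) :: F' ∧ shockSpeed U W ≤ 0) ∨
      (∃ k V F', (k = shock2 ∨ k = rar2) ∧ F = (k, V) :: F') := by
  have hW : 0 < W.h := hl.1.trans hl.2.1
  cases F with
  | nil => exact .inl ⟨rfl, solution_nil.1 hs⟩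
  | cons p F =>
    obtain ⟨k', W'⟩ := p
    right
    obtain ⟨hl', -, -, -⟩ := solution_cons.1 hs
    obtain ⟨hne, hsp⟩ := hf
    cases k' with
    | contact => exact .inl ⟨W', F, rfl, hsp⟩
    | shock1 => exact absurd rfl hne
    | rar1 =>
      have := (shock1_lax hg hl).2.1
      simp only [leftSpeed, rightSpeed] at hsp; linarith
    | dry => exact absurd hl'.1 hW.ne'
    | shock2 => exact .inr ⟨_, W', F, .inl rfl, rfl⟩
    | rar2 => exact .inr ⟨_, W', F, .inr rfl, rfl⟩

theorem pure_of_wave2 {g : ℝ} {k : WaveKind} {V R : State} (hk : k = shock2 ∨ k = rar2)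
    (hl : Links g k V R) : IsPureFan g V R [(k, R)] := by
  obtain ⟨h1, h2, h3, h4⟩ := links_wave2 hk hl
  have e : wave1State g V V.h = V := by
    simp only [wave1State, velJump_self, sub_zero]
  refine ⟨h2.symm, .inl ⟨V.h, h4, by rwa [e], ?_⟩⟩
  rw [e, wave1Fan_self, wave2Fan_of_links hk hl]; rfl

theorem pure_of_wave1 {g : ℝ} {k : WaveKind} {V M : State} (hk : k = shock1 ∨ k = rar1)
    (hl : Links g k V M) : IsPureFan g V M [(k, M)] := by
  obtain ⟨h1, h2, h3⟩ := links_wave1 hk hl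
  refine ⟨by rw [h1]; rfl, .inl ⟨M.h, h3, ?_, ?_⟩⟩
  · rw [← h1, phi2_eq, velJump_self]; ring
  · rw [← h1, wave2Fan_self, wave1Fan_of_links hk hl]; rfl

theorem pure_of_wave1_wave2 {g : ℝ} {k k' : WaveKind} {V M R : State}
    (hk : k = shock1 ∨ k = rar1) (hk' : k' = shock2 ∨ k' = rar2)
    (hl : Links g k V M) (hl' : Links g k' M R) : IsPureFan g V R [(k, M), (k', R)] := by
  obtain ⟨h1, h2, h3⟩ := links_wave1 hk hl
  obtain ⟨h4, h5, h6, h7⟩ := links_wave2 hk' hl'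
  refine ⟨by rw [h5, h1]; rfl, .inl ⟨M.h, h3, ?_, ?_⟩⟩
  · rw [← h1, h4]
  · rw [← h1, wave1Fan_of_links hk hl, wave2Fan_of_links hk' hl']; rfl

theorem pure_nil {g : ℝ} {V : State} (hV : 0 ≤ V.h) : IsPureFan g V V [] := by
  have e : wave1State g V V.h = V := by
    simp only [wave1State, velJump_self, sub_zero]
  refine ⟨rfl, .inl ⟨V.h, hV, ?_, ?_⟩⟩
  · rw [e, phi2_eq, velJump_self]; ring
  · rw [e, wave1Fan_self, wave2Fan_self]; rfl

/-- A rarefaction strictly increases `λ₁`, so from `λ₁(V) ≥ 0` on all later speeds are positive and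
no contact fits in. -/
theorem pure_of_rar1 {g : ℝ} {V W R : State} {F : Fan} (hg : 0 < g)
    (hR : 0 < R.h) (hl1 : 0 ≤ lambda1 g V) (hl : Links g rar1 V W) (hf : Follows g rar1 V W F)
    (hs : IsRiemannSolution g W R F) : IsPureFan g V R ((rar1, W) :: F) := by
  have hW1 := rar1_lambda1 hg hl
  obtain ⟨e1, e2, e3⟩ := links_wave1 (.inr rfl) hl
  have two : ∀ k W' F', (k = shock2 ∨ k = rar2) → F = (k, W') :: F' → F' = [] ∧ W' = R := by
    rintro k W' F' hk rfl
    obtain ⟨hl', hf', hs', -⟩ := solution_cons.1 hs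
    rcases after_wave2 hg hk hl' hf' hs' with h | ⟨h, -⟩
    · exact h
    · exfalso
      have : lambda1 g W ≤ leftSpeed g k W W' := hf.2
      have : leftSpeed g k W W' ≤ rightSpeed g k W W' := by
        rcases hk with rfl | rfl
        · exact le_rfl
        · exact (rar2_lambda2 hg hl').le
      linarith
  cases F with
  | nil =>
    obtain rfl := solution_nil.1 hs
    exact pure_of_wave1 (.inr rfl) hl
  | cons p F =>
    obtain ⟨k', W'⟩ := p
    obtain ⟨hl', hf', hs', -⟩ := solution_cons.1 hs
    cases k' with
    | contact => have := hf.2; simp only [leftSpeed, rightSpeed] at this; linarith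
    | rar1 => exact absurd rfl hf.1
    | shock1 =>
      have := (shock1_lax hg hl').1
      have := hf.2
      simp only [leftSpeed, rightSpeed] at this; linarith
    | shock2 =>
      obtain ⟨rfl, rfl⟩ := two _ _ _ (.inl rfl) rfl
      exact pure_of_wave1_wave2 (.inr rfl) (.inl rfl) hl hl'
    | rar2 =>
      obtain ⟨rfl, rfl⟩ := two _ _ _ (.inr rfl) rfl
      exact pure_of_wave1_wave2 (.inr rfl) (.inr rfl) hl hl'
    | dry =>
      obtain ⟨hW0, hW'0, ha, hu⟩ := hl'
      cases F with
      | nil =>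
        obtain rfl := solution_nil.1 hs'
        exact absurd hW'0 hR.ne'
      | cons p F =>
        obtain ⟨k, Z⟩ := p
        obtain ⟨hl'', hf'', hs'', -⟩ := solution_cons.1 hs'
        cases k with
        | contact => exact absurd hW'0 (contact_h_pos hl'').1.ne'
        | shock1 => exact absurd hW'0 hl''.1.ne'
        | rar1 => exact absurd hW'0 ((hl''.1.trans_lt hl''.2.1).ne')
        | shock2 => exact absurd hW'0 ((hl''.1.trans hl''.2.1).ne')
        | dry => exact absurd rfl hf'.1
        | rar2 =>
          obtain ⟨i1, i2, i3, i4⟩ := links_wave2 (.inr rfl) hl''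
          have hlam : lambda1 g W = W.u := by simp [lambda1, hW0]
          have hZ : 0 < lambda2 g Z := by
            have := rar2_lambda2 hg hl''
            have : lambda2 g W' = W'.u := by simp [lambda2, hW'0]
            linarith
          rcases after_wave2 hg (.inr rfl) hl'' hf'' hs'' with ⟨rfl, rfl⟩ | ⟨-, h, -⟩
          · rw [hW0] at e1
            have eW' : W' = dryState g Z := by
              refine State.ext hW'0 ?_ i2.symm
              rw [phi2_eq, hW'0] at i1
              simp only [dryState]; linarith
            refine ⟨by rw [i2, ha, e1]; rfl, .inr ⟨?_, ?_⟩⟩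
            · rw [← e1, phi2_eq, hW0]
              rw [phi2_eq, hW'0] at i1
              linarith
            · rw [← e1, ← eW']
          · linarith

/-- The beginning of a solution whose left-hand state is not subcritical. -/
theorem start_classify {g : ℝ} {V R : State} {F : Fan} (hg : 0 < g) (hV : 0 < V.h)
    (hR : 0 < R.h) (hl1 : 0 ≤ lambda1 g V) (hs : IsRiemannSolution g V R F) :
    IsPureFan g V R F ∨ (∃ W F', F = (contact, W) :: F') ∨
    (∃ U W F', F = (shock1, U) :: (contact, W) :: F' ∧ shockSpeed V U ≤ 0) ∨
    (∃ k U Q W F', (k = shock2 ∨ k = rar2) ∧ F = (shock1, U) :: (k, Q) :: (contact, W) :: F' ∧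
      rightSpeed g k U Q ≤ 0) := by
  have hu := lambda1_lt_u hg hV
  have two : ∀ k W' F', (k = shock2 ∨ k = rar2) → F = (k, W') :: F' → F' = [] ∧ W' = R := by
    rintro k W' F' hk rfl
    obtain ⟨hl', hf', hs', -⟩ := solution_cons.1 hs
    rcases after_wave2 hg hk hl' hf' hs' with h | ⟨h, -⟩
    · exact h
    · exfalso
      have : V.u < rightSpeed g k V W' := by
        rcases hk with rfl | rfl
        · exact (shock2_lax hg hl').2.2.1
        · exact (u_lt_lambda2 hg hV).trans (rar2_lambda2 hg hl')
      linarith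
  cases F with
  | nil =>
    obtain rfl := solution_nil.1 hs
    exact .inl (pure_nil hV.le)
  | cons p F =>
    obtain ⟨k', W⟩ := p
    obtain ⟨hl, hf, hs', -⟩ := solution_cons.1 hs
    cases k' with
    | contact => exact .inr (.inl ⟨W, F, rfl⟩)
    | rar1 => exact .inl (pure_of_rar1 hg hR hl1 hl hf hs')
    | shock2 =>
      obtain ⟨rfl, rfl⟩ := two _ _ _ (.inl rfl) rfl
      exact .inl (pure_of_wave2 (.inl rfl) hl)
    | rar2 =>
      obtain ⟨rfl, rfl⟩ := two _ _ _ (.inr rfl) rfl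
      exact .inl (pure_of_wave2 (.inr rfl) hl)
    | dry => exact absurd hl.1 hV.ne'
    | shock1 =>
      rcases after_shock1 hg hl hf hs' with ⟨rfl, rfl⟩ | ⟨Z, F', rfl, h⟩ | ⟨k, Q, F', hk, rfl⟩
      · exact .inl (pure_of_wave1 (.inl rfl) hl)
      · exact .inr (.inr (.inl ⟨_, _, _, rfl, h⟩))
      · obtain ⟨hl2, hf2, hs2, -⟩ := solution_cons.1 hs'
        rcases after_wave2 hg hk hl2 hf2 hs2 with ⟨rfl, rfl⟩ | ⟨h, -, Z, F'', rfl⟩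
        · exact .inl (pure_of_wave1_wave2 (.inl rfl) hk hl hl2)
        · exact .inr (.inr (.inr ⟨_, _, _, _, _, hk, rfl, h⟩))

/-- The part of a solution behind a contact whose right-hand state is not supercritical. -/
theorem tail_classify {g : ℝ} {U V R : State} {F : Fan} (hg : 0 < g) (hR : 0 < R.h)
    (hR2 : 0 < lambda2 g R) (hV : 0 < V.h) (hl1 : lambda1 g V ≤ 0)
    (hf : Follows g contact U V F) (hs : IsRiemannSolution g V R F) :
    (phi2 g V R = 0 ∧ V.a = R.a ∧ 0 ≤ lambda2 g V ∧ F = wave2Fan V R) ∨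
    (lambda1 g V = 0 ∧ IsPureFan g V R F) ∨
    (∃ Z Y F', F = (shock2, Z) :: (contact, Y) :: F' ∧ shockSpeed V Z = 0) := by
  cases F with
  | nil =>
    obtain rfl := solution_nil.1 hs
    refine .inl ⟨?_, rfl, hR2.le, (wave2Fan_self V).symm⟩
    rw [phi2_eq, velJump_self]; ring
  | cons p F =>
    obtain ⟨k', W⟩ := p
    obtain ⟨hl, hf', hs', -⟩ := solution_cons.1 hs
    obtain ⟨hne, hsp⟩ := hf
    cases k' with
    | contact => exact absurd rfl hne
    | dry => exact absurd hl.1 hV.ne'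
    | shock1 =>
      have := (shock1_lax hg hl).1
      simp only [leftSpeed, rightSpeed] at hsp; linarith
    | rar1 =>
      have h0 : lambda1 g V = 0 := le_antisymm hl1 hsp
      -- Behind a contact a 1-rarefaction needs `λ₁(V) ≥ 0`, so it can start only at a critical
      -- state.
      exact .inr (.inl ⟨h0, pure_of_rar1 hg hR h0.ge hl hf' hs'⟩)
    | rar2 =>
      have h1 := rar2_lambda2 hg hl
      have h2 : 0 ≤ lambda2 g V := hsp
      rcases after_wave2 hg (.inr rfl) hl hf' hs' with ⟨rfl, rfl⟩ | ⟨-, h, -⟩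
      · obtain ⟨i1, i2, -, -⟩ := links_wave2 (.inr rfl) hl
        exact .inl ⟨i1, i2.symm, h2, (wave2Fan_of_links (.inr rfl) hl).symm⟩
      · linarith
    | shock2 =>
      have h1 := (shock2_lax hg hl).2.1
      have h2 : 0 ≤ shockSpeed V W := hsp
      rcases after_wave2 hg (.inl rfl) hl hf' hs' with ⟨rfl, rfl⟩ | ⟨h, -, Y, F', rfl⟩
      · obtain ⟨i1, i2, -, -⟩ := links_wave2 (.inl rfl) hl
        exact .inl ⟨i1, i2.symm, by linarith, (wave2Fan_of_links (.inl rfl) hl).symm⟩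
      · exact .inr (.inr ⟨_, _, _, rfl, le_antisymm h h2⟩)

/-! ### Stationary shocks -/

theorem disc_eq_of_shockSpeed_zero {U W : State} (h : W.h ≠ U.h) (hs : shockSpeed U W = 0) :
    disc W = disc U := by
  unfold shockSpeed at hs
  rw [div_eq_zero_iff] at hs
  rcases hs with hs | hs
  · unfold disc; linarith
  · exact absurd (sub_eq_zero.1 hs) h

theorem eq_hash_of_mul_kap {g : ℝ} {U W : State} (hg : 0 < g) (hU : 0 < U.h) (hW : 0 < W.h)
    (hu : U.u ≠ 0) (hk : W.h * kap g U.h W.h = |U.u|) (hd : disc W = disc U) (ha : W.a = U.a) :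
    W = hash g U := by
  have hq : disc U ≠ 0 := mul_ne_zero hU.ne' hu
  have h1 := jumpDepth_mul_kap hg hU hu
  have h2 := jumpDepth_pos hg hq hU
  have h3 : W.h = jumpDepth g (disc U) U.h := by
    refine le_antisymm ?_ ?_
    · exact (mul_kap_le_iff hg hU hW h2).1 (hk.trans h1.symm).le
    · exact (mul_kap_le_iff hg hU h2 hW).1 (h1.trans hk.symm).le
  have h4 : W.h = (hash g U).h := by rw [h3, hash_h hU.ne']
  refine State.ext h4 ?_ ha
  rw [hash_u, ← h4, ← hd]
  exact (mul_div_cancel_left₀ _ hW.ne').symm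

theorem eq_hash_of_shock1 {g : ℝ} {U W : State} (hg : 0 < g) (hl : Links g shock1 U W)
    (hs : shockSpeed U W = 0) : W = hash g U ∧ 0 < lambda1 g U := by
  have h1 := (shock1_speed hl).1
  have h2 := (shock1_lax hg hl).1
  obtain ⟨h0, hlt, ha, -⟩ := hl
  have hW := h0.trans hlt
  have hu : 0 < U.u := by linarith [lambda1_lt_u hg h0]
  refine ⟨eq_hash_of_mul_kap hg h0 hW hu.ne' ?_ (disc_eq_of_shockSpeed_zero hlt.ne' hs) ha,
    by linarith⟩
  rw [abs_of_pos hu]; linarith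

theorem eq_hash_of_shock2 {g : ℝ} {W Z : State} (hg : 0 < g) (hl : Links g shock2 W Z)
    (hs : shockSpeed W Z = 0) : W = hash g Z ∧ lambda2 g Z < 0 := by
  have h1 := (shock2_speed hl).2
  have h2 := (shock2_lax hg hl).1
  obtain ⟨h0, hlt, ha, -⟩ := hl
  have hW := h0.trans hlt
  have hu : Z.u < 0 := by linarith [u_lt_lambda2 hg h0]
  refine ⟨eq_hash_of_mul_kap hg h0 hW hu.ne ?_ (disc_eq_of_shockSpeed_zero hlt.ne hs).symm ha.symm,
    by linarith⟩
  rw [abs_of_neg hu]; linarith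

theorem lt_hash_h {g : ℝ} {U : State} (hg : 0 < g) (hU : 0 < U.h) (h : g * U.h < U.u ^ 2) :
    U.h < (hash g U).h ∧ hcrit g (disc U) < (hash g U).h ∧ disc U ≠ 0 := by
  have hu : U.u ≠ 0 := by
    rintro h0; rw [h0] at h; nlinarith
  have hq : disc U ≠ 0 := mul_ne_zero hU.ne' hu
  have hc := (lt_hcrit_disc_iff hg hU).2 h
  have := hcrit_lt_jumpDepth hg hq hU hc
  rw [hash_h hU.ne']
  exact ⟨hc.trans this, this, hq⟩

theorem hash_mul_kap {g : ℝ} {U : State} (hg : 0 < g) (hU : 0 < U.h) (hu : U.u ≠ 0) :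
    (hash g U).h * kap g U.h (hash g U).h = |U.u| ∧ (hash g U).h * (hash g U).u = U.h * U.u := by
  refine ⟨?_, disc_hash hg hU (mul_ne_zero hU.ne' hu)⟩
  rw [hash_h hU.ne']
  exact jumpDepth_mul_kap hg hU hu

theorem hash_eq_wave1State {g : ℝ} {U : State} (hg : 0 < g) (hU : 0 < U.h) (hu : 0 < U.u)
    (h : g * U.h ≤ U.u ^ 2) : hash g U = wave1State g U (hash g U).h := by
  have hq : disc U ≠ 0 := mul_ne_zero hU.ne' hu.ne'
  have hle : U.h ≤ (hash g U).h := by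
    rw [hash_h hU.ne']
    have := (le_hcrit_disc_iff hg hU).2 h
    exact this.trans (hcrit_le_jumpDepth hg hq hU this)
  obtain ⟨h1, h2⟩ := hash_mul_kap hg hU hu.ne'
  rw [abs_of_pos hu] at h1
  refine State.ext rfl ?_ rfl
  simp only [wave1State]
  rw [velJump_of_ge hle, shockJump_eq]
  have h3 : 0 < (hash g U).h := hU.trans_le hle
  refine mul_left_cancel₀ h3.ne' ?_
  linear_combination h2 + ((hash g U).h - U.h) * h1

theorem links_shock1_hash {g : ℝ} {U : State} (hg : 0 < g) (hU : U ∈ G1 g) :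
    Links g shock1 U (hash g U) ∧ shockSpeed U (hash g U) = 0 := by
  obtain ⟨h0, hu, hs⟩ := (mem_G1_iff hg).1 hU
  have h := (lt_hash_h hg h0 hs).1
  have e := hash_eq_wave1State hg h0 hu hs.le
  have hl : Links g shock1 U (hash g U) := by rw [e]; exact links_shock1_wave1State h0 h
  refine ⟨hl, ?_⟩
  rw [(shock1_speed hl).1, (hash_mul_kap hg h0 hu.ne').1, abs_of_pos hu, sub_self]

theorem links_shock2_hash {g : ℝ} {Z : State} (hg : 0 < g) (h0 : 0 < Z.h) (hZ : lambda2 g Z < 0) :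
    Links g shock2 (hash g Z) Z ∧ shockSpeed (hash g Z) Z = 0 := by
  obtain ⟨hu, hs⟩ := (lambda2_neg_iff (by positivity)).1 hZ
  have h := (lt_hash_h hg h0 hs).1
  obtain ⟨h1, h2⟩ := hash_mul_kap hg h0 hu.ne
  rw [abs_of_neg hu] at h1
  have hl : Links g shock2 (hash g Z) Z := by
    refine ⟨h0, h, rfl, ?_⟩
    rw [shockJump_eq, kap_comm]
    have h3 : 0 < (hash g Z).h := h0.trans h
    refine mul_left_cancel₀ h3.ne' ?_
    linear_combination -h2 + ((hash g Z).h - Z.h) * h1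
  refine ⟨hl, ?_⟩
  rw [(shock2_speed hl).2, h1]; ring

/-! ### Contacts from and to the various regions -/

theorem contact_supercritical_left {g : ℝ} {U V : State} (hg : 0 < g)
    (h : StationaryContact g U V) (hU : lambda2 g U < 0) : V.u < 0 ∧ lambda2 g V ≤ 0 := by
  obtain ⟨hU0, hV0, hq, -, hc⟩ := (stationaryContact_iff hg).1 h
  obtain ⟨hu, hs⟩ := (lambda2_neg_iff (by positivity)).1 hU
  have hlt := (lt_hcrit_disc_iff hg hU0).2 hs
  have hVu : V.u < 0 := by
    unfold disc at hq
    have : U.h * U.u < 0 := mul_neg_of_pos_of_neg hU0 hu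
    rw [hq] at this
    exact neg_of_mul_neg_right this hV0.le
  refine ⟨hVu, (lambda2_nonpos_iff (by positivity)).2 ⟨hVu.le, ?_⟩⟩
  rcases hc with hc | hc
  · exact absurd hc.1 hlt.not_ge
  · exact (le_hcrit_disc_iff hg hV0).1 (hq ▸ hc.2)

theorem contact_subcritical {g : ℝ} {U V : State} (hg : 0 < g)
    (h : StationaryContact g U V) (hU : U.u ^ 2 < g * U.h) : V.u ^ 2 ≤ g * V.h := by
  obtain ⟨hU0, hV0, hq, -, hc⟩ := (stationaryContact_iff hg).1 h
  have hlt := (hcrit_disc_lt_iff hg hU0).2 hU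
  rcases hc with hc | hc
  · exact (hcrit_disc_le_iff hg hV0).1 (hq ▸ hc.2)
  · exact absurd hc.1 hlt.not_ge

theorem contact_supercritical_right {g : ℝ} {U V : State} (hg : 0 < g)
    (h : StationaryContact g U V) (hU : 0 < lambda1 g U) : 0 < V.u ∧ 0 ≤ lambda1 g V := by
  obtain ⟨hU0, hV0, hq, -, hc⟩ := (stationaryContact_iff hg).1 h
  obtain ⟨hu, hs⟩ := (lambda1_pos_iff (by positivity)).1 hU
  have hlt := (lt_hcrit_disc_iff hg hU0).2 hs
  have hVu : 0 < V.u := by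
    unfold disc at hq
    have : 0 < U.h * U.u := mul_pos hU0 hu
    rw [hq] at this
    exact pos_of_mul_pos_right this hV0.le
  refine ⟨hVu, (lambda1_nonneg_iff (by positivity)).2 ⟨hVu.le, ?_⟩⟩
  rcases hc with hc | hc
  · exact absurd hc.1 hlt.not_ge
  · exact (le_hcrit_disc_iff hg hV0).1 (hq ▸ hc.2)

/-- A nontrivial contact ending at a critical state raises the bottom. -/
theorem contact_level_lt {g : ℝ} {U V : State} (hg : 0 < g)
    (h : StationaryContact g U V) (hne : U.a ≠ V.a) (hV : V.u ^ 2 = g * V.h) : U.a < V.a := by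
  obtain ⟨hU0, hV0, hq, he, -⟩ := (stationaryContact_iff hg).1 h
  have hVc : V.h = hcrit g (disc V) :=
    le_antisymm ((le_hcrit_disc_iff hg hV0).2 hV.ge) ((hcrit_disc_le_iff hg hV0).2 hV.le)
  have h1 : head g V = 3 / 2 * hcrit g (disc V) := by
    unfold head colHead; rw [hV, ← hVc]; field_simp; ring
  have h2 := specHead_ge (q := disc U) hg hU0
  rw [← head_eq_specHead hU0, hq] at h2
  exact lt_of_le_of_ne (by linarith) hne

theorem contact_level_gt {g : ℝ} {U V : State} (hg : 0 < g)
    (h : StationaryContact g U V) (hne : U.a ≠ V.a) (hU : U.u ^ 2 = g * U.h) : V.a < U.a := by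
  refine contact_level_lt hg ?_ hne.symm hU
  rw [stationaryContact_iff hg] at *
  obtain ⟨h1, h2, h3, h4, h5⟩ := h
  rw [← h3]
  exact ⟨h2, h1, rfl, h4.symm, by tauto⟩

/-! ### The kinds of solutions -/

/-- `U` is reached from `UL` by a 1-shock of nonpositive speed. -/
def IsLeftShock (g : ℝ) (UL U : State) : Prop :=
  UL.h < U.h ∧ U = wave1State g UL U.h ∧ UL.u ≤ U.h * kap g UL.h U.h

/-- A contact followed by a fan without contacts. -/
def IsContactPure (g : ℝ) (UL R : State) (F : Fan) : Prop :=
  ∃ V F', StationaryContact g UL V ∧ V.a = R.a ∧ F = (contact, V) :: F' ∧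
    IsPureFan g V R F' ∧ Follows g contact UL V F'

/-- Two contacts separated by a stationary 1-shock. -/
def IsResonant (g : ℝ) (UL R : State) (F : Fan) : Prop :=
  ∃ V W F', StationaryContact g UL V ∧ 0 < lambda1 g V ∧ V.a ≠ UL.a ∧ V.a ≠ R.a ∧
    |V.a - UL.a| + |V.a - R.a| ≤ |UL.a - R.a| ∧ StationaryContact g (hash g V) W ∧ W.a = R.a ∧
    F = (contact, V) :: (shock1, hash g V) :: (contact, W) :: F' ∧
    ((phi2 g W R = 0 ∧ F' = wave2Fan W R) ∨ (lambda1 g W = 0 ∧ IsPureFan g W R F'))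

/-- A 1-shock, a subcritical contact and a 2-wave. -/
def IsShockContact (g : ℝ) (UL R : State) (F : Fan) : Prop :=
  ∃ U V, IsLeftShock g UL U ∧ 0 ≤ lambda2 g U ∧ StationaryContact g U V ∧ V.a = R.a ∧
    V.u ^ 2 ≤ g * V.h ∧ phi2 g V R = 0 ∧ 0 ≤ lambda2 g V ∧
    F = (shock1, U) :: (contact, V) :: wave2Fan V R

/-- A 1-shock, a contact to a critical state of positive velocity, and a fan without contacts. -/
def IsShockCritical (g : ℝ) (UL R : State) (F : Fan) : Prop :=
  ∃ U V F', IsLeftShock g UL U ∧ StationaryContact g U V ∧ V.a = R.a ∧ lambda1 g V = 0 ∧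
    IsPureFan g V R F' ∧ Follows g contact U V F' ∧ F = (shock1, U) :: (contact, V) :: F'

/-- A 1-shock, a 2-rarefaction wave to a critical state, a contact and a 2-wave. -/
def IsRarContact (g : ℝ) (UL R : State) (F : Fan) : Prop :=
  ∃ U Q V, R.a < UL.a ∧ IsLeftShock g UL U ∧ Links g rar2 U Q ∧ lambda2 g Q = 0 ∧
    StationaryContact g Q V ∧ V.a = R.a ∧ V.u ^ 2 ≤ g * V.h ∧ phi2 g V R = 0 ∧ 0 ≤ lambda2 g V ∧
    F = (shock1, U) :: (rar2, Q) :: (contact, V) :: wave2Fan V R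

/-- A 1-shock, a 2-wave, a supercritical contact to a critical state and a 2-wave. -/
def IsWaveContact (g : ℝ) (UL R : State) (F : Fan) : Prop :=
  ∃ U Q W, UL.a < R.a ∧ IsLeftShock g UL U ∧ 0 < Q.h ∧ phi2 g U Q = 0 ∧ Q.a = U.a ∧
    (Q.h < U.h → Q.u + U.h * kap g Q.h U.h ≤ 0) ∧
    lambda2 g Q < 0 ∧ StationaryContact g Q W ∧ W.a = R.a ∧ lambda2 g W = 0 ∧ phi2 g W R = 0 ∧
    F = (shock1, U) :: (wave2Fan U Q ++ (contact, W) :: wave2Fan W R)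

/-- A 1-shock, two contacts separated by a stationary 2-shock, and a 2-wave. -/
def IsBackResonant (g : ℝ) (UL R : State) (F : Fan) : Prop :=
  ∃ U Z W, UL.a < Z.a ∧ Z.a < R.a ∧ IsLeftShock g UL U ∧ 0 ≤ lambda2 g U ∧
    StationaryContact g U (hash g Z) ∧
    0 < Z.h ∧ lambda2 g Z < 0 ∧ StationaryContact g Z W ∧ W.a = R.a ∧ lambda2 g W = 0 ∧
    phi2 g W R = 0 ∧
    F = (shock1, U) :: (contact, hash g Z) :: (shock2, Z) :: (contact, W) :: wave2Fan W R

theorem isLeftShock_of_links {g : ℝ} {UL U : State} (hl : Links g shock1 UL U)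
    (hs : shockSpeed UL U ≤ 0) : IsLeftShock g UL U := by
  refine ⟨hl.2.1, (links_wave1 (.inl rfl) hl).1, ?_⟩
  rw [(shock1_speed hl).1] at hs; linarith

theorem sq_eq_of_lambda2_zero {g : ℝ} {U : State} (hU : 0 ≤ g * U.h) (h : lambda2 g U = 0) :
    U.u ^ 2 = g * U.h := by
  have := Real.sq_sqrt hU
  unfold lambda2 at h
  rw [← this, eq_neg_of_add_eq_zero_left h]; ring

/-- Behind a contact from a state with `λ₂ < 0`. -/
theorem tail_supercritical {g : ℝ} {Z Y R : State} {F : Fan} (hg : 0 < g) (hR : 0 < R.h)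
    (hR2 : 0 < lambda2 g R) (hl : StationaryContact g Z Y)
    (hY2 : Y.u < 0) (hY3 : lambda2 g Y ≤ 0)
    (hf : Follows g contact Z Y F) (hs : IsRiemannSolution g Y R F) :
    phi2 g Y R = 0 ∧ Y.a = R.a ∧ lambda2 g Y = 0 ∧ F = wave2Fan Y R := by
  have hY : 0 < Y.h := hl.2.1
  have h1 := lambda1_lt_u hg hY
  rcases tail_classify hg hR hR2 hY (by linarith) hf hs with ⟨i1, i2, i3, i4⟩ | ⟨h, -⟩ |
    ⟨X, V, F', rfl, h⟩
  · exact ⟨i1, i2, le_antisymm hY3 i3, i4⟩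
  · linarith
  · have := (shock2_lax hg (solution_cons.1 hs).1).2.1
    linarith

/-- The two ends are handled by `start_classify` and `tail_classify`. In between, a contact fixes
the sign of the velocity and the flow regime, a shock enclosed by two contacts is stationary, and
the bottom cannot go down and up again. -/
theorem solution_classify {g : ℝ} {UL R : State} {F : Fan} (hg : 0 < g) (hUL : UL ∈ G1 g)
    (hR : 0 < R.h) (hR2 : 0 < lambda2 g R) (hne : UL.a ≠ R.a) (hs : IsRiemannSolution g UL R F) :
    IsContactPure g UL R F ∨ IsResonant g UL R F ∨ IsShockContact g UL R F ∨
      IsShockCritical g UL R F ∨ IsRarContact g UL R F ∨ IsWaveContact g UL R F ∨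
      IsBackResonant g UL R F := by
  obtain ⟨hL0, hL1⟩ := hUL
  rcases start_classify hg hL0 hR hL1.le hs with h | ⟨V, F1, rfl⟩ | ⟨U, V, F1, rfl, hsp⟩ |
    ⟨k, U, Q, W, F1, hk, rfl, hsp⟩
  · exact absurd h.1 hne
  · -- first wave is a contact
    obtain ⟨hl, hf, hs1, ha⟩ := solution_cons.1 hs
    obtain ⟨hVu, hV1⟩ := contact_supercritical_right hg hl.1 hL1
    have hV0 := hl.1.2.1
    rcases start_classify hg hV0 hR hV1 hs1 with h | ⟨W, F2, rfl⟩ | ⟨U, W, F2, rfl, hsp⟩ |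
      ⟨k, U, Q, W, F2, hk, rfl, hsp⟩
    · exact .inl ⟨V, F1, hl.1, h.1, rfl, h, hf⟩
    · exact absurd rfl hf.1
    · obtain ⟨hl2, hf2, hs2, -⟩ := solution_cons.1 hs1
      obtain ⟨hl3, hf3, hs3, -⟩ := solution_cons.1 hs2
      -- Enclosed between two contacts, the shock has speed exactly zero.
      have hz : shockSpeed V U = 0 := le_antisymm hsp hf.2
      obtain ⟨rfl, hV1'⟩ := eq_hash_of_shock1 hg hl2 hz
      obtain ⟨-, hVs⟩ := (lambda1_pos_iff (by positivity)).1 hV1'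
      obtain ⟨j1, j2, j3⟩ := lt_hash_h hg hV0 hVs
      have hHd := disc_hash hg hV0 j3
      have hH0 := hV0.trans j1
      have hHs : (hash g V).u ^ 2 < g * (hash g V).h :=
        (hcrit_disc_lt_iff hg hH0).1 (by rwa [hHd])
      have hWs := contact_subcritical hg hl3.1 hHs
      have hW0 := hl3.1.2.1
      have hWc := ((mem_closedG2_iff hg).2 ⟨hW0, hWs⟩).2
      have hWu : 0 < W.u := by
        have : disc W = disc V := by
          rw [← hHd]; exact hl3.1.2.2.1.symm
        unfold disc at this
        have h2 : 0 < V.h * V.u := mul_pos hV0 hVu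
        rw [← this] at h2
        exact pos_of_mul_pos_right h2 hW0.le
      have fin : W.a = R.a → ((phi2 g W R = 0 ∧ F2 = wave2Fan W R) ∨
          (lambda1 g W = 0 ∧ IsPureFan g W R F2)) →
          IsResonant g UL R ((contact, V) :: (shock1, hash g V) :: (contact, W) :: F2) := by
        intro hWa h
        refine ⟨V, W, F2, hl.1, hV1', hl.2.symm, ?_, ha, hl3.1, hWa, rfl, h⟩
        rw [← hWa]; exact hl3.2
      rcases tail_classify hg hR hR2 hW0 hWc.1 hf3 hs3 with ⟨i1, i2, i3, i4⟩ | ⟨i1, i2⟩ |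
        ⟨Z, Y, F3, rfl, h⟩
      · exact .inr (.inl (fin i2 (.inl ⟨i1, i4⟩)))
      · exact .inr (.inl (fin i2.1 (.inr ⟨i1, i2⟩)))
      · have := (shock2_lax hg (solution_cons.1 hs3).1).2.2.1
        linarith
    -- The 1-shock follows a contact, so its speed is nonnegative; the 2-wave is then faster than
    -- zero and no second contact can follow.
    · exfalso
      obtain ⟨hl2, hf2, hs2, -⟩ := solution_cons.1 hs1
      obtain ⟨hl3, -, -, -⟩ := solution_cons.1 hs2
      have h1 := (shock1_lax hg hl2).2.2
      have h2 : 0 ≤ shockSpeed V U := hf.2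
      have hU0 := hl2.1.trans hl2.2.1
      have : U.u < rightSpeed g k U Q := by
        rcases hk with rfl | rfl
        · exact (shock2_lax hg hl3).2.2.1
        · exact (u_lt_lambda2 hg hU0).trans (rar2_lambda2 hg hl3)
      linarith
  · -- a 1-shock and a contact
    obtain ⟨hl1, hf1, hs1, ha1⟩ := solution_cons.1 hs
    obtain ⟨hl, hf, hs2, ha2⟩ := solution_cons.1 hs1
    have hU := isLeftShock_of_links hl1 hsp
    have hU0 := hl.1.1
    have hV0 := hl.1.2.1
    have hUa : U.a = UL.a := hl1.2.2.1
    have hU1 : lambda1 g U < 0 := (shock1_lax hg hl1).2.1.trans_le hsp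
    -- If `λ₂(U) < 0`, the contact is supercritical and the fan is the case `Q = U`, with a trivial
    -- 2-wave, of `IsWaveContact`.
    rcases lt_or_ge (lambda2 g U) 0 with hU2 | hU2
    · obtain ⟨hVu, hV2⟩ := contact_supercritical_left hg hl.1 hU2
      obtain ⟨i1, i2, i3, i4⟩ := tail_supercritical hg hR hR2 hl.1 hVu hV2 hf hs2
      have := contact_level_lt hg hl.1 hl.2 (sq_eq_of_lambda2_zero (by positivity) i3)
      refine .inr (.inr (.inr (.inr (.inr (.inl ⟨U, U, V, by rw [← hUa, ← i2]; exact this, hU,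
        hU0, ?_, rfl, fun h => absurd h (lt_irrefl _), hU2, hl.1, i2, i3, i1, ?_⟩)))))
      · rw [phi2_eq, velJump_self]; ring
      · rw [wave2Fan_self, i4]; rfl
    · have hUs := ((mem_closedG2_iff hg).1 ⟨hU0, hU1.le, hU2⟩).2
      have hVs : V.u ^ 2 ≤ g * V.h := by
        rcases hUs.eq_or_lt with h | h
        -- From a critical state a contact could also leave for the supercritical side; with
        -- velocity to the left the rest of the fan would then require `λ₂(V) = 0`.
        · by_contra! hn
          have hlt := contact_level_gt hg hl.1 hl.2 h
          have hUu : U.u < 0 := by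
            by_contra! h0
            have := (lambda1_nonneg_iff (g := g) (U := U) (by positivity)).2 ⟨h0, h.ge⟩
            linarith
          have hVu : V.u < 0 := by
            have h1 : U.h * U.u < 0 := mul_neg_of_pos_of_neg hU0 hUu
            rw [hl.1.2.2.1] at h1
            exact neg_of_mul_neg_right h1 hV0.le
          have hV2 := (lambda2_neg_iff (g := g) (U := V) (by positivity)).2 ⟨hVu, hn⟩
          obtain ⟨-, -, i3, -⟩ := tail_supercritical hg hR hR2 hl.1 hVu hV2.le hf hs2
          linarith
        · exact contact_subcritical hg hl.1 h
      have hVc := ((mem_closedG2_iff hg).2 ⟨hV0, hVs⟩).2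
      rcases tail_classify hg hR hR2 hV0 hVc.1 hf hs2 with ⟨i1, i2, i3, i4⟩ | ⟨i1, i2⟩ |
        ⟨Z, Y, F3, rfl, h⟩
      · exact .inr (.inr (.inl ⟨U, V, hU, hU2, hl.1, i2, hVs, i1, i3, by rw [i4]⟩))
      · exact .inr (.inr (.inr (.inl ⟨U, V, _, hU, hl.1, i2.1, i1, i2, hf, rfl⟩)))
      · obtain ⟨hl3, hf3, hs3, ha3⟩ := solution_cons.1 hs2
        obtain ⟨hl4, hf4, hs4, ha4⟩ := solution_cons.1 hs3
        obtain ⟨rfl, hZ2⟩ := eq_hash_of_shock2 hg hl3 h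
        obtain ⟨hYu, hY2⟩ := contact_supercritical_left hg hl4.1 hZ2
        obtain ⟨i1, i2, i3, i4⟩ := tail_supercritical hg hR hR2 hl4.1 hYu hY2 hf4 hs4
        have hlt := contact_level_lt hg hl4.1 hl4.2
          (sq_eq_of_lambda2_zero (mul_pos hg hl4.1.2.1).le i3)
        rw [i2] at hlt
        refine .inr (.inr (.inr (.inr (.inr (.inr ⟨U, Z, Y, ?_, hlt, hU, hU2, hl.1, hl4.1.1, hZ2,
          hl4.1, i2, i3, i1, by rw [i4]⟩)))))
        have hne' : Z.a ≠ UL.a := by rw [← hUa]; exact hl.2.symm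
        rw [hUa, hash_a] at ha2
        -- A level below both outer levels would make the total variation of the bottom too large.
        rcases lt_or_gt_of_ne hne' with h' | h'
        · exfalso
          rw [abs_of_neg (sub_neg.2 h'), abs_of_neg (sub_neg.2 hlt)] at ha2
          rcases abs_cases (UL.a - R.a) with h'' | h'' <;> linarith
        · exact h'
  · obtain ⟨hl1, hf1, hs1, ha1⟩ := solution_cons.1 hs
    obtain ⟨hl2, hf2, hs2, ha2⟩ := solution_cons.1 hs1
    obtain ⟨hl, hf, hs3, ha3⟩ := solution_cons.1 hs2
    obtain ⟨j1, j2, hQ0, -⟩ := links_wave2 hk hl2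
    have hU0 : 0 < U.h := hl1.1.trans hl1.2.1
    have hUa : U.a = UL.a := hl1.2.2.1
    have hW0 := hl.1.2.1
    have hu : U.u < rightSpeed g k U Q ∧ lambda2 g Q ≤ rightSpeed g k U Q := by
      rcases hk with rfl | rfl
      · exact ⟨(shock2_lax hg hl2).2.2.1, (shock2_lax hg hl2).1.le⟩
      · exact ⟨(u_lt_lambda2 hg hU0).trans (rar2_lambda2 hg hl2), le_rfl⟩
    have hU := isLeftShock_of_links hl1 (by linarith [(shock1_lax hg hl1).2.2])
    rcases (hu.2.trans hsp).lt_or_eq with hQ2 | hQ2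
    · obtain ⟨hWu, hW2⟩ := contact_supercritical_left hg hl.1 hQ2
      obtain ⟨i1, i2, i3, i4⟩ := tail_supercritical hg hR hR2 hl.1 hWu hW2 hf hs3
      have := contact_level_lt hg hl.1 hl.2 (sq_eq_of_lambda2_zero (by positivity) i3)
      refine .inr (.inr (.inr (.inr (.inr (.inl ⟨U, Q, W, by rw [← hUa, ← j2, ← i2]; exact this,
        hU, hQ0, j1, j2, ?_, hQ2, hl.1, i2, i3, i1, ?_⟩)))))
      · intro h
        rcases hk with rfl | rfl
        · rw [← (shock2_speed hl2).2]; exact hsp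
        · exact absurd hl2.2.1 h.not_gt
      · rw [wave2Fan_of_links hk hl2, i4]; rfl
    · rcases hk with rfl | rfl
      · have := (shock2_lax hg hl2).1
        simp only [rightSpeed] at hsp
        linarith
      have hQs := sq_eq_of_lambda2_zero (by positivity) hQ2
      have hlt := contact_level_gt hg hl.1 hl.2 hQs
      have hQu : Q.u < 0 := by linarith [u_lt_lambda2 hg hQ0]
      have hWu : W.u < 0 := by
        have h1 : Q.h * Q.u < 0 := mul_neg_of_pos_of_neg hQ0 hQu
        rw [hl.1.2.2.1] at h1
        exact neg_of_mul_neg_right h1 hW0.le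
      have hWs : W.u ^ 2 ≤ g * W.h := by
        by_contra! hn
        have hW2 := (lambda2_neg_iff (g := g) (U := W) (by positivity)).2 ⟨hWu, hn⟩
        obtain ⟨-, -, i3, -⟩ := tail_supercritical hg hR hR2 hl.1 hWu hW2.le hf hs3
        linarith
      have hWc := ((mem_closedG2_iff hg).2 ⟨hW0, hWs⟩).2
      have hQa : Q.a = UL.a := by rw [j2, hUa]
      rw [hQa] at hlt ha3
      rcases tail_classify hg hR hR2 hW0 hWc.1 hf hs3 with ⟨i1, i2, i3, i4⟩ | ⟨i1, i2⟩ |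
        ⟨Z, Y, F3, rfl, h⟩
      · exact .inr (.inr (.inr (.inr (.inl ⟨U, Q, W, i2 ▸ hlt, hU, hl2, hQ2, hl.1, i2, hWs, i1,
          i3, by rw [i4]⟩))))
      · linarith [lambda1_lt_u hg hW0]
      -- The bottom would fall at the first contact and rise at the second, beyond the allowed
      -- variation.
      · exfalso
        obtain ⟨hl3, hf3, hs4, -⟩ := solution_cons.1 hs3
        obtain ⟨hl4, hf4, hs5, -⟩ := solution_cons.1 hs4
        obtain ⟨rfl, hZ2⟩ := eq_hash_of_shock2 hg hl3 h
        obtain ⟨hYu, hY2⟩ := contact_supercritical_left hg hl4.1 hZ2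
        obtain ⟨i1, i2, i3, i4⟩ := tail_supercritical hg hR hR2 hl4.1 hYu hY2 hf4 hs5
        have hlt2 := contact_level_lt hg hl4.1 hl4.2
          (sq_eq_of_lambda2_zero (mul_pos hg hl4.1.2.1).le i3)
        rw [i2] at hlt2
        rw [hash_a] at ha3 hlt
        rw [abs_of_neg (sub_neg.2 hlt), abs_of_neg (sub_neg.2 hlt2)] at ha3
        rcases abs_cases (UL.a - R.a) with h'' | h'' <;> linarith

/-! ### Comparison of states -/

theorem contact_disc_head {g : ℝ} {U V : State} (hg : 0 < g) (h : StationaryContact g U V) :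
    disc U = disc V ∧ U.a + head g U = V.a + head g V :=
  let h' := (stationaryContact_iff hg).1 h
  ⟨h'.2.2.1, h'.2.2.2.1⟩

theorem state_ext_disc {U V : State} (hU : 0 < U.h) (hh : U.h = V.h) (hd : disc U = disc V)
    (ha : U.a = V.a) : U = V := by
  refine State.ext hh ?_ ha
  unfold disc at hd
  rw [← hh] at hd
  exact mul_left_cancel₀ hU.ne' hd

/-- At fixed positive discharge the deeper state is the slower one, while the 2-wave curve rises
with the depth. -/
theorem phi2_lt_of_disc {g : ℝ} {V V' R : State} (hg : 0 < g) (hR : 0 < R.h) (hV : 0 < V.h)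
    (hlt : V.h < V'.h) (hd : disc V = disc V') (hq : 0 < disc V) :
    phi2 g V' R < phi2 g V R := by
  have h1 := velJump_strictMono hg hR hV.le hlt
  have hV' := hV.trans hlt
  have hu : V'.u < V.u := by
    unfold disc at hd hq
    have hu' : 0 < V'.u := by rw [hd] at hq; exact pos_of_mul_pos_right hq hV'.le
    by_contra! hn
    have := mul_lt_mul hlt hn (pos_of_mul_pos_right hq hV.le) hV'.le
    linarith
  rw [phi2_eq, phi2_eq]
  linarith

theorem right_lambda2_lt {g : ℝ} {V V' R : State} (hg : 0 < g) (hR : 0 < R.h) (hV : 0 ≤ V.h)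
    (hlt : V.h < V'.h) (hp : phi2 g V R = 0) (hp' : phi2 g V' R = 0) :
    lambda2 g V < lambda2 g V' := by
  have h1 := velJump_strictMono hg hR hV hlt
  have h2 := sqrt_lt_sqrt_mul hg hV hlt
  rw [phi2_eq] at hp hp'
  unfold lambda2
  linarith

/-- On the 2-wave curve discharge and head are ordered alike, whereas left-hand 1-shocks order them
oppositely. This clash is what excludes a second intersection. -/
theorem right_no_cross {g : ℝ} {V V' R : State} (hg : 0 < g) (hR : 0 < R.h)
    (hR2 : 0 < lambda2 g R) (hV : 0 < V.h) (hV' : 0 < V'.h)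
    (hp : phi2 g V R = 0) (hp' : phi2 g V' R = 0) (hl : 0 ≤ lambda2 g V) (hl' : 0 ≤ lambda2 g V')
    (hd : disc V' ≤ disc V) (hh : head g V < head g V') : False := by
  rcases lt_trichotomy V.h V'.h with h | h | h
  · exact (right_mono hg hR hR2 hV.le hp hp' hl h).1.not_ge hd
  · have : V.u = V'.u := by rw [phi2_eq] at hp hp'; rw [h] at hp; linarith
    unfold head at hh; rw [h, this] at hh; exact lt_irrefl _ hh
  · exact (right_mono hg hR hR2 hV'.le hp' hp hl' h).2.not_gt hh

theorem exists_root {f : ℝ → ℝ} {a b : ℝ} (hab : a ≤ b) (hf : ContinuousOn f (Icc a b))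
    (ha : 0 ≤ f a) (hb : f b ≤ 0) : ∃ x ∈ Icc a b, f x = 0 := by
  obtain ⟨x, hx, h⟩ := intermediate_value_Icc' hab hf ⟨hb, ha⟩
  exact ⟨x, hx, h⟩

/-- A nonpositive shock speed means a depth at least that of the stationary shock, so `U_L^#` is the
end of this part of the 1-wave curve with the largest discharge and the least head. -/
theorem IsLeftShock.facts {g : ℝ} {UL U : State} (hg : 0 < g) (hUL : UL ∈ G1 g)
    (h : IsLeftShock g UL U) : 0 < U.h ∧ lambda1 g U < 0 ∧ U.a = UL.a ∧ (hash g UL).h ≤ U.h ∧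
      disc U ≤ disc UL ∧ head g (hash g UL) ≤ head g U := by
  obtain ⟨h0, hu, hs⟩ := (mem_G1_iff hg).1 hUL
  obtain ⟨h1, h2, h3⟩ := h
  have hU0 := h0.trans h1
  obtain ⟨j1, j2, j3⟩ := lt_hash_h hg h0 hs
  have hk := (hash_mul_kap hg h0 hu.ne').1
  rw [abs_of_pos hu] at hk
  have hle : (hash g UL).h ≤ U.h :=
    (mul_kap_le_iff hg h0 (h0.trans j1) hU0).1 (by rw [hk]; exact h3)
  have e := hash_eq_wave1State hg h0 hu hs.le
  have hd := disc_hash hg h0 j3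
  refine ⟨hU0, ?_, by rw [h2]; rfl, hle, ?_⟩
  · rw [h2]; exact left_lambda1_neg hg h0 h1 h3
  rcases hle.eq_or_lt with h4 | h4
  · have : U = hash g UL := by rw [h2, ← h4, ← e]
    rw [this, hd]; exact ⟨le_rfl, le_rfl⟩
  · rw [← hd, h2, e]
    exact ⟨(left_disc_lt hg h0 j1.le h4 hk.ge).le, (left_head_lt hg h0 j1.le h4 hk.ge).le⟩

theorem isLeftShock_hash {g : ℝ} {UL : State} (hg : 0 < g) (hUL : UL ∈ G1 g) :
    IsLeftShock g UL (hash g UL) ∧ 0 < lambda2 g (hash g UL) ∧ disc (hash g UL) = disc UL ∧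
      0 < disc UL := by
  obtain ⟨h0, hu, hs⟩ := (mem_G1_iff hg).1 hUL
  obtain ⟨j1, j2, j3⟩ := lt_hash_h hg h0 hs
  have hk := (hash_mul_kap hg h0 hu.ne').1
  rw [abs_of_pos hu] at hk
  have hd := disc_hash hg h0 j3
  have hq : 0 < disc UL := mul_pos h0 hu
  refine ⟨⟨j1, hash_eq_wave1State hg h0 hu hs.le, hk.ge⟩, ?_, hd, hq⟩
  refine lt_trans ?_ (u_lt_lambda2 hg (h0.trans j1))
  rw [hash_u]
  exact div_pos hq (h0.trans j1)

theorem IsLeftShock.compare {g : ℝ} {UL U U' : State} (hg : 0 < g) (hUL : 0 < UL.h)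
    (h : IsLeftShock g UL U) (h' : IsLeftShock g UL U') (hlt : U.h < U'.h) :
    disc U' < disc U ∧ head g U < head g U' ∧ lambda2 g U' < lambda2 g U := by
  obtain ⟨h1, h2, h3⟩ := h
  obtain ⟨-, h5, -⟩ := h'
  rw [h2, h5]
  exact ⟨left_disc_lt hg hUL h1.le hlt h3, left_head_lt hg hUL h1.le hlt h3,
    left_lambda2_lt hg hUL (hUL.trans h1).le hlt⟩

theorem IsLeftShock.eq_of_h {g : ℝ} {UL U U' : State} 
    (h : IsLeftShock g UL U) (h' : IsLeftShock g UL U') (hh : U.h = U'.h) : U = U' := by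
  rw [h.2.1, h'.2.1, hh]

theorem IsLeftShock.le_of_disc {g : ℝ} {UL U U' : State} (hg : 0 < g) (hUL : 0 < UL.h)
    (h : IsLeftShock g UL U) (h' : IsLeftShock g UL U') (hd : disc U' ≤ disc U) :
    U.h ≤ U'.h ∧ head g U ≤ head g U' := by
  rcases lt_trichotomy U.h U'.h with hh | hh | hh
  · exact ⟨hh.le, (h.compare hg hUL h' hh).2.1.le⟩
  · rw [h.eq_of_h h' hh]; exact ⟨le_rfl, le_rfl⟩
  · exact absurd hd (h'.compare hg hUL h hh).1.not_ge

theorem IsLeftShock.lt_of_lambda2 {g : ℝ} {UL U U' : State} (hg : 0 < g) (hUL : 0 < UL.h)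
    (h : IsLeftShock g UL U) (h' : IsLeftShock g UL U') (hl : lambda2 g U' < lambda2 g U) :
    U.h < U'.h := by
  rcases lt_trichotomy U.h U'.h with hh | hh | hh
  · exact hh
  · rw [h.eq_of_h h' hh] at hl; exact absurd hl (lt_irrefl _)
  · exact absurd hl (h'.compare hg hUL h hh).2.2.not_gt

theorem critical_of_lambda2_zero {g : ℝ} {Q : State} (hg : 0 < g) (h0 : 0 < Q.h)
    (h : lambda2 g Q = 0) : disc Q = -(Q.h * √(g * Q.h)) ∧ head g Q = 3 / 2 * Q.h ∧
      disc Q < 0 ∧ Q.h = hcrit g (disc Q) := by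
  have hs := sq_eq_of_lambda2_zero (by positivity) h
  have hc : 0 < √(g * Q.h) := by positivity
  have hu : Q.u = -√(g * Q.h) := by unfold lambda2 at h; linarith
  refine ⟨by unfold disc; rw [hu]; ring, ?_, by unfold disc; rw [hu]; nlinarith, ?_⟩
  · unfold head colHead; rw [hs]; field_simp; ring
  · exact le_antisymm ((le_hcrit_disc_iff hg h0).2 hs.ge) ((hcrit_disc_le_iff hg h0).2 hs.le)

/-! ### Critical states and 2-waves of nonpositive speed -/

/-- Critical states farther down on `λ₂ = 0` have smaller discharge and larger head. -/
theorem critical_compare {g : ℝ} {Q Q' : State} (hg : 0 < g) (h0 : 0 < Q.h)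
    (h : lambda2 g Q = 0) (h' : lambda2 g Q' = 0) (hlt : Q.h < Q'.h) :
    disc Q' < disc Q ∧ head g Q < head g Q' := by
  obtain ⟨a1, a2, -⟩ := critical_of_lambda2_zero hg h0 h
  obtain ⟨b1, b2, -⟩ := critical_of_lambda2_zero hg (h0.trans hlt) h'
  rw [a1, b1, a2, b2]
  have h1 := sqrt_lt_sqrt_mul hg h0.le hlt
  have := mul_lt_mul'' hlt h1 h0.le (Real.sqrt_nonneg _)
  exact ⟨by linarith, by linarith⟩

/-- The Riemann invariant `u - 2√(g h)` is constant in a 2-rarefaction and equals `-3√(g h)` where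
`λ₂ = 0`. -/
theorem rar2_critical_h {g : ℝ} {U Q : State} (hg : 0 < g) (hl : Links g rar2 U Q)
    (hQ : lambda2 g Q = 0) : 3 * √(g * Q.h) = 2 * √(g * U.h) - U.u := by
  obtain ⟨-, -, -, h4⟩ := hl
  rw [rarJump_eq hg] at h4
  unfold lambda2 at hQ
  linarith

theorem lt_of_sqrt_mul_lt {g x y : ℝ} (hg : 0 < g) (h : √(g * x) < √(g * y)) : x < y := by
  by_contra! hn
  exact h.not_ge (Real.sqrt_le_sqrt (mul_le_mul_of_nonneg_left hn hg.le))

theorem rar2_critical_lt {g : ℝ} {UL U U' : State} (hg : 0 < g) (hUL : 0 < UL.h)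
    (h : IsLeftShock g UL U) (h' : IsLeftShock g UL U') (hlt : U.h < U'.h) :
    2 * √(g * U.h) - U.u < 2 * √(g * U'.h) - U'.u := by
  have h1 := velJump_strictMono hg hUL (hUL.trans h.1).le hlt
  have h2 := sqrt_lt_sqrt_mul hg (hUL.trans h.1).le hlt
  have e1 : U.u = UL.u - velJump g UL.h U.h := congrArg State.u h.2.1
  have e2 : U'.u = UL.u - velJump g UL.h U'.h := congrArg State.u h'.2.1
  linarith

theorem continuous_lambda2_wave1State {g : ℝ} {U : State} (h0 : 0 < U.h) :
    Continuous fun h => lambda2 g (wave1State g U h) := by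
  have := continuous_wave1State (g := g) h0
  unfold lambda2
  simp only [wave1State] at *
  fun_prop

theorem isLeftShock_wave1State {g : ℝ} {UL U : State} {x : ℝ} (hg : 0 < g) (hUL : 0 < UL.h)
    (h : IsLeftShock g UL U) (hx : U.h ≤ x) : IsLeftShock g UL (wave1State g UL x) :=
  ⟨h.1.trans_le hx, rfl, h.2.2.trans
    ((mul_kap_le_iff hg hUL (hUL.trans h.1) (hUL.trans (h.1.trans_le hx))).2 hx)⟩

/-- The comparison passes through the critical state of the 1-shock curve between `U₁` and `U`:
first along that curve, then along the critical states up to `Q`, which is deeper by the Riemann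
invariant. -/
theorem rarContact_compare {g : ℝ} {UL U₁ U Q : State} (hg : 0 < g) (hUL : UL ∈ G1 g)
    (h₁ : IsLeftShock g UL U₁) (hl₁ : 0 ≤ lambda2 g U₁) (h : IsLeftShock g UL U)
    (hl : Links g rar2 U Q) (hQ : lambda2 g Q = 0) :
    disc Q < disc U₁ ∧ head g U₁ < head g Q := by
  have hL0 := hUL.1
  have hU2 : lambda2 g U < 0 := hQ ▸ rar2_lambda2 hg hl
  have hlt := h₁.lt_of_lambda2 hg hL0 h (hU2.trans_le hl₁)
  obtain ⟨x, hx, hx0⟩ := exists_root hlt.le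
    (continuous_lambda2_wave1State (g := g) hL0).continuousOn
    (by rw [← h₁.2.1]; exact hl₁) (by rw [← h.2.1]; exact hU2.le)
  have hK := isLeftShock_wave1State hg hL0 h₁ hx.1
  have hx' : x < U.h := by
    rcases hx.2.eq_or_lt with e | e
    · rw [e, ← h.2.1] at hx0; linarith
    · exact e
  have a := h₁.le_of_disc hg hL0 hK (by
    rcases hx.1.eq_or_lt with e | e
    · rw [← e, ← h₁.2.1]
    · exact (h₁.compare hg hL0 hK e).1.le)
  have a' : disc (wave1State g UL x) ≤ disc U₁ := by
    rcases hx.1.eq_or_lt with e | e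
    · rw [← e, ← h₁.2.1]
    · exact (h₁.compare hg hL0 hK e).1.le
  have b := rar2_critical_lt hg hL0 hK h hx'
  rw [← rar2_critical_h hg hl hQ] at b
  have hKQ : x < Q.h := by
    refine lt_of_sqrt_mul_lt hg ?_
    unfold lambda2 at hx0
    simp only [wave1State] at hx0 b
    linarith
  have hx0' : 0 < x := (hL0.trans h₁.1).trans_le hx.1
  have c := critical_compare (Q := wave1State g UL x) hg hx0' hx0 hQ hKQ
  exact ⟨c.1.trans_le a', a.2.trans_lt c.2⟩

/-- Across a 2-shock of nonpositive speed the head increases from left to right. -/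
theorem shock2_head_lt {g : ℝ} {U Q : State} (hg : 0 < g) (hQ : 0 < Q.h) (hlt : Q.h < U.h)
    (hp : phi2 g U Q = 0) (hs : Q.u + U.h * kap g Q.h U.h ≤ 0) :
    disc U ≤ disc Q ∧ head g U < head g Q := by
  have hU := hQ.trans hlt
  have hk := kap_pos hg hQ hU
  have hk2 := kap_sq' hg hQ hU
  rw [phi2_eq, velJump_of_lt hlt, shockJump_eq] at hp
  generalize kap g Q.h U.h = k at *
  have hu : U.u = Q.u + (U.h - Q.h) * k := by linarith
  unfold disc head colHead
  rw [hu]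
  constructor
  · nlinarith
  have e1 : (Q.h + Q.u ^ 2 / (2 * g)) - (U.h + (Q.u + (U.h - Q.h) * k) ^ 2 / (2 * g))
      = (U.h - Q.h) * (-(2 * k) * (Q.u + U.h * k) + (U.h + Q.h) * k ^ 2 - 2 * g) / (2 * g) := by
    field_simp; ring
  have e2 : 0 < (U.h + Q.h) * k ^ 2 - 2 * g := by
    have : (2 * U.h * Q.h) * ((U.h + Q.h) * k ^ 2 - 2 * g) = g * (U.h - Q.h) ^ 2 := by
      linear_combination (U.h + Q.h) * hk2
    have h3 : 0 < g * (U.h - Q.h) ^ 2 := mul_pos hg (pow_pos (by linarith) 2)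
    rw [← this] at h3
    exact pos_of_mul_pos_right h3 (by positivity)
  have e3 : 0 ≤ -(2 * k) * (Q.u + U.h * k) := by nlinarith
  have := div_pos (mul_pos (sub_pos.2 hlt) (show 0 < -(2 * k) * (Q.u + U.h * k)
    + (U.h + Q.h) * k ^ 2 - 2 * g by linarith)) (show 0 < 2 * g by positivity)
  linarith

theorem head_le_of_subcritical {g : ℝ} {U : State} (hg : 0 < g) (h : U.u ^ 2 ≤ g * U.h) :
    head g U ≤ 3 / 2 * U.h := by
  have : U.u ^ 2 / (2 * g) ≤ U.h / 2 := by
    rw [div_le_iff₀ (by positivity)]; linarith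
  unfold head colHead; linarith

theorem lt_head_of_supercritical {g : ℝ} {U : State} (hg : 0 < g) (h : g * U.h < U.u ^ 2) :
    3 / 2 * U.h < head g U := by
  have : U.h / 2 < U.u ^ 2 / (2 * g) := by
    rw [lt_div_iff₀ (by positivity)]; linarith
  unfold head colHead; linarith

/-- The data of a 1-shock followed by a 2-wave, both of nonpositive speed, to a state with
`λ₂ < 0`. -/
def LeftTwoWaves (g : ℝ) (UL U Q : State) : Prop :=
  IsLeftShock g UL U ∧ 0 < Q.h ∧ phi2 g U Q = 0 ∧ Q.a = U.a ∧
    (Q.h < U.h → Q.u + U.h * kap g Q.h U.h ≤ 0) ∧ lambda2 g Q < 0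

/-- If the 2-wave is a rarefaction, the depths decide, since the head is at most `3/2 h` in
subcritical and more than that in supercritical flow. If it is a shock of nonpositive speed, both
shocks raise the head. -/
theorem LeftTwoWaves.head_lt {g : ℝ} {UL U₁ U Q : State} (hg : 0 < g) (hUL : UL ∈ G1 g)
    (h₁ : IsLeftShock g UL U₁) (hl₁ : 0 ≤ lambda2 g U₁) (h : LeftTwoWaves g UL U Q)
    (hd : disc Q ≤ disc U₁) : head g U₁ < head g Q := by
  obtain ⟨hU, hQ0, hp, ha, hs, hQ2⟩ := h
  have hL0 := hUL.1
  rcases lt_trichotomy U.h Q.h with hh | hh | hh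
  · have hl2 := rar2_lambda2 hg (links_rar2_of_phi2 (hL0.trans hU.1).le hh hp ha)
    have hlt := h₁.lt_of_lambda2 hg hL0 hU (by linarith)
    obtain ⟨f1, f2, -⟩ := h₁.facts hg hUL
    have a := head_le_of_subcritical hg ((mem_closedG2_iff hg).1 ⟨f1, f2.le, hl₁⟩).2
    have b := lt_head_of_supercritical hg ((lambda2_neg_iff (by positivity)).1 hQ2).2
    linarith
  · have hUQ : U = Q := by
      rw [phi2_eq, hh, velJump_self] at hp
      exact State.ext hh (by linarith) ha.symm
    subst hUQ
    exact (h₁.compare hg hL0 hU (h₁.lt_of_lambda2 hg hL0 hU (by linarith))).2.1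
  · obtain ⟨a, b⟩ := shock2_head_lt hg hQ0 hh hp (hs hh)
    exact (h₁.le_of_disc hg hL0 hU (a.trans hd)).2.trans_lt b

theorem IsWaveContact.data {g : ℝ} {UL R : State} {F : Fan} (h : IsWaveContact g UL R F) :
    ∃ U Q W, UL.a < R.a ∧ LeftTwoWaves g UL U Q ∧ StationaryContact g Q W ∧ W.a = R.a ∧
      lambda2 g W = 0 ∧ phi2 g W R = 0 ∧
      F = (shock1, U) :: (wave2Fan U Q ++ (contact, W) :: wave2Fan W R) := by
  obtain ⟨U, Q, W, h0, h1, h2, h3, h4, h5, h6, h7, h8, h9, h10, h11⟩ := h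
  exact ⟨U, Q, W, h0, ⟨h1, h2, h3, h4, h5, h6⟩, h7, h8, h9, h10, h11⟩

/-- `λ₂` increases strictly along the backward 2-wave curve, so it vanishes there at most once. -/
theorem critical_unique {g : ℝ} {W W' R : State} (hg : 0 < g) (hR : 0 < R.h) (hW : 0 < W.h)
    (hW' : 0 < W'.h) (hl : lambda2 g W = 0) (hl' : lambda2 g W' = 0) (hp : phi2 g W R = 0)
    (hp' : phi2 g W' R = 0) (ha : W.a = W'.a) : W = W' := by
  rcases lt_trichotomy W.h W'.h with h | h | h
  · linarith [right_lambda2_lt hg hR hW.le h hp hp']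
  · exact eq_of_phi2 hp hp' h ha
  · linarith [right_lambda2_lt hg hR hW'.le h hp' hp]

/-- The critical state is the lower end of the part of the curve with `λ₂ ≥ 0`. -/
theorem critical_le {g : ℝ} {W V R : State} (hg : 0 < g) (hR : 0 < R.h) (hR2 : 0 < lambda2 g R)
    (hW : 0 < W.h) (hV : 0 < V.h) (hl : lambda2 g W = 0) (hl' : 0 ≤ lambda2 g V)
    (hp : phi2 g W R = 0) (hp' : phi2 g V R = 0) : disc W ≤ disc V ∧ head g W ≤ head g V := by
  rcases lt_trichotomy W.h V.h with h | h | h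
  · have := right_mono hg hR hR2 hW.le hp hp' hl.ge h
    exact ⟨this.1.le, this.2.le⟩
  · have : W.u = V.u := by rw [phi2_eq] at hp hp'; rw [h] at hp; linarith
    unfold disc head; rw [h, this]; exact ⟨le_rfl, le_rfl⟩
  · linarith [right_lambda2_lt hg hR hV.le h hp' hp]

/-! ### Uniqueness among the solutions that begin with a 1-shock -/

/-- The solutions that begin with a 1-shock and contain no 1-rarefaction. -/
def IsLower (g : ℝ) (UL R : State) (F : Fan) : Prop :=
  IsShockContact g UL R F ∨ IsRarContact g UL R F ∨ IsWaveContact g UL R F ∨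
    IsBackResonant g UL R F

section Unique

variable {g : ℝ} {UL R : State} {F F' : Fan}

theorem shockContact_unique (hg : 0 < g) (hUL : UL ∈ G1 g) (hR : 0 < R.h)
    (hR2 : 0 < lambda2 g R) (h : IsShockContact g UL R F) (h' : IsShockContact g UL R F') :
    F = F' := by
  obtain ⟨U, V, hU, hU2, hc, ha, hs, hp, hl, rfl⟩ := h
  obtain ⟨U', V', hU', hU2', hc', ha', hs', hp', hl', rfl⟩ := h'
  have hL0 := hUL.1
  obtain ⟨c1, c2⟩ := contact_disc_head hg hc
  obtain ⟨c1', c2'⟩ := contact_disc_head hg hc'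
  have f := (hU.facts hg hUL).2.2.1
  have f' := (hU'.facts hg hUL).2.2.1
  have hUU : U = U' := by
    rcases lt_trichotomy U.h U'.h with h | h | h
    · obtain ⟨d1, d2, -⟩ := hU.compare hg hL0 hU' h
      exact (right_no_cross hg hR hR2 hc.2.1 hc'.2.1 hp hp' hl hl' (by linarith)
        (by linarith)).elim
    · exact hU.eq_of_h hU' h
    · obtain ⟨d1, d2, -⟩ := hU'.compare hg hL0 hU h
      exact (right_no_cross hg hR hR2 hc'.2.1 hc.2.1 hp' hp hl' hl (by linarith)
        (by linarith)).elim
  subst hUU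
  have hVV : V = V' := by
    refine eq_of_phi2 hp hp' ?_ (ha.trans ha'.symm)
    rcases lt_trichotomy V.h V'.h with h | h | h
    · have := (right_mono hg hR hR2 hc.2.1.le hp hp' hl h).1; linarith
    · exact h
    · have := (right_mono hg hR hR2 hc'.2.1.le hp' hp hl' h).1; linarith
  rw [hVV]

theorem rarContact_unique (hg : 0 < g) (hUL : UL ∈ G1 g) (hR : 0 < R.h)
    (hR2 : 0 < lambda2 g R) (h : IsRarContact g UL R F) (h' : IsRarContact g UL R F') :
    F = F' := by
  obtain ⟨U, Q, V, -, hU, hr, hQ, hc, ha, hs, hp, hl, rfl⟩ := h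
  obtain ⟨U', Q', V', -, hU', hr', hQ', hc', ha', hs', hp', hl', rfl⟩ := h'
  have hL0 := hUL.1
  obtain ⟨c1, c2⟩ := contact_disc_head hg hc
  obtain ⟨c1', c2'⟩ := contact_disc_head hg hc'
  have f := (hU.facts hg hUL).2.2.1
  have f' := (hU'.facts hg hUL).2.2.1
  have fa : Q.a = U.a := (links_wave2 (.inr rfl) hr).2.1
  have fa' : Q'.a = U'.a := (links_wave2 (.inr rfl) hr').2.1
  have e := rar2_critical_h hg hr hQ
  have e' := rar2_critical_h hg hr' hQ'
  have hUU : U = U' := by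
    rcases lt_trichotomy U.h U'.h with h | h | h
    · have := rar2_critical_lt hg hL0 hU hU' h
      obtain ⟨d1, d2⟩ := critical_compare hg hc.1 hQ hQ' (lt_of_sqrt_mul_lt hg (by linarith))
      exact (right_no_cross hg hR hR2 hc.2.1 hc'.2.1 hp hp' hl hl' (by linarith)
        (by linarith)).elim
    · exact hU.eq_of_h hU' h
    · have := rar2_critical_lt hg hL0 hU' hU h
      obtain ⟨d1, d2⟩ := critical_compare hg hc'.1 hQ' hQ (lt_of_sqrt_mul_lt hg (by linarith))
      exact (right_no_cross hg hR hR2 hc'.2.1 hc.2.1 hp' hp hl' hl (by linarith)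
        (by linarith)).elim
  subst hUU
  have hQQ : Q = Q' := by
    have hs : √(g * Q.h) = √(g * Q'.h) := by linarith
    have hh : Q.h = Q'.h := by
      rcases lt_trichotomy Q.h Q'.h with h | h | h
      · linarith [sqrt_lt_sqrt_mul hg hc.1.le h]
      · exact h
      · linarith [sqrt_lt_sqrt_mul hg hc'.1.le h]
    unfold lambda2 at hQ hQ'
    exact State.ext hh (by linarith) (fa.trans fa'.symm)
  subst hQQ
  have hVV : V = V' := by
    refine eq_of_phi2 hp hp' ?_ (ha.trans ha'.symm)
    rcases lt_trichotomy V.h V'.h with h | h | h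
    · have := (right_mono hg hR hR2 hc.2.1.le hp hp' hl h).1; linarith
    · exact h
    · have := (right_mono hg hR hR2 hc'.2.1.le hp' hp hl' h).1; linarith
  rw [hVV]

theorem supercritical_contact_unique {g : ℝ} {Q Q' W : State} (hg : 0 < g)
    (hc : StationaryContact g Q W) (hc' : StationaryContact g Q' W)
    (hQ : lambda2 g Q < 0) (hQ' : lambda2 g Q' < 0) (ha : Q.a = Q'.a) : Q = Q' := by
  obtain ⟨c1, c2⟩ := contact_disc_head hg hc
  obtain ⟨c1', c2'⟩ := contact_disc_head hg hc'
  have h0 := hc.1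
  have h0' := hc'.1
  have hd : disc Q = disc Q' := c1.trans c1'.symm
  have s := (lt_hcrit_disc_iff hg h0).2 ((lambda2_neg_iff (by positivity)).1 hQ).2
  have s' := (lt_hcrit_disc_iff hg h0').2 ((lambda2_neg_iff (by positivity)).1 hQ').2
  refine state_ext_disc h0 ?_ hd ha
  refine supercritical_depth_unique (q := disc Q) hg h0 h0' s.le (by rw [hd]; exact s'.le) ?_
  rw [← head_eq_specHead h0, hd, ← head_eq_specHead h0']
  linarith

theorem waveContact_unique (hg : 0 < g) (hUL : UL ∈ G1 g) (hR : 0 < R.h)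
    (h : IsWaveContact g UL R F) (h' : IsWaveContact g UL R F') :
    F = F' := by
  obtain ⟨U, Q, W, -, ⟨hU, hQ0, hUQ, hQa, -, hQ2⟩, hc, ha, hl, hp, rfl⟩ := h.data
  obtain ⟨U', Q', W', -, ⟨hU', hQ0', hUQ', hQa', -, hQ2'⟩, hc', ha', hl', hp', rfl⟩ := h'.data
  have hL0 := hUL.1
  obtain rfl := critical_unique hg hR hc.2.1 hc'.2.1 hl hl' hp hp' (ha.trans ha'.symm)
  have f := (hU.facts hg hUL).2.2.1
  have f' := (hU'.facts hg hUL).2.2.1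
  obtain rfl := supercritical_contact_unique hg hc hc' hQ2 hQ2' (by rw [hQa, hQa', f, f'])
  have hUU : U = U' := by
    refine hU.eq_of_h hU' ?_
    rw [hU.2.1] at hUQ
    rw [hU'.2.1] at hUQ'
    rcases lt_trichotomy U.h U'.h with h | h | h
    · linarith [phi2_wave1State_lt (R := Q) hg hL0 hQ0 (hL0.trans hU.1).le h]
    · exact h
    · linarith [phi2_wave1State_lt (R := Q) hg hL0 hQ0 (hL0.trans hU'.1).le h]
  rw [hUU]

/-- The head of the left-hand shock state in a solution with a stationary 2-shock. -/
theorem backResonant_head {g : ℝ} {U Z W : State} (hg : 0 < g)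
    (hc : StationaryContact g U (hash g Z)) (hZ0 : 0 < Z.h) (hZ : lambda2 g Z < 0)
    (hc' : StationaryContact g Z W) : disc U = disc W ∧ disc Z = disc W ∧ disc Z ≠ 0 ∧
      Z.h < hcrit g (disc Z) ∧
      U.a + head g U = W.a + head g W - jumpLoss g (disc Z) Z.h ∧
      0 < jumpLoss g (disc Z) Z.h := by
  obtain ⟨hu, hs⟩ := (lambda2_neg_iff (by positivity)).1 hZ
  have hq : disc Z ≠ 0 := mul_ne_zero hZ0.ne' hu.ne
  have hcr := (lt_hcrit_disc_iff hg hZ0).2 hs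
  obtain ⟨c1, c2⟩ := contact_disc_head hg hc
  obtain ⟨c1', c2'⟩ := contact_disc_head hg hc'
  rw [disc_hash hg hZ0 hq] at c1
  rw [head_hash hg hZ0 hq, hash_a] at c2
  exact ⟨c1.trans c1', c1', hq, hcr, by linarith, jumpLoss_pos hg hq hZ0 hcr⟩

/-- The critical end state is determined by the 2-wave curve; its discharge fixes the 1-shock, and
the head that has to be lost fixes the depth in front of the stationary 2-shock. -/
theorem backResonant_unique (hg : 0 < g) (hUL : UL ∈ G1 g) (hR : 0 < R.h)
    (h : IsBackResonant g UL R F) (h' : IsBackResonant g UL R F') :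
    F = F' := by
  obtain ⟨U, Z, W, -, -, hU, hU2, hc, hZ0, hZ2, hcW, ha, hl, hp, rfl⟩ := h
  obtain ⟨U', Z', W', -, -, hU', hU2', hc', hZ0', hZ2', hcW', ha', hl', hp', rfl⟩ := h'
  have hL0 := hUL.1
  obtain rfl := critical_unique hg hR hcW.2.1 hcW'.2.1 hl hl' hp hp' (ha.trans ha'.symm)
  obtain ⟨b1, b2, b3, b4, b5, b6⟩ := backResonant_head hg hc hZ0 hZ2 hcW
  obtain ⟨b1', b2', b3', b4', b5', b6'⟩ := backResonant_head hg hc' hZ0' hZ2' hcW'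
  have hdU : disc U = disc U' := b1.trans b1'.symm
  have hUU : U = U' := by
    refine hU.eq_of_h hU' (le_antisymm ?_ ?_)
    · exact (hU.le_of_disc hg hL0 hU' hdU.ge).1
    · exact (hU'.le_of_disc hg hL0 hU hdU.le).1
  subst hUU
  have hdZ : disc Z = disc Z' := b2.trans b2'.symm
  have hZZ : Z = Z' := by
    have hh : Z.h = Z'.h := by
      rw [← hdZ] at b4' b5'
      rcases lt_trichotomy Z.h Z'.h with h | h | h
      · linarith [jumpLoss_strictAnti hg b3 hZ0 h b4'.le]
      · exact h
      · linarith [jumpLoss_strictAnti hg b3 hZ0' h b4.le]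
    refine state_ext_disc hZ0 hh hdZ ?_
    have e : head g Z = head g Z' := by
      rw [head_eq_specHead hZ0, head_eq_specHead hZ0', hh, hdZ]
    have := (contact_disc_head hg hcW).2
    have := (contact_disc_head hg hcW').2
    linarith
  rw [hZZ]

theorem shockContact_rarContact (hg : 0 < g) (hUL : UL ∈ G1 g) (hR : 0 < R.h)
    (hR2 : 0 < lambda2 g R) (h : IsShockContact g UL R F) (h' : IsRarContact g UL R F') :
    False := by
  obtain ⟨U, V, hU, hU2, hc, ha, hs, hp, hl, rfl⟩ := h
  obtain ⟨U', Q', V', -, hU', hr', hQ', hc', ha', hs', hp', hl', rfl⟩ := h'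
  obtain ⟨c1, c2⟩ := contact_disc_head hg hc
  obtain ⟨c1', c2'⟩ := contact_disc_head hg hc'
  have f := (hU.facts hg hUL).2.2.1
  have f' := (hU'.facts hg hUL).2.2.1
  have fa' : Q'.a = U'.a := (links_wave2 (.inr rfl) hr').2.1
  obtain ⟨d1, d2⟩ := rarContact_compare hg hUL hU hU2 hU' hr' hQ'
  exact right_no_cross hg hR hR2 hc.2.1 hc'.2.1 hp hp' hl hl' (by linarith) (by linarith)

theorem shockContact_waveContact (hg : 0 < g) (hUL : UL ∈ G1 g) (hR : 0 < R.h)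
    (hR2 : 0 < lambda2 g R) (h : IsShockContact g UL R F) (h' : IsWaveContact g UL R F') :
    False := by
  obtain ⟨U, V, hU, hU2, hc, ha, hs, hp, hl, rfl⟩ := h
  obtain ⟨U', Q', W', -, hW, hc', ha', hl', hp', rfl⟩ := h'.data
  obtain ⟨c1, c2⟩ := contact_disc_head hg hc
  obtain ⟨c1', c2'⟩ := contact_disc_head hg hc'
  have f := (hU.facts hg hUL).2.2.1
  have f' := (hW.1.facts hg hUL).2.2.1
  have fa := hW.2.2.2.1
  obtain ⟨d1, d2⟩ := critical_le hg hR hR2 hc'.2.1 hc.2.1 hl' hl hp' hp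
  have := hW.head_lt hg hUL hU hU2 (by linarith)
  linarith

theorem shockContact_backResonant (hg : 0 < g) (hUL : UL ∈ G1 g) (hR : 0 < R.h)
    (hR2 : 0 < lambda2 g R) (h : IsShockContact g UL R F) (h' : IsBackResonant g UL R F') :
    False := by
  obtain ⟨U, V, hU, hU2, hc, ha, hs, hp, hl, rfl⟩ := h
  obtain ⟨U', Z', W', -, -, hU', hU2', hc', hZ0', hZ2', hcW', ha', hl', hp', rfl⟩ := h'
  obtain ⟨c1, c2⟩ := contact_disc_head hg hc
  obtain ⟨b1', b2', b3', b4', b5', b6'⟩ := backResonant_head hg hc' hZ0' hZ2' hcW'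
  have f := (hU.facts hg hUL).2.2.1
  have f' := (hU'.facts hg hUL).2.2.1
  obtain ⟨d1, d2⟩ := critical_le hg hR hR2 hcW'.2.1 hc.2.1 hl' hl hp' hp
  have := (hU.le_of_disc hg hUL.1 hU' (by linarith)).2
  linarith

/-- Both solutions end at the same critical state, so `U`, `Z` and `Q` share its discharge. As `Z`
lies at a higher level than `Q`, it is deeper and loses less head, whence `(hash g Q).h < U.h`. In
the other solution the discharge gives `U.h ≤ U'.h` and the sign of the 2-shock speed gives `U'.h ≤
(hash g Q).h`. -/
theorem backResonant_waveContact (hg : 0 < g) (hUL : UL ∈ G1 g) (hR : 0 < R.h)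
    (h : IsBackResonant g UL R F) (h' : IsWaveContact g UL R F') : False := by
  obtain ⟨U, Z, W, hZa, -, hU, hU2, hc, hZ0, hZ2, hcW, ha, hl, hp, rfl⟩ := h
  obtain ⟨U', Q, W', -, ⟨hU', hQ0, hUQ, hQa, hs, hQ2⟩, hc', ha', hl', hp', rfl⟩ := h'.data
  have hL0 := hUL.1
  obtain rfl := critical_unique hg hR hcW.2.1 hc'.2.1 hl hl' hp hp' (ha.trans ha'.symm)
  obtain ⟨b1, b2, b3, b4, b5, b6⟩ := backResonant_head hg hc hZ0 hZ2 hcW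
  obtain ⟨c1, c2⟩ := contact_disc_head hg hc'
  obtain ⟨f1, f2, f3, -⟩ := hU.facts hg hUL
  have f3' := (hU'.facts hg hUL).2.2.1
  have hcU : hcrit g (disc U) ≤ U.h :=
    (hcrit_disc_le_iff hg f1).2 ((mem_closedG2_iff hg).1 ⟨f1, f2.le, hU2⟩).2
  obtain ⟨qu, qs⟩ := (lambda2_neg_iff (by positivity)).1 hQ2
  have hcQ := (lt_hcrit_disc_iff hg hQ0).2 qs
  have hdUQ : disc U = disc Q := b1.trans c1.symm
  have hQU : Q.h < U.h := by rw [hdUQ] at hcU; linarith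
  rcases le_or_gt U'.h Q.h with hh | hh
  · have hU'2 : lambda2 g U' < 0 := by
      rcases hh.eq_or_lt with hh | hh
      · have : U' = Q := by
          rw [phi2_eq, hh, velJump_self] at hUQ
          exact State.ext hh (by linarith) hQa.symm
        rw [this]; exact hQ2
      · have := rar2_lambda2 hg (links_rar2_of_phi2 (hL0.trans hU'.1).le hh hUQ hQa)
        linarith
    have := hU.lt_of_lambda2 hg hL0 hU' (by linarith)
    linarith
  · have hd := (shock2_head_lt hg hQ0 hh hUQ (hs hh)).1
    have hle := (hU.le_of_disc hg hL0 hU' (by linarith)).1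
    obtain ⟨j1, j2, j3⟩ := lt_hash_h hg hQ0 qs
    have hk := (hash_mul_kap hg hQ0 qu.ne).1
    rw [abs_of_neg qu] at hk
    have hle2 : U'.h ≤ (hash g Q).h :=
      (mul_kap_le_iff hg hQ0 (hQ0.trans hh) (hQ0.trans j1)).1 (by rw [hk]; linarith [hs hh])
    have hZQ : disc Z = disc Q := b2.trans c1.symm
    have hQZ : Q.h < Z.h := by
      refine lt_of_specHead_lt_super (q := disc Q) hg hZ0 hcQ.le ?_
      rw [← head_eq_specHead hQ0, ← hZQ, ← head_eq_specHead hZ0]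
      have := (contact_disc_head hg hcW).2
      linarith
    have hloss := jumpLoss_strictAnti hg j3 hQ0 hQZ (by rw [← hZQ]; exact b4.le)
    have : (hash g Q).h < U.h := by
      refine lt_of_specHead_lt_sub (q := disc Q) hg f1 (by rw [← hdUQ]; exact hcU) ?_
      rw [← hdUQ, ← head_eq_specHead f1, hdUQ]
      have e := head_eq_specHead (g := g) (U := hash g Q) (hQ0.trans j1)
      rw [disc_hash hg hQ0 j3, head_hash hg hQ0 j3] at e
      rw [← e]
      rw [hZQ] at b5
      linarith
    linarith

/-- `IsRarContact` needs a falling bottom, `IsWaveContact` and `IsBackResonant` a rising one. The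
remaining pairs are separated by comparing discharge and head. -/
theorem lower_unique (hg : 0 < g) (hUL : UL ∈ G1 g) (hR : 0 < R.h)
    (hR2 : 0 < lambda2 g R) (h : IsLower g UL R F) (h' : IsLower g UL R F') : F = F' := by
  have level : ∀ {F F' : Fan}, IsRarContact g UL R F →
      (IsWaveContact g UL R F' ∨ IsBackResonant g UL R F') → False := by
    rintro F F' ⟨_, _, _, h1, -⟩ (⟨_, _, _, h2, -⟩ | ⟨_, _, _, h2, h3, -⟩) <;> linarith
  rcases h with h | h | h | h <;> rcases h' with h' | h' | h' | h'
  · exact shockContact_unique hg hUL hR hR2 h h'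
  · exact (shockContact_rarContact hg hUL hR hR2 h h').elim
  · exact (shockContact_waveContact hg hUL hR hR2 h h').elim
  · exact (shockContact_backResonant hg hUL hR hR2 h h').elim
  · exact (shockContact_rarContact hg hUL hR hR2 h' h).elim
  · exact rarContact_unique hg hUL hR hR2 h h'
  · exact (level h (.inl h')).elim
  · exact (level h (.inr h')).elim
  · exact (shockContact_waveContact hg hUL hR hR2 h' h).elim
  · exact (level h' (.inl h)).elim
  · exact waveContact_unique hg hUL hR h h'
  · exact (backResonant_waveContact hg hUL hR h' h).elim
  · exact (shockContact_backResonant hg hUL hR hR2 h' h).elim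
  · exact (level h' (.inr h)).elim
  · exact (backResonant_waveContact hg hUL hR h h').elim
  · exact backResonant_unique hg hUL hR h h'

end Unique

/-! ### The two reference states behind the contact -/

theorem hash_of_critical {g : ℝ} {V : State} (hg : 0 < g) (hV : 0 < V.h) (hq : disc V ≠ 0)
    (hs : V.u ^ 2 = g * V.h) : hash g V = V := by
  have hVc : V.h = hcrit g (disc V) :=
    le_antisymm ((le_hcrit_disc_iff hg hV).2 hs.ge) ((hcrit_disc_le_iff hg hV).2 hs.le)
  have h1 : (hash g V).h = V.h := by
    have := jumpDepth_hcrit hg hq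
    rwa [← hVc, ← hash_h hV.ne'] at this
  exact state_ext_disc (by rw [h1]; exact hV) h1 (disc_hash hg hV hq) rfl

section Signs

variable {g : ℝ} {UL R O S : State} {F F' : Fan}

theorem contact_supercritical_facts (hg : 0 < g) (hUL : UL ∈ G1 g)
    (hO : StationaryContact g UL O) :
    0 < O.h ∧ 0 < O.u ∧ 0 ≤ lambda1 g O ∧ disc O = disc UL ∧ O.h ≤ hcrit g (disc UL) ∧
      O.a + head g O = UL.a + head g UL := by
  obtain ⟨c1, c2⟩ := contact_disc_head hg hO
  obtain ⟨a1, a2⟩ := contact_supercritical_right hg hO hUL.2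
  refine ⟨hO.2.1, a1, a2, c1.symm, ?_, c2.symm⟩
  rw [c1]
  exact (le_hcrit_disc_iff hg hO.2.1).2
    ((lambda1_nonneg_iff (mul_pos hg hO.2.1).le).1 a2).2

theorem hash_facts (hg : 0 < g) (hO : 0 < O.h) (hu : 0 < O.u) (hl : 0 ≤ lambda1 g O) :
    (hash g O).h = jumpDepth g (disc O) O.h ∧ O.h ≤ (hash g O).h ∧
      hcrit g (disc O) ≤ (hash g O).h ∧ hash g O = wave1State g O (hash g O).h ∧
      (hash g O).h * kap g O.h (hash g O).h = O.u := by
  have hq : disc O ≠ 0 := (mul_pos hO hu).ne'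
  have hs := ((lambda1_nonneg_iff (by positivity)).1 hl).2
  have hc := (le_hcrit_disc_iff hg hO).2 hs
  have h1 := hash_h (g := g) hO.ne'
  have h2 := hcrit_le_jumpDepth hg hq hO hc
  rw [← h1] at h2
  refine ⟨h1, hc.trans h2, h2, hash_eq_wave1State hg hO hu hs, ?_⟩
  rw [(hash_mul_kap hg hO hu.ne').1, abs_of_pos hu]

theorem contact_hash_facts (hg : 0 < g) (hUL : UL ∈ G1 g)
    (hS : StationaryContact g (hash g UL) S) :
    0 < S.h ∧ disc S = disc UL ∧ hcrit g (disc UL) ≤ S.h ∧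
      S.a + head g S = UL.a + head g UL - jumpLoss g (disc UL) UL.h := by
  obtain ⟨h0, hu, hs⟩ := (mem_G1_iff hg).1 hUL
  obtain ⟨j1, j2, j3⟩ := lt_hash_h hg h0 hs
  obtain ⟨c1, c2⟩ := contact_disc_head hg hS
  have hd := disc_hash hg h0 j3
  rw [head_hash hg h0 j3, hash_a] at c2
  have hs2 : (hash g UL).u ^ 2 < g * (hash g UL).h :=
    (hcrit_disc_lt_iff hg (h0.trans j1)).1 (by rwa [hd])
  have := (hcrit_disc_le_iff hg hS.2.1).2 (contact_subcritical hg hS hs2)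
  rw [← c1, hd] at this
  exact ⟨hS.2.1, c1.symm.trans hd, this, by linarith⟩

/-- The levels determine the order of the heights of `U_L^{#o}` and `U_L^{o#}`. -/
theorem hash_contact_order (hg : 0 < g) (hUL : UL ∈ G1 g) (hO : StationaryContact g UL O)
    (hOa : O.a = R.a) (hS : StationaryContact g (hash g UL) S) (hSa : S.a = R.a) :
    (UL.a < R.a → S.h < (hash g O).h) ∧ (R.a < UL.a → (hash g O).h < S.h) ∧
    (UL.a = R.a → O = UL) := by
  obtain ⟨h0, hu, hs⟩ := (mem_G1_iff hg).1 hUL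
  have hq : disc UL ≠ 0 := (mul_pos h0 hu).ne'
  have hcL := (lt_hcrit_disc_iff hg h0).2 hs
  obtain ⟨a1, a2, a3, a4, a5, a6⟩ := contact_supercritical_facts hg hUL hO
  obtain ⟨b1, b2, b3, b4⟩ := contact_hash_facts hg hUL hS
  obtain ⟨e1, e2, e3, -⟩ := hash_facts hg a1 a2 a3
  have hH0 : 0 < (hash g O).h := a1.trans_le e2
  have hOd := disc_hash hg a1 (by rw [a4]; exact hq)
  have hOh := head_hash hg a1 (by rw [a4]; exact hq)
  rw [a4] at e1 e3 hOd hOh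
  have k1 := head_eq_specHead (g := g) h0
  have k2 := head_eq_specHead (g := g) a1
  have k3 := head_eq_specHead (g := g) b1
  have k4 := head_eq_specHead (g := g) hH0
  rw [a4] at k2
  rw [b2] at k3
  rw [hOd] at k4
  refine ⟨fun h => ?_, fun h => ?_, fun h => ?_⟩
  -- Raising the bottom lowers the head and moves a supercritical depth towards the critical one, so
  -- a jump after the contact loses less head than a jump before it.
  · have : UL.h < O.h := lt_of_specHead_lt_super (q := disc UL) hg a1 hcL.le (by linarith)
    have := jumpLoss_strictAnti hg hq h0 this a5
    exact lt_of_specHead_lt_sub (q := disc UL) hg hH0 e3 (by linarith)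
  · have : O.h < UL.h := lt_of_specHead_lt_super (q := disc UL) hg h0 a5 (by linarith)
    have := jumpLoss_strictAnti hg hq a1 this hcL.le
    exact lt_of_specHead_lt_sub (q := disc UL) hg b1 b3 (by linarith)
  · refine state_ext_disc a1 ?_ a4 (by rw [hOa, h])
    exact supercritical_depth_unique (q := disc UL) hg a1 h0 a5 hcL.le (by linarith)

/-- `hash g V` is where the 1-shock has speed zero. A 1-wave allowed behind a contact stops at or
before that depth, and `Φ₂` decreases along the 1-wave curve. -/
theorem pureFan_sign (hg : 0 < g) (hR : 0 < R.h) {V : State} {U : State} (hV : 0 < V.h)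
    (hu : 0 < V.u) (hl : 0 ≤ lambda1 g V) (hp : IsPureFan g V R F)
    (hf : Follows g contact U V F) : phi2 g (hash g V) R ≤ 0 := by
  obtain ⟨e1, e2, e3, e4, e5⟩ := hash_facts hg hV hu hl
  rw [e4]
  obtain ⟨-, ⟨x, hx, hpx, rfl⟩ | ⟨hp, rfl⟩⟩ := hp
  · rw [← hpx]
    refine phi2_wave1State_le hg hV hR hx ?_
    rcases le_or_gt x V.h with h | h
    · exact h.trans e2
    · rw [wave1Fan_shock (show V.h < (wave1State g V x).h from h)] at hf
      have h1 : 0 ≤ shockSpeed V (wave1State g V x) := hf.2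
      rw [(shock1_speed (links_shock1_wave1State hV h)).1] at h1
      refine (mul_kap_le_iff hg hV (hV.trans h) (hV.trans_le e2)).1 ?_
      rw [e5]
      simp only [wave1State] at h1; linarith
  · exact (phi2_wave1State_le hg hV hR le_rfl (hV.le.trans e2)).trans hp.le

theorem contactPure_sign (hg : 0 < g) (hUL : UL ∈ G1 g) (hR : 0 < R.h)
    (hO : StationaryContact g UL O) (hOa : O.a = R.a) (h : IsContactPure g UL R F) :
    phi2 g (hash g O) R ≤ 0 ∧ ∃ F', F = (contact, O) :: F' ∧ IsPureFan g O R F' := by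
  obtain ⟨V, F', hV, hVa, rfl, hp, hf⟩ := h
  obtain ⟨a1, a2, a3, a4, a5, a6⟩ := contact_supercritical_facts hg hUL hO
  obtain ⟨b1, b2, b3, b4, b5, b6⟩ := contact_supercritical_facts hg hUL hV
  have : V = O := by
    refine state_ext_disc b1 ?_ (b4.trans a4.symm) (hVa.trans hOa.symm)
    refine supercritical_depth_unique (q := disc UL) hg b1 a1 b5 a5 ?_
    rw [← b4, ← head_eq_specHead b1, b4, ← a4, ← head_eq_specHead a1]
    linarith
  subst this
  exact ⟨pureFan_sign hg hR a1 a2 a3 hp hf, F', rfl, hp⟩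

theorem contactPure_unique (hg : 0 < g) (hUL : UL ∈ G1 g) (hR : 0 < R.h)
    (hO : StationaryContact g UL O) (hOa : O.a = R.a) (h : IsContactPure g UL R F)
    (h' : IsContactPure g UL R F') : F = F' := by
  obtain ⟨-, F₁, rfl, hp⟩ := contactPure_sign hg hUL hR hO hOa h
  obtain ⟨-, F₂, rfl, hp'⟩ := contactPure_sign hg hUL hR hO hOa h'
  rw [hp.unique hg hO.2.1 hR hp']

/-- In a solution with a stationary 1-shock between two contacts, the state behind the second
contact lies strictly between `U_L^{#o}` and `U_L^{o#}`. -/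
theorem resonant_between (hg : 0 < g) (hUL : UL ∈ G1 g)
    (hO : StationaryContact g UL O) (hOa : O.a = R.a) (hS : StationaryContact g (hash g UL) S)
    (hSa : S.a = R.a) (h : IsResonant g UL R F) :
    ∃ V W, 0 < V.h ∧ disc V = disc UL ∧ V.h ≤ hcrit g (disc UL) ∧ V.a + head g V = UL.a + head g UL
      ∧ 0 < W.h ∧ disc W = disc UL ∧
      W.a = R.a ∧ W.a + head g W = UL.a + head g UL - jumpLoss g (disc UL) V.h ∧
      (UL.a < R.a → S.h < W.h ∧ W.h < (hash g O).h) ∧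
      (R.a < UL.a → (hash g O).h < W.h ∧ W.h < S.h) ∧ phi2 g W R = 0 ∧
      F = (contact, V) :: (shock1, hash g V) :: (contact, W) :: wave2Fan W R := by
  obtain ⟨V, W, F', hV, hV1, hne, hne', hab, hW, hWa, rfl, hF⟩ := h
  obtain ⟨h0, hu, hs⟩ := (mem_G1_iff hg).1 hUL
  have hq : disc UL ≠ 0 := (mul_pos h0 hu).ne'
  have hcL := (lt_hcrit_disc_iff hg h0).2 hs
  obtain ⟨a1, a2, a3, a4, a5, a6⟩ := contact_supercritical_facts hg hUL hO
  obtain ⟨v1, v2, v3, v4, v5, v6⟩ := contact_supercritical_facts hg hUL hV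
  obtain ⟨b1, b2, b3, b4⟩ := contact_hash_facts hg hUL hS
  obtain ⟨w1, w2, w3, w4⟩ := contact_hash_facts hg ⟨v1, hV1⟩ hW
  obtain ⟨e1, e2, e3, -⟩ := hash_facts hg a1 a2 a3
  have hH0 : 0 < (hash g O).h := a1.trans_le e2
  have hOd := disc_hash hg a1 (by rw [a4]; exact hq)
  have hOh := head_hash hg a1 (by rw [a4]; exact hq)
  rw [a4] at e1 e3 hOd hOh
  rw [v4] at w2 w3 w4
  have k1 := head_eq_specHead (g := g) h0
  have k2 := head_eq_specHead (g := g) a1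
  have k3 := head_eq_specHead (g := g) b1
  have k4 := head_eq_specHead (g := g) hH0
  have k5 := head_eq_specHead (g := g) v1
  have k6 := head_eq_specHead (g := g) w1
  rw [a4] at k2
  rw [b2] at k3
  rw [hOd] at k4
  rw [v4] at k5
  rw [w2] at k6
  have up : UL.a < R.a → S.h < W.h ∧ W.h < (hash g O).h := by
    intro h
    -- The bound on the variation, together with the two contacts being nontrivial, puts the middle
    -- level strictly between the outer ones.
    have i1 : UL.a < V.a ∧ V.a < R.a := by
      rcases lt_or_gt_of_ne hne with h1 | h1 <;> rcases lt_or_gt_of_ne hne' with h2 | h2 <;>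
      rcases abs_cases (V.a - UL.a) with ⟨c1, c2⟩ | ⟨c1, c2⟩ <;>
      rcases abs_cases (V.a - R.a) with ⟨c3, c4⟩ | ⟨c3, c4⟩ <;>
      rcases abs_cases (UL.a - R.a) with ⟨c5, c6⟩ | ⟨c5, c6⟩ <;> constructor <;> linarith
    have l1 : UL.h < V.h := lt_of_specHead_lt_super (q := disc UL) hg v1 hcL.le (by linarith)
    have l2 : V.h < O.h := lt_of_specHead_lt_super (q := disc UL) hg a1 v5 (by linarith)
    have m1 := jumpLoss_strictAnti hg hq h0 l1 v5
    have m2 := jumpLoss_strictAnti hg hq v1 l2 a5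
    exact ⟨lt_of_specHead_lt_sub (q := disc UL) hg w1 w3 (by linarith),
      lt_of_specHead_lt_sub (q := disc UL) hg hH0 e3 (by linarith)⟩
  have down : R.a < UL.a → (hash g O).h < W.h ∧ W.h < S.h := by
    intro h
    have i1 : V.a < UL.a ∧ R.a < V.a := by
      rcases lt_or_gt_of_ne hne with h1 | h1 <;> rcases lt_or_gt_of_ne hne' with h2 | h2 <;>
      rcases abs_cases (V.a - UL.a) with ⟨c1, c2⟩ | ⟨c1, c2⟩ <;>
      rcases abs_cases (V.a - R.a) with ⟨c3, c4⟩ | ⟨c3, c4⟩ <;>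
      rcases abs_cases (UL.a - R.a) with ⟨c5, c6⟩ | ⟨c5, c6⟩ <;> constructor <;> linarith
    have l1 : V.h < UL.h := lt_of_specHead_lt_super (q := disc UL) hg h0 v5 (by linarith)
    have l2 : O.h < V.h := lt_of_specHead_lt_super (q := disc UL) hg v1 a5 (by linarith)
    have m1 := jumpLoss_strictAnti hg hq v1 l1 hcL.le
    have m2 := jumpLoss_strictAnti hg hq a1 l2 v5
    exact ⟨lt_of_specHead_lt_sub (q := disc UL) hg w1 w3 (by linarith),
      lt_of_specHead_lt_sub (q := disc UL) hg b1 b3 (by linarith)⟩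
  have hneLR : UL.a ≠ R.a := by
    intro h
    rw [h, sub_self, abs_zero] at hab
    have := abs_nonneg (V.a - R.a)
    exact hne' (sub_eq_zero.1 (abs_eq_zero.1 (by linarith)))
  -- Both reference states are at least critical in depth, so `W` is strictly subcritical and the
  -- alternative `λ₁(W) = 0` is void.
  have hWc : hcrit g (disc UL) < W.h := by
    rcases lt_or_gt_of_ne hneLR with h | h
    · exact b3.trans_lt (up h).1
    · exact e3.trans_lt (down h).1
  rcases hF with ⟨hp, rfl⟩ | ⟨hl, -⟩
  · exact ⟨V, W, v1, v4, v5, v6, w1, w2, hWa, by linarith, up, down, hp, rfl⟩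
  · exfalso
    have := ((lambda1_nonneg_iff (mul_pos hg w1).le).1 hl.ge).2
    have := (le_hcrit_disc_iff hg w1).2 this
    rw [w2] at this
    linarith

theorem resonant_unique (hg : 0 < g) (hUL : UL ∈ G1 g) (hR : 0 < R.h)
    (hO : StationaryContact g UL O) (hOa : O.a = R.a) (hS : StationaryContact g (hash g UL) S)
    (hSa : S.a = R.a) (h : IsResonant g UL R F) (h' : IsResonant g UL R F') : F = F' := by
  obtain ⟨V, W, v1, v2, v3, v4, w1, w2, w3, w4, -, -, hp, rfl⟩ :=
    resonant_between hg hUL hO hOa hS hSa h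
  obtain ⟨V', W', v1', v2', v3', v4', w1', w2', w3', w4', -, -, hp', rfl⟩ :=
    resonant_between hg hUL hO hOa hS hSa h'
  have hq : 0 < disc UL := (isLeftShock_hash hg hUL).2.2.2
  have hWW : W = W' := by
    refine eq_of_phi2 hp hp' ?_ (w3.trans w3'.symm)
    rcases lt_trichotomy W.h W'.h with h | h | h
    · linarith [phi2_lt_of_disc hg hR w1 h (w2.trans w2'.symm) (by rwa [w2])]
    · exact h
    · linarith [phi2_lt_of_disc hg hR w1' h (w2'.trans w2.symm) (by rwa [w2'])]
  subst hWW
  have hVV : V = V' := by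
    have hh : V.h = V'.h := by
      rcases lt_trichotomy V.h V'.h with h | h | h
      · linarith [jumpLoss_strictAnti hg hq.ne' v1 h v3']
      · exact h
      · linarith [jumpLoss_strictAnti hg hq.ne' v1' h v3]
    refine state_ext_disc v1 hh (v2.trans v2'.symm) ?_
    have e : head g V = head g V' := by
      rw [head_eq_specHead v1, head_eq_specHead v1', hh, v2, v2']
    linarith
  rw [hVV]

/-- A subcritical state on the backward 2-wave curve with smaller discharge and larger head than
`S` forces `S` to lie above or on that curve. -/
theorem phi2_nonneg_of_state (hg : 0 < g) (hR : 0 < R.h) (hR2 : 0 < lambda2 g R) {V : State}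
    (hV : 0 < V.h) (hVs : V.u ^ 2 ≤ g * V.h) (hp : phi2 g V R = 0)
    (hS : 0 < S.h) (hSq : 0 < disc S)
    (hd : disc V ≤ disc S) (hh : head g S ≤ head g V) : 0 ≤ phi2 g S R := by
  by_contra! hn
  have hSu : 0 < S.u := pos_of_mul_pos_right hSq hS.le
  have hVc := (hcrit_disc_le_iff hg hV).2 hVs
  rw [head_eq_specHead hS, head_eq_specHead hV] at hh
  -- For nonnegative velocity the smaller discharge and larger head make `V` deeper and slower than
  -- `S`. For negative velocity the state of the curve at rest has to be inserted.
  rcases le_or_gt 0 V.u with hVu | hVu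
  · have hd2 : disc V ^ 2 ≤ disc S ^ 2 := pow_le_pow_left₀ (mul_nonneg hV.le hVu) hd 2
    have hle : S.h ≤ V.h := by
      by_contra! hlt
      have h1 := specHead_lt_of_hcrit_le hg hV hVc hlt
      have h2 := specHead_mono_disc (x := S.h) hg hd2
      linarith
    have hu : V.u ≤ S.u := by
      by_contra! hlt
      have := mul_lt_mul' hle hlt hSu.le hV
      exact absurd hd (not_le.2 this)
    have := velJump_mono hg hR hS.le hle
    rw [phi2_eq] at hp hn
    linarith
  · have hVl : 0 ≤ lambda2 g V := ((mem_closedG2_iff hg).2 ⟨hV, hVs⟩).2.2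
    rw [phi2_eq] at hp hn
    have hlt : V.h < S.h := by
      by_contra! hle
      have := velJump_mono hg hR hS.le hle
      linarith
    -- At the state at rest the head is its depth `z ≤ S.h`, and the head rises along the curve from
    -- `V` to it; so the head of `V` would be less than that of `S`.
    obtain ⟨z, hz, hz0⟩ := exists_root (f := fun z => -R.u - velJump g R.h z) hlt.le
      (continuous_const.sub (continuous_velJump hR)).continuousOn (by linarith) (by linarith)
    have hzV : V.h < z := by
      rcases hz.1.eq_or_lt with h | h
      · rw [← h] at hz0; linarith
      · exact h
    have hm := (right_mono (V' := ⟨z, 0, V.a⟩) hg hR hR2 hV.le (by rw [phi2_eq]; exact hp)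
      (by rw [phi2_eq]; simp only; linarith) hVl hzV).2
    rw [head_eq_specHead hV] at hm
    have e1 : head g ⟨z, 0, V.a⟩ = z := by simp [head, colHead]
    have e2 : S.h < specHead g (disc S) S.h := by
      rw [← head_eq_specHead hS]
      unfold head colHead
      have : 0 < S.u ^ 2 / (2 * g) := by positivity
      linarith
    linarith [hz.2]

/-- In each form the state behind the last contact has at most the discharge of `U_L^{#o}` and at
least its head, so `phi2_nonneg_of_state` applies. -/
theorem lower_sign (hg : 0 < g) (hUL : UL ∈ G1 g) (hR : 0 < R.h) (hR2 : 0 < lambda2 g R)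
    (hS : StationaryContact g (hash g UL) S) (hSa : S.a = R.a) (h : IsLower g UL R F) :
    0 ≤ phi2 g S R := by
  obtain ⟨b1, b2, b3, b4⟩ := contact_hash_facts hg hUL hS
  obtain ⟨i1, i2, i3, hq⟩ := isLeftShock_hash hg hUL
  have hHa := hash_a g UL
  obtain ⟨hSd, hSh⟩ := contact_disc_head hg hS
  have fin : ∀ V : State, 0 < V.h → V.u ^ 2 ≤ g * V.h → phi2 g V R = 0 → disc V ≤ disc UL →
      UL.a + head g (hash g UL) ≤ R.a + head g V → 0 ≤ phi2 g S R := by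
    intro V h1 h2 h3 h4 h5
    exact phi2_nonneg_of_state hg hR hR2 h1 h2 h3 b1 (by rwa [b2]) (by rwa [b2])
      (by linarith)
  rcases h with h | h | h | h
  · obtain ⟨U, V, hU, hU2, hc, ha, hs, hp, hl, -⟩ := h
    obtain ⟨f1, f2, f3, f4, f5, f6⟩ := hU.facts hg hUL
    obtain ⟨c1, c2⟩ := contact_disc_head hg hc
    exact fin V hc.2.1 hs hp (by linarith) (by linarith)
  · obtain ⟨U, Q, V, -, hU, hr, hQ, hc, ha, hs, hp, hl, -⟩ := h
    obtain ⟨f1, f2, f3, f4, f5, f6⟩ := hU.facts hg hUL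
    obtain ⟨c1, c2⟩ := contact_disc_head hg hc
    obtain ⟨d1, d2⟩ := rarContact_compare hg hUL i1 i2.le hU hr hQ
    have fa : Q.a = U.a := (links_wave2 (.inr rfl) hr).2.1
    exact fin V hc.2.1 hs hp (by linarith) (by linarith)
  · obtain ⟨U, Q, W, -, hW, hc, ha, hl, hp, -⟩ := h.data
    obtain ⟨c1, c2⟩ := contact_disc_head hg hc
    have f := (hW.1.facts hg hUL).2.2.1
    have fa := hW.2.2.2.1
    obtain ⟨k1, k2, k3, k4⟩ := critical_of_lambda2_zero hg hc.2.1 hl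
    have d := hW.head_lt hg hUL i1 i2.le (by linarith)
    exact fin W hc.2.1 (sq_eq_of_lambda2_zero (mul_pos hg hc.2.1).le hl).le hp (by linarith)
      (by linarith)
  · obtain ⟨U, Z, W, hZa, -, hU, hU2, hc, hZ0, hZ2, hcW, ha, hl, hp, -⟩ := h
    obtain ⟨f1, f2, f3, f4, f5, f6⟩ := hU.facts hg hUL
    obtain ⟨e1, e2, e3, e4, e5, e6⟩ := backResonant_head hg hc hZ0 hZ2 hcW
    exact fin W hcW.2.1 (sq_eq_of_lambda2_zero (mul_pos hg hcW.2.1).le hl).le hp (by linarith)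
      (by linarith)

/-- The critical state `V` has the least head for its discharge, which is at most that of `S`, while
its head is at least that of `S`. All inequalities become equalities and `V = S`. -/
theorem shockCritical_sign (hg : 0 < g) (hUL : UL ∈ G1 g) (hR : 0 < R.h)
    (hS : StationaryContact g (hash g UL) S) (hSa : S.a = R.a) (h : IsShockCritical g UL R F) :
    S.u ^ 2 = g * S.h ∧ phi2 g S R ≤ 0 := by
  obtain ⟨U, V, F', hU, hc, ha, hl, hp, hf, -⟩ := h
  obtain ⟨b1, b2, b3, b4⟩ := contact_hash_facts hg hUL hS
  obtain ⟨i1, i2, i3, hq⟩ := isLeftShock_hash hg hUL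
  have hHa := hash_a g UL
  obtain ⟨f1, f2, f3, f4, f5, f6⟩ := hU.facts hg hUL
  obtain ⟨c1, c2⟩ := contact_disc_head hg hc
  obtain ⟨hSd, hSh⟩ := contact_disc_head hg hS
  have hV0 := hc.2.1
  have hVu : 0 < V.u := by linarith [lambda1_lt_u hg hV0]
  have hVs : V.u ^ 2 = g * V.h := by
    have := Real.sq_sqrt (mul_pos hg hV0).le
    unfold lambda1 at hl
    rw [← this, sub_eq_zero.1 hl]
  have hVq : 0 < disc V := mul_pos hV0 hVu
  have hVc : V.h = hcrit g (disc V) :=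
    le_antisymm ((le_hcrit_disc_iff hg hV0).2 hVs.ge) ((hcrit_disc_le_iff hg hV0).2 hVs.le)
  have hVh : head g V = 3 / 2 * V.h := by
    unfold head colHead; rw [hVs]; field_simp; ring
  have hd : disc V ≤ disc S := by linarith
  have hm := hcrit_mono (g := g) hg (pow_le_pow_left₀ hVq.le hd 2)
  have hS32 := specHead_ge (q := disc S) hg b1
  have hSs := head_eq_specHead (g := g) b1
  have hSc : S.h = hcrit g (disc S) := by
    by_contra hne
    have := specHead_gt hg b1 hne
    linarith
  have hcr : hcrit g (disc V) = hcrit g (disc S) := le_antisymm hm (by linarith)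
  have hVS : V = S := by
    refine State.ext (by rw [hVc, hSc, hcr]) ?_ (ha.trans hSa.symm)
    have hdd : disc V ^ 2 = disc S ^ 2 := by
      rw [← hcrit_cube' hg, ← hcrit_cube' hg (disc S), hcr]
    have hdd' : disc V = disc S := by
      have hSq : 0 < disc S := by linarith
      exact (pow_left_inj₀ hVq.le hSq.le (by norm_num)).1 hdd
    unfold disc at hdd'
    rw [show V.h = S.h by rw [hVc, hSc, hcr]] at hdd'
    exact mul_left_cancel₀ b1.ne' hdd'
  rw [← hVS]
  refine ⟨hVs, ?_⟩
  have := pureFan_sign hg hR hV0 hVu hl.ge hp hf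
  rwa [hash_of_critical hg hV0 hVq.ne' hVs] at this

end Signs

/-! ### Uniqueness -/

section Uniqueness

variable {g : ℝ} {UL R O S : State}

theorem pureFan_of_level_eq {F : Fan} (hg : 0 < g) (hUL : UL ∈ G1 g) (hR : 0 < R.h)
    (ha : UL.a = R.a) (hs : IsRiemannSolution g UL R F) : IsPureFan g UL R F := by
  have key : ∀ {U W : State} {F : Fan}, U.a = R.a →
      IsRiemannSolution g U R ((contact, W) :: F) → False := by
    intro U W F hU h
    obtain ⟨hl, -, -, h⟩ := solution_cons.1 h
    rw [hU, sub_self, abs_zero] at h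
    have h1 := abs_nonneg (W.a - R.a)
    have : W.a - R.a = 0 := abs_eq_zero.1 (by linarith)
    exact hl.2 (by linarith)
  rcases start_classify hg hUL.1 hR hUL.2.le hs with h | ⟨W, F', rfl⟩ | ⟨U, W, F', rfl, -⟩ |
    ⟨k, U, Q, W, F', hk, rfl, -⟩
  · exact h
  · exact (key ha hs).elim
  · obtain ⟨hl, -, hs, -⟩ := solution_cons.1 hs
    exact (key (hl.2.2.1.trans ha) hs).elim
  · obtain ⟨hl, -, hs, -⟩ := solution_cons.1 hs
    obtain ⟨hl2, -, hs, -⟩ := solution_cons.1 hs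
    exact (key ((links_wave2 hk hl2).2.1.trans (hl.2.2.1.trans ha)) hs).elim

theorem solution_cases {F : Fan} (hg : 0 < g) (hUL : UL ∈ G1 g)
    (hR : 0 < R.h) (hR2 : 0 < lambda2 g R) (hne : UL.a ≠ R.a)
    (hS : StationaryContact g (hash g UL) S) (hSa : S.a = R.a)
    (hcr : S.u ^ 2 < g * S.h ∨ 0 < phi2 g S R) (hs : IsRiemannSolution g UL R F) :
    IsContactPure g UL R F ∨ IsResonant g UL R F ∨ IsLower g UL R F := by
  rcases solution_classify hg hUL hR hR2 hne hs with h | h | h | h | h | h | h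
  · exact .inl h
  · exact .inr (.inl h)
  · exact .inr (.inr (.inl h))
  · obtain ⟨h1, h2⟩ := shockCritical_sign hg hUL hR hS hSa h
    rcases hcr with h3 | h3 <;> linarith
  · exact .inr (.inr (.inr (.inl h)))
  · exact .inr (.inr (.inr (.inr (.inl h))))
  · exact .inr (.inr (.inr (.inr (.inr h))))

/-- Either the levels agree and the fan contains no contact, or the bottom falls and the sign
conditions of the three forms exclude each other. -/
theorem solution_unique_of_le {F F' : Fan} (hg : 0 < g) (hUL : UL ∈ G1 g)
    (hR : 0 < R.h) (hR2 : 0 < lambda2 g R)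
    (hO : StationaryContact g UL O) (hOa : O.a = R.a) (hS : StationaryContact g (hash g UL) S)
    (hSa : S.a = R.a) (hle : (hash g O).h ≤ S.h) (hF : IsRiemannSolution g UL R F)
    (hF' : IsRiemannSolution g UL R F') : F = F' := by
  obtain ⟨o1, o2, o3⟩ := hash_contact_order (R := R) hg hUL hO hOa hS hSa
  rcases lt_trichotomy UL.a R.a with h | h | h
  · exact absurd hle (o1 h).not_ge
  · exact (pureFan_of_level_eq hg hUL hR h hF).unique hg hUL.1 hR
      (pureFan_of_level_eq hg hUL hR h hF')
  · have hlt := o2 h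
    obtain ⟨a1, a2, a3, a4, a5, a6⟩ := contact_supercritical_facts hg hUL hO
    obtain ⟨e1, e2, e3, -⟩ := hash_facts hg a1 a2 a3
    obtain ⟨b1, b2, b3, b4⟩ := contact_hash_facts hg hUL hS
    have hq : 0 < disc UL := (isLeftShock_hash hg hUL).2.2.2
    have hOd := disc_hash hg a1 (by rw [a4]; exact hq.ne')
    rw [a4] at e3 hOd
    have hSs : S.u ^ 2 < g * S.h :=
      (hcrit_disc_lt_iff hg b1).1 (by rw [b2]; exact e3.trans_lt hlt)
    have hphi := phi2_lt_of_disc hg hR (a1.trans_le e2) hlt (hOd.trans b2.symm) (by rwa [hOd])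
    have res : ∀ {F}, IsResonant g UL R F →
        0 < phi2 g (hash g O) R ∧ phi2 g S R < 0 := by
      intro F hF
      obtain ⟨V, W, v1, v2, v3, v4, w1, w2, w3, w4, -, hW, hp, -⟩ :=
        resonant_between hg hUL hO hOa hS hSa hF
      obtain ⟨h1, h2⟩ := hW h
      have := phi2_lt_of_disc hg hR (a1.trans_le e2) h1 (hOd.trans w2.symm) (by rwa [hOd])
      have := phi2_lt_of_disc hg hR w1 h2 (w2.trans b2.symm) (by rwa [w2])
      constructor <;> linarith
    rcases solution_cases hg hUL hR hR2 h.ne' hS hSa (.inl hSs) hF with h1 | h1 | h1 <;>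
    rcases solution_cases hg hUL hR hR2 h.ne' hS hSa (.inl hSs) hF' with h2 | h2 | h2
    · exact contactPure_unique hg hUL hR hO hOa h1 h2
    · linarith [(contactPure_sign hg hUL hR hO hOa h1).1, (res h2).1]
    · linarith [(contactPure_sign hg hUL hR hO hOa h1).1, lower_sign hg hUL hR hR2 hS hSa h2]
    · linarith [(contactPure_sign hg hUL hR hO hOa h2).1, (res h1).1]
    · exact resonant_unique hg hUL hR hO hOa hS hSa h1 h2
    · linarith [(res h1).2, lower_sign hg hUL hR hR2 hS hSa h2]
    · linarith [(contactPure_sign hg hUL hR hO hOa h2).1, lower_sign hg hUL hR hR2 hS hSa h1]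
    · linarith [(res h2).2, lower_sign hg hUL hR hR2 hS hSa h1]
    · exact lower_unique hg hUL hR hR2 h1 h2

/-- The level at the right lies above the level at the left as soon as
`h_L^{#o} < h_L^{o#}`. -/
theorem level_lt_of_lt (hg : 0 < g) (hUL : UL ∈ G1 g) (hO : StationaryContact g UL O)
    (hOa : O.a = R.a) (hS : StationaryContact g (hash g UL) S) (hSa : S.a = R.a)
    (hlt : S.h < (hash g O).h) : UL.a < R.a := by
  obtain ⟨o1, o2, o3⟩ := hash_contact_order (R := R) hg hUL hO hOa hS hSa
  rcases lt_trichotomy UL.a R.a with h | h | h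
  · exact h
  · exfalso
    have hOL := o3 h
    subst hOL
    have hc := hash_a g O
    obtain ⟨c1, c2⟩ := contact_disc_head hg hS
    obtain ⟨h0, hu, hs⟩ := (mem_G1_iff hg).1 hUL
    obtain ⟨j1, j2, j3⟩ := lt_hash_h hg h0 hs
    obtain ⟨b1, b2, b3, b4⟩ := contact_hash_facts hg hUL hS
    have hH0 := h0.trans j1
    have hd := disc_hash hg h0 j3
    have := subcritical_depth_unique (q := disc O) hg b1 hH0 b3 j2.le (by
      rw [← b2, ← head_eq_specHead b1, ← c1, ← head_eq_specHead hH0]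
      linarith)
    linarith
  · exact absurd (o2 h) (not_lt.2 hlt.le)

theorem resonant_signs {F : Fan} (hg : 0 < g) (hUL : UL ∈ G1 g) (hR : 0 < R.h)
    (hO : StationaryContact g UL O) (hOa : O.a = R.a) (hS : StationaryContact g (hash g UL) S)
    (hSa : S.a = R.a) (h : UL.a < R.a) (hF : IsResonant g UL R F) :
    phi2 g (hash g O) R < 0 ∧ 0 < phi2 g S R := by
  obtain ⟨V, W, v1, v2, v3, v4, w1, w2, w3, w4, hW, -, hp, -⟩ :=
    resonant_between hg hUL hO hOa hS hSa hF
  obtain ⟨h1, h2⟩ := hW h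
  obtain ⟨b1, b2, b3, b4⟩ := contact_hash_facts hg hUL hS
  obtain ⟨a1, a2, a3, a4, a5, a6⟩ := contact_supercritical_facts hg hUL hO
  have hq : 0 < disc UL := (isLeftShock_hash hg hUL).2.2.2
  have hOd := disc_hash hg a1 (by rw [a4]; exact hq.ne')
  rw [a4] at hOd
  have := phi2_lt_of_disc hg hR b1 h1 (b2.trans w2.symm) (by rwa [b2])
  have := phi2_lt_of_disc hg hR w1 h2 (w2.trans hOd.symm) (by rwa [w2])
  constructor <;> linarith

theorem solution_unique_of_same_side {F F' : Fan} (hg : 0 < g) (hUL : UL ∈ G1 g)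
    (hR : 0 < R.h) (hR2 : 0 < lambda2 g R)
    (hO : StationaryContact g UL O) (hOa : O.a = R.a) (hS : StationaryContact g (hash g UL) S)
    (hSa : S.a = R.a) (hlt : S.h < (hash g O).h) (hSG : S ∈ G2 g)
    (hside : 0 < phi2 g S R * phi2 g (hash g O) R) (hF : IsRiemannSolution g UL R F)
    (hF' : IsRiemannSolution g UL R F') : F = F' := by
  have h := level_lt_of_lt hg hUL hO hOa hS hSa hlt
  have hSs := (mem_G2_iff.1 hSG).2
  have hnr : ∀ {F}, IsResonant g UL R F → False := by
    intro F hF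
    obtain ⟨h1, h2⟩ := resonant_signs hg hUL hR hO hOa hS hSa h hF
    linarith [mul_neg_of_pos_of_neg h2 h1]
  have hpl : ∀ {F F'}, IsContactPure g UL R F → IsLower g UL R F' → False := by
    intro F F' hF hF'
    have h1 := (contactPure_sign hg hUL hR hO hOa hF).1
    have h2 := lower_sign hg hUL hR hR2 hS hSa hF'
    linarith [mul_nonpos_of_nonneg_of_nonpos h2 h1]
  rcases solution_cases hg hUL hR hR2 h.ne hS hSa (.inl hSs) hF with h1 | h1 | h1 <;>
  rcases solution_cases hg hUL hR hR2 h.ne hS hSa (.inl hSs) hF' with h2 | h2 | h2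
  · exact contactPure_unique hg hUL hR hO hOa h1 h2
  · exact (hnr h2).elim
  · exact (hpl h1 h2).elim
  · exact (hnr h1).elim
  · exact (hnr h1).elim
  · exact (hnr h1).elim
  · exact (hpl h2 h1).elim
  · exact (hnr h2).elim
  · exact lower_unique hg hUL hR hR2 h1 h2

end Uniqueness

/-! ### Building solutions -/

section Building

variable {g : ℝ} {R : State}

theorem solution_cons_wave {k : WaveKind} {U W : State} {F : Fan} (hl : Links g k U W)
    (ha : W.a = U.a) (hf : Follows g k U W F) (hs : IsRiemannSolution g W R F) :
    IsRiemannSolution g U R ((k, W) :: F) :=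
  solution_cons.2 ⟨hl, hf, hs, by rw [ha]; simp⟩

theorem solution_cons_contact {U W : State} {F : Fan} (hl : StationaryContact g U W)
    (hne : U.a ≠ W.a) (hf : Follows g contact U W F) (hs : IsRiemannSolution g W R F)
    (ha : |W.a - U.a| + |W.a - R.a| ≤ |U.a - R.a|) :
    IsRiemannSolution g U R ((contact, W) :: F) :=
  solution_cons.2 ⟨⟨hl, hne⟩, hf, hs, ha⟩

theorem solution_cons_contact' {U W : State} {F : Fan} (hl : StationaryContact g U W)
    (hne : U.a ≠ R.a) (hW : W.a = R.a) (hf : Follows g contact U W F)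
    (hs : IsRiemannSolution g W R F) : IsRiemannSolution g U R ((contact, W) :: F) :=
  solution_cons_contact hl (hW ▸ hne) hf hs (by rw [hW, abs_sub_comm]; simp)

theorem solution_wave2Fan {M : State} (hM : 0 ≤ M.h) (hR : 0 < R.h) (hp : phi2 g M R = 0)
    (ha : M.a = R.a) : IsRiemannSolution g M R (wave2Fan M R) := by
  rcases lt_trichotomy M.h R.h with h | h | h
  · rw [wave2Fan_rar h]
    exact solution_cons_wave (links_rar2_of_phi2 hM h hp ha.symm) ha.symm trivial
      (solution_nil.2 rfl)
  · have : M = R := by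
      rw [phi2_eq, h, velJump_self] at hp
      exact State.ext h (by linarith) ha
    rw [this, wave2Fan_self]
    exact solution_nil.2 rfl
  · rw [wave2Fan_shock h]
    exact solution_cons_wave (links_shock2_of_phi2 hR h hp ha.symm) ha.symm trivial
      (solution_nil.2 rfl)

theorem follows_wave2Fan {k : WaveKind} {U M : State} (hg : 0 < g) (hR : 0 < R.h)
    (hk : k ≠ shock2) (hk' : k ≠ rar2) (hp : phi2 g M R = 0)
    (ha : M.a = R.a) (hs : rightSpeed g k U M ≤ M.u) : Follows g k U M (wave2Fan M R) := by
  rcases lt_trichotomy M.h R.h with h | h | h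
  · rw [wave2Fan_rar h]
    refine ⟨hk', hs.trans ?_⟩
    have := Real.sqrt_nonneg (g * M.h)
    simp only [leftSpeed, lambda2]; linarith
  · unfold wave2Fan
    rw [if_neg h.not_lt, if_neg h.not_gt]; trivial
  · rw [wave2Fan_shock h]
    exact ⟨hk, hs.trans (shock2_lax hg (links_shock2_of_phi2 hR h hp ha.symm)).2.2.1.le⟩

theorem follows_contact_wave2Fan {U M : State} (h1 : M.h < R.h → 0 ≤ lambda2 g M)
    (h2 : R.h < M.h → 0 ≤ shockSpeed M R) : Follows g contact U M (wave2Fan M R) := by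
  rcases lt_trichotomy M.h R.h with h | h | h
  · rw [wave2Fan_rar h]
    exact ⟨by simp, h1 h⟩
  · unfold wave2Fan
    rw [if_neg h.not_lt, if_neg h.not_gt]; trivial
  · rw [wave2Fan_shock h]
    exact ⟨by simp, h2 h⟩

theorem shockSpeed_nonneg_of_lambda2 {M : State} (hg : 0 < g) (hR : 0 < R.h)
    (hR2 : 0 < lambda2 g R) (hp : phi2 g M R = 0) (ha : M.a = R.a) (h : R.h < M.h) :
    0 ≤ shockSpeed M R := by
  linarith [(shock2_lax hg (links_shock2_of_phi2 hR h hp ha.symm)).1]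

theorem solution_of_pureFan {V : State} {F : Fan} (hg : 0 < g) (hV : 0 < V.h) (hR : 0 < R.h)
    (h : IsPureFan g V R F) : IsRiemannSolution g V R F := by
  obtain ⟨ha, ⟨x, hx, hp, rfl⟩ | ⟨hp, rfl⟩⟩ := h
  · have s := solution_wave2Fan (M := wave1State g V x) hx hR hp ha
    rcases lt_trichotomy x V.h with h | h | h
    · have hl := links_rar1_wave1State (g := g) hx h
      rw [wave1Fan_rar (show (wave1State g V x).h < V.h from h)]
      refine solution_cons_wave hl rfl (follows_wave2Fan hg hR (by simp) (by simp) hp ha ?_) s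
      have := Real.sqrt_nonneg (g * (wave1State g V x).h)
      simp only [rightSpeed, lambda1]; linarith
    · have e : wave1State g V x = V := by
        rw [h]; simp only [wave1State, velJump_self, sub_zero]
      rw [e] at s ⊢
      rw [wave1Fan_self]; exact s
    · have hl := links_shock1_wave1State (g := g) hV h
      rw [wave1Fan_shock (show V.h < (wave1State g V x).h from h)]
      exact solution_cons_wave hl rfl (follows_wave2Fan hg hR (by simp) (by simp) hp ha
        (shock1_lax hg hl).2.2.le) s
  · have hdl : Links g dry (wave1State g V 0) (dryState g R) := by
      refine ⟨rfl, rfl, ha.symm, ?_⟩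
      rw [phi2_eq] at hp
      simp only [dryState]
      simp only [wave1State] at *
      linarith
    refine solution_cons_wave (links_rar1_wave1State le_rfl hV) rfl ⟨by simp, ?_⟩
      (solution_cons_wave hdl ha.symm ⟨by simp, ?_⟩
        (solution_cons_wave (links_rar2_of_phi2 le_rfl hR (phi2_dryState g R) rfl) rfl trivial
          (solution_nil.2 rfl)))
    · simp [rightSpeed, leftSpeed, lambda1, wave1State]
    · simp [rightSpeed, leftSpeed, lambda2, dryState]

theorem exists_velJump_gt {V : State} (hg : 0 < g) (hV : 0 < V.h) (b c : ℝ) :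
    ∃ x, b ≤ x ∧ V.h ≤ x ∧ (wave1State g V x).u < c := by
  have hd : ∃ s, max (√(g * V.h)) (√(g * |b|)) ≤ s ∧ V.u + 2 * √(g * V.h) - 2 * s < c ∧ 0 ≤ s := by
    -- `s` plays the role of `√(g x)`: along the 1-wave curve the velocity is at most `V.u + 2√(g
    -- V.h) - 2 s`.
    refine ⟨max (max (√(g * V.h)) (√(g * |b|))) (V.u / 2 + √(g * V.h) - c / 2 + 1),
      le_max_left _ _, ?_, ?_⟩
    · have := le_max_right (max (√(g * V.h)) (√(g * |b|))) (V.u / 2 + √(g * V.h) - c / 2 + 1)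
      linarith
    · exact (Real.sqrt_nonneg _).trans ((le_max_left _ _).trans (le_max_left _ _))
  obtain ⟨s, hs1, hs2, hs0⟩ := hd
  have hx : g * (s ^ 2 / g) = s ^ 2 := by field_simp
  have hsx : √(g * (s ^ 2 / g)) = s := by rw [hx]; exact Real.sqrt_sq hs0
  have hle : ∀ y, 0 ≤ y → √(g * y) ≤ s → y ≤ s ^ 2 / g := by
    intro y hy h
    rw [le_div_iff₀ hg]
    have := pow_le_pow_left₀ (Real.sqrt_nonneg _) h 2
    rw [sqrt_mul_sq hg hy] at this
    linarith
  have hVx := hle _ hV.le ((le_max_left _ _).trans hs1)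
  refine ⟨s ^ 2 / g, (le_abs_self b).trans (hle _ (abs_nonneg b) ((le_max_right _ _).trans hs1)),
    hVx, ?_⟩
  have := rarJump_le_velJump_sub hg hV hVx
  rw [rarJump_eq hg, hsx, velJump_self] at this
  simp only [wave1State]
  linarith

/-- The bound `x ≤ b` on the depth behind a 1-shock is recorded because it controls the shock speed
when the fan follows a contact. -/
theorem exists_pureFan_of_nonpos {V : State} {b : ℝ} (hV : 0 < V.h)
    (hR : 0 < R.h) (ha : V.a = R.a) (hb : 0 ≤ b) (hp : phi2 g (wave1State g V b) R ≤ 0) :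
    ∃ F, IsPureFan g V R F ∧ ∀ W F', F = (shock1, W) :: F' → ∃ x ≤ b, W = wave1State g V x := by
  rcases le_or_gt 0 (phi2 g (wave1State g V 0) R) with h | h
  · have hc : Continuous fun x => phi2 g (wave1State g V x) R := by
      simp only [phi2_eq]
      exact ((continuous_wave1State hV).sub continuous_const).sub (continuous_velJump hR)
    obtain ⟨x, hx, hx0⟩ := exists_root hb hc.continuousOn h hp
    refine ⟨_, ⟨ha, .inl ⟨x, hx.1, hx0, rfl⟩⟩, ?_⟩
    intro W F' hF
    refine ⟨x, hx.2, ?_⟩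
    rcases lt_trichotomy x V.h with h | h | h
    · rw [wave1Fan_rar (show (wave1State g V x).h < V.h from h)] at hF
      simp at hF
    · have e : wave1State g V x = V := by
        rw [h]; simp only [wave1State, velJump_self, sub_zero]
      rw [e, wave1Fan_self] at hF
      unfold wave2Fan at hF
      split_ifs at hF <;> simp at hF
    · rw [wave1Fan_shock (show V.h < (wave1State g V x).h from h)] at hF
      simp at hF
      exact hF.1.symm
  · exact ⟨_, ⟨ha, .inr ⟨h, rfl⟩⟩, by simp⟩

theorem exists_pureFan {V : State} (hg : 0 < g) (hV : 0 < V.h) (hR : 0 < R.h) (ha : V.a = R.a) :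
    ∃ F, IsPureFan g V R F := by
  obtain ⟨x, hx, hVx, hu⟩ := exists_velJump_gt hg hV R.h R.u
  obtain ⟨F, hF, -⟩ := exists_pureFan_of_nonpos hV hR ha (hV.le.trans hVx) (by
    have := velJump_mono hg hR hR.le hx
    rw [velJump_self] at this
    rw [phi2_eq]
    have e : (wave1State g V x).h = x := rfl
    rw [e]; linarith)
  exact ⟨F, hF⟩

/-- Solvability behind a contact ending at a supercritical or critical state. -/
theorem exists_pureFan_follows {U V : State} (hg : 0 < g) (hV : 0 < V.h) (hR : 0 < R.h)
    (hu : 0 < V.u) (hl : 0 ≤ lambda1 g V) (ha : V.a = R.a) (hp : phi2 g (hash g V) R ≤ 0) :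
    ∃ F, IsPureFan g V R F ∧ Follows g contact U V F := by
  obtain ⟨e1, e2, e3, e4, e5⟩ := hash_facts hg hV hu hl
  rw [e4] at hp
  obtain ⟨F, hF, hF'⟩ := exists_pureFan_of_nonpos hV hR ha (hV.le.trans e2) hp
  refine ⟨F, hF, ?_⟩
  have hs := solution_of_pureFan hg hV hR hF
  cases F with
  | nil => trivial
  | cons p F =>
    obtain ⟨k, W⟩ := p
    obtain ⟨hlk, -, -, -⟩ := solution_cons.1 hs
    cases k with
    | contact =>
      exfalso
      obtain ⟨-, ⟨x, hx, -, hF⟩ | ⟨-, hF⟩⟩ := hF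
      · unfold wave1Fan wave2Fan at hF
        split_ifs at hF <;> simp at hF
      · simp at hF
    | shock1 =>
      obtain ⟨x, hx, rfl⟩ := hF' W F rfl
      refine ⟨by simp, ?_⟩
      change 0 ≤ shockSpeed _ _
      have h1 : V.h < x := hlk.2.1
      have := (mul_kap_le_iff hg hV (hV.trans h1) (hV.trans_le e2)).2 hx
      rw [(shock1_speed hlk).1, sub_nonneg, ← e5]
      exact this
    | rar1 => exact ⟨by simp, hl⟩
    | shock2 =>
      refine ⟨by simp, ?_⟩
      change 0 ≤ shockSpeed _ _
      linarith [(shock2_lax hg hlk).2.2.1]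
    | rar2 =>
      refine ⟨by simp, ?_⟩
      change 0 ≤ lambda2 g V
      linarith [u_lt_lambda2 hg hV]
    | dry => exact absurd hlk.1 hV.ne'

theorem wave1Fan_kinds (U M : State) : AtMostOneOf shock1 rar1 ((wave1Fan U M).map Prod.fst) := by
  unfold wave1Fan AtMostOneOf
  split_ifs <;> simp

theorem wave2Fan_kinds (U M : State) : AtMostOneOf shock2 rar2 ((wave2Fan U M).map Prod.fst) := by
  unfold wave2Fan AtMostOneOf
  split_ifs <;> simp

theorem isA1_of_pureFan {V : State} {F : Fan} (h : IsPureFan g V R F) : IsA1 ((contact, V) :: F) := by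
  obtain ⟨-, ⟨x, -, -, rfl⟩ | ⟨-, rfl⟩⟩ := h
  · exact .inl ⟨(wave1Fan V (wave1State g V x)).map Prod.fst,
      (wave2Fan (wave1State g V x) R).map Prod.fst, wave1Fan_kinds _ _, wave2Fan_kinds _ _, by simp⟩
  · exact .inr (by simp)

/-- The solution that begins with a contact and contains no other contact. -/
theorem exists_contactPure {UL O : State} (hg : 0 < g) (hUL : UL ∈ G1 g) (hR : 0 < R.h)
    (hne : UL.a ≠ R.a) (hO : StationaryContact g UL O) (hOa : O.a = R.a)
    (hp : phi2 g (hash g O) R ≤ 0) :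
    ∃ F, IsRiemannSolution g UL R F ∧ IsContactPure g UL R F ∧ IsA1 F := by
  obtain ⟨a1, a2, a3, a4, a5, a6⟩ := contact_supercritical_facts hg hUL hO
  obtain ⟨F, hF, hf⟩ := exists_pureFan_follows (U := UL) hg a1 hR a2 a3 hOa hp
  exact ⟨_, solution_cons_contact' hO hne hOa hf (solution_of_pureFan hg a1 hR hF),
    ⟨O, F, hO, hOa, rfl, hF, hf⟩, isA1_of_pureFan hF⟩

theorem exists_strict_between {f : ℝ → ℝ} {a b y : ℝ} (hf : ContinuousOn f (uIcc a b))
    (h : (f a < y ∧ y < f b) ∨ (f b < y ∧ y < f a)) :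
    ∃ x, f x = y ∧ ((a < x ∧ x < b) ∨ (b < x ∧ x < a)) := by
  have hy : y ∈ uIcc (f a) (f b) := by
    rcases h with h | h
    · exact mem_uIcc.2 (.inl ⟨h.1.le, h.2.le⟩)
    · exact mem_uIcc.2 (.inr ⟨h.1.le, h.2.le⟩)
  obtain ⟨x, hx, hxy⟩ := intermediate_value_uIcc hf hy
  refine ⟨x, hxy, ?_⟩
  have hxa : x ≠ a := by rintro rfl; rcases h with h | h <;> linarith
  have hxb : x ≠ b := by rintro rfl; rcases h with h | h <;> linarith
  rcases mem_uIcc.1 hx with ⟨h1, h2⟩ | ⟨h1, h2⟩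
  · exact .inl ⟨lt_of_le_of_ne h1 hxa.symm, lt_of_le_of_ne h2 hxb⟩
  · exact .inr ⟨lt_of_le_of_ne h1 hxb.symm, lt_of_le_of_ne h2 hxa⟩

/-- The solution with two contacts separated by a stationary 1-shock. -/
theorem exists_resonant {UL O S : State} (hg : 0 < g) (hUL : UL ∈ G1 g) (hR : 0 < R.h)
    (hO : StationaryContact g UL O) (hOa : O.a = R.a)
    (hS : StationaryContact g (hash g UL) S) (hSa : S.a = R.a)
    (hp : (phi2 g S R < 0 ∧ 0 < phi2 g (hash g O) R) ∨
      (phi2 g (hash g O) R < 0 ∧ 0 < phi2 g S R)) :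
    ∃ F, IsRiemannSolution g UL R F ∧ IsResonant g UL R F ∧ IsA2 F := by
  obtain ⟨h0, hu, hs⟩ := (mem_G1_iff hg).1 hUL
  have hq : 0 < disc UL := mul_pos h0 hu
  have hcL := (lt_hcrit_disc_iff hg h0).2 hs
  obtain ⟨a1, a2, a3, a4, a5, a6⟩ := contact_supercritical_facts hg hUL hO
  obtain ⟨b1, b2, b3, b4⟩ := contact_hash_facts hg hUL hS
  obtain ⟨e1, e2, e3, -⟩ := hash_facts hg a1 a2 a3
  have hH0 : 0 < (hash g O).h := a1.trans_le e2
  have hOd := disc_hash hg a1 (by rw [a4]; exact hq.ne')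
  have hOh := head_hash hg a1 (by rw [a4]; exact hq.ne')
  rw [a4] at e1 e3 hOd hOh
  have k1 := head_eq_specHead (g := g) h0
  have k2 := head_eq_specHead (g := g) a1
  have k3 := head_eq_specHead (g := g) b1
  have k4 := head_eq_specHead (g := g) hH0
  rw [a4] at k2
  rw [b2] at k3
  rw [hOd] at k4
  set q := disc UL with hqdef
  have hu2 : ∀ V : State, 0 < V.h → disc V = q → V.u = q / V.h := by
    intro V hV h
    rw [← h]; unfold disc; field_simp
  -- the state behind the second contact
  have hcont : ContinuousOn (fun w => q / w - R.u - velJump g R.h w)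
      (uIcc S.h (hash g O).h) := by
    refine ((continuousOn_const.div continuousOn_id ?_).sub continuousOn_const).sub
      (continuous_velJump hR).continuousOn
    intro w hw
    exact ((lt_min b1 hH0).trans_le hw.1).ne'
  obtain ⟨w, hw, hwb⟩ := exists_strict_between (y := 0) hcont (by
    simp only [phi2_eq] at hp
    rw [hu2 S b1 b2, hu2 _ hH0 hOd] at hp
    exact hp)
  have hw0 : 0 < w := by rcases hwb with h | h <;> linarith
  have hwc : hcrit g q < w := by rcases hwb with h | h <;> linarith
  -- the state in front of the shock
  have hcont2 : ContinuousOn (jumpLoss g q) (uIcc UL.h O.h) :=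
    (continuousOn_jumpLoss hg hq.ne').mono fun z hz => (lt_min h0 a1).trans_le hz.1
  -- Contacts conserve level plus head, so the jump has to lose the difference between the value at
  -- `U_L` and that at the already chosen state behind the second contact.
  obtain ⟨v, hv, hvb⟩ := exists_strict_between (y := UL.a + head g UL - R.a - specHead g q w)
    hcont2 (by
    rcases hwb with ⟨h1, h2⟩ | ⟨h1, h2⟩
    · have m1 := specHead_lt_of_hcrit_le hg b1 b3 h1
      have m2 := specHead_lt_of_hcrit_le hg hw0 hwc.le h2
      right; constructor <;> linarith
    · have m1 := specHead_lt_of_hcrit_le hg hH0 e3 h1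
      have m2 := specHead_lt_of_hcrit_le hg hw0 hwc.le h2
      left; constructor <;> linarith)
  have hv0 : 0 < v := by rcases hvb with h | h <;> linarith
  have hvc : v < hcrit g q := by rcases hvb with h | h <;> linarith
  set V : State := ⟨v, q / v, UL.a + head g UL - specHead g q v⟩ with hVdef
  set W : State := ⟨w, q / w, R.a⟩ with hWdef
  have hVd : disc V = q := mul_div_cancel₀ _ hv0.ne'
  have hWd : disc W = q := mul_div_cancel₀ _ hw0.ne'
  have hVh : head g V = specHead g q v := by rw [← hVd]; exact head_eq_specHead hv0
  have hWh : head g W = specHead g q w := by rw [← hWd]; exact head_eq_specHead hw0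
  have hVG : V ∈ G1 g := by
    refine (mem_G1_iff hg).2 ⟨hv0, div_pos hq hv0, ?_⟩
    exact (lt_hcrit_disc_iff hg hv0).1 (by rw [hVd]; exact hvc)
  have hVs := ((mem_G1_iff hg).1 hVG).2.2
  obtain ⟨j1, j2, j3⟩ := lt_hash_h hg (U := V) hv0 hVs
  have hVhd := disc_hash hg (U := V) hv0 j3
  have hVhh := head_hash hg (U := V) hv0 j3
  rw [hVd] at hVhd hVhh j2
  have hcV : StationaryContact g UL V := by
    refine (stationaryContact_iff hg).2 ⟨h0, hv0, hVd.symm, ?_, .inr ⟨hcL.le, hvc.le⟩⟩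
    rw [hVh]; ring
  have hcW : StationaryContact g (hash g V) W := by
    refine (stationaryContact_iff hg).2 ⟨hv0.trans j1, hw0, hVhd.trans hWd.symm, ?_,
      .inl ⟨by rw [hVhd]; exact j2.le, by rw [hVhd]; exact hwc.le⟩⟩
    rw [hVhh, hWh, hVh, hash_a]
    change UL.a + head g UL - specHead g q v + (specHead g q v - jumpLoss g q v)
      = R.a + specHead g q w
    linarith
  have hlev : (UL.a < V.a ∧ V.a < R.a) ∨ (R.a < V.a ∧ V.a < UL.a) := by
    change (UL.a < UL.a + head g UL - specHead g q v ∧ UL.a + head g UL - specHead g q v < R.a) ∨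
      (R.a < UL.a + head g UL - specHead g q v ∧ UL.a + head g UL - specHead g q v < UL.a)
    rcases hvb with ⟨h1, h2⟩ | ⟨h1, h2⟩
    · have m1 := specHead_lt_of_le_hcrit hg h0 hvc.le h1
      have m2 := specHead_lt_of_le_hcrit hg hv0 a5 h2
      left; constructor <;> linarith
    · have m1 := specHead_lt_of_le_hcrit hg a1 hvc.le h1
      have m2 := specHead_lt_of_le_hcrit hg hv0 hcL.le h2
      right; constructor <;> linarith
  have hVL : V.a ≠ UL.a := by rcases hlev with h | h; exacts [h.1.ne', h.2.ne]
  have hVR : V.a ≠ R.a := by rcases hlev with h | h; exacts [h.2.ne, h.1.ne']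
  have hab : |V.a - UL.a| + |V.a - R.a| ≤ |UL.a - R.a| := by
    rcases hlev with ⟨h1, h2⟩ | ⟨h1, h2⟩
    · rw [abs_of_pos (by linarith), abs_of_neg (by linarith), abs_of_neg (by linarith)]
      linarith
    · rw [abs_of_neg (by linarith), abs_of_pos (by linarith), abs_of_pos (by linarith)]
      linarith
  have hWp : phi2 g W R = 0 := by rw [phi2_eq]; exact hw
  obtain ⟨hsl, hs0⟩ := links_shock1_hash hg hVG
  have hWu : 0 < W.u := div_pos hq hw0
  refine ⟨(contact, V) :: (shock1, hash g V) :: (contact, W) :: wave2Fan W R, ?_,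
    ⟨V, W, _, hcV, hVG.2, hVL, hVR, hab, hcW, rfl, rfl, .inl ⟨hWp, rfl⟩⟩,
    ⟨(wave2Fan W R).map Prod.fst, wave2Fan_kinds _ _, by simp⟩⟩
  refine solution_cons_contact hcV hVL.symm ⟨by simp, hs0.ge⟩ ?_ hab
  refine solution_cons_wave hsl rfl ⟨by simp, hs0.le⟩ ?_
  refine solution_cons_contact' hcW hVR rfl
    (follows_wave2Fan hg hR (by simp) (by simp) hWp rfl hWu.le)
    (solution_wave2Fan hw0.le hR hWp rfl)

/-- The solution with a 1-shock in front of a subcritical contact. -/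
theorem exists_shockContact {UL V : State} (hg : 0 < g) (hUL : UL ∈ G1 g) (hR : 0 < R.h)
    (hne : UL.a ≠ R.a) (hV : V ∈ W1a g UL R.a ∩ W2B g R)
    (hs : R.h < V.h → 0 ≤ shockSpeed V R) :
    ∃ F, IsRiemannSolution g UL R F ∧ IsShockContact g UL R F ∧ IsA3 F := by
  obtain ⟨⟨hVa, hVG, U, hU, hlt, hUG, hsp, hc⟩, hV0, -, hVp⟩ := hV
  obtain ⟨hU0, hUe⟩ := mem_W1_iff.1 hU
  have hUa : U.a = UL.a := hU.2.1
  have hl : Links g shock1 UL U := by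
    rw [hUe]; exact links_shock1_wave1State hUL.1 hlt
  refine ⟨(shock1, U) :: (contact, V) :: wave2Fan V R, ?_,
    ⟨U, V, isLeftShock_of_links hl hsp, hUG.2.2, hc, hVa, ((mem_closedG2_iff hg).1 hVG).2,
      hVp, hVG.2.2, rfl⟩,
      ⟨(wave2Fan V R).map Prod.fst, wave2Fan_kinds _ _, by simp⟩⟩
  exact solution_cons_wave hl hUa ⟨by simp, hsp⟩
    (solution_cons_contact' hc (hUa ▸ hne) hVa
      (follows_contact_wave2Fan (fun _ => hVG.2.2) hs) (solution_wave2Fan hV0.le hR hVp hVa))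

end Building

/-! ### Subcritical contacts along the 1-shock curve -/

/-- The subcritical state at level `a` behind a stationary contact from `U`. -/
def contactTo (g a : ℝ) (U : State) : State where
  h := subDepth (disc U ^ 2 / g) (head g U + U.a - a)
  u := disc U / subDepth (disc U ^ 2 / g) (head g U + U.a - a)
  a := a

theorem contactTo_spec {g a : ℝ} {U : State} (hg : 0 < g) (hU : U ∈ closedG2 g)
    (he : 0 < head g U + U.a - a) (ha : a ≤ aMax g U) :
    StationaryContact g U (contactTo g a U) ∧ contactTo g a U ∈ closedG2 g := by
  obtain ⟨h0, hs⟩ := (mem_closedG2_iff hg).1 hU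
  rw [aMax_eq] at ha
  have hc := (hcrit_le_iff_cubic (q := disc U) hg).1
    (show 3 / 2 * hcrit g (disc U) ≤ head g U + U.a - a by linarith)
  have d0 : 0 < (contactTo g a U).h :=
    (by positivity : 0 < 2 * (head g U + U.a - a) / 3).trans_le (subDepth_ge he)
  have hd : disc (contactTo g a U) = disc U := mul_div_cancel₀ _ d0.ne'
  have hcd : hcrit g (disc U) ≤ (contactTo g a U).h := hcrit_le_subDepth hg he hc
  have hh : head g (contactTo g a U) = head g U + U.a - a := by
    rw [head_eq_specHead d0, hd]; exact subDepth_specHead hg he hc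
  refine ⟨(stationaryContact_iff hg).2 ⟨h0, d0, hd.symm, ?_,
    .inl ⟨(hcrit_disc_le_iff hg h0).2 hs, hcd⟩⟩, (mem_closedG2_iff hg).2 ⟨d0, ?_⟩⟩
  · rw [hh]; change _ = a + _; ring
  · rw [← hcrit_disc_le_iff hg d0, hd]; exact hcd

theorem level_le_aMax {g : ℝ} {U V : State} (hg : 0 < g) (h : StationaryContact g U V) :
    V.a ≤ aMax g U := by
  obtain ⟨h1, h2⟩ := contact_disc_head hg h
  have := specHead_ge (q := disc V) hg h.2.1
  rw [← head_eq_specHead h.2.1] at this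
  rw [aMax_eq, h1]; linarith

theorem eq_contactTo {g : ℝ} {U V : State} (hg : 0 < g) (hU : U ∈ closedG2 g)
    (h : StationaryContact g U V) (hV : V ∈ closedG2 g) : V = contactTo g V.a U := by
  obtain ⟨h1, h2⟩ := contact_disc_head hg h
  have hV0 := h.2.1
  have hp : 0 < head g V := by
    have : 0 ≤ V.u ^ 2 / (2 * g) := by positivity
    unfold head colHead; linarith
  obtain ⟨c1, c2⟩ := contactTo_spec (a := V.a) hg hU (by linarith) (level_le_aMax hg h)
  obtain ⟨k1, k2⟩ := contact_disc_head hg c1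
  have hd : disc V = disc (contactTo g V.a U) := h1.symm.trans k1
  have e : (contactTo g V.a U).a = V.a := rfl
  refine state_ext_disc hV0 ?_ hd rfl
  refine subcritical_depth_unique (q := disc V) hg hV0 c2.1
    ((hcrit_disc_le_iff hg hV0).2 ((mem_closedG2_iff hg).1 hV).2) ?_ ?_
  · rw [hd]; exact (hcrit_disc_le_iff hg c2.1).2 ((mem_closedG2_iff hg).1 c2).2
  · rw [← head_eq_specHead hV0]
    rw [hd, ← head_eq_specHead c2.1]; linarith

theorem continuous_disc_wave1State {g : ℝ} {U : State} (h0 : 0 < U.h) :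
    Continuous fun z => disc (wave1State g U z) :=
  continuous_id.mul (continuous_wave1State h0)

theorem continuous_head_wave1State {g : ℝ} {U : State} (h0 : 0 < U.h) :
    Continuous fun z => head g (wave1State g U z) :=
  continuous_id.add (((continuous_wave1State h0).pow 2).div_const _)

theorem continuous_hcrit (g : ℝ) : Continuous (hcrit g) :=
  ((continuous_pow 2).div_const g).rpow_const fun _ => .inr (by norm_num)

theorem continuous_aMax_wave1State {g : ℝ} {U : State} (h0 : 0 < U.h) :
    Continuous fun z => aMax g (wave1State g U z) := by
  simp only [aMax_eq]
  exact (continuous_const.add (continuous_head_wave1State h0)).sub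
    (continuous_const.mul ((continuous_hcrit g).comp (continuous_disc_wave1State h0)))

theorem hasDerivAt_hcrit {g q : ℝ} (hg : 0 < g) (hq : q ≠ 0) :
    HasDerivAt (hcrit g) (2 / 3 * hcrit g q / q) q := by
  have hp : 0 < q ^ 2 / g := by positivity
  have h := (((hasDerivAt_pow 2 q).div_const g).rpow_const (p := 1 / 3) (.inl hp.ne'))
  refine HasDerivAt.congr_deriv h ?_
  rw [Real.rpow_sub_one hp.ne']
  change _ * (hcrit g q / _) = _
  field_simp
  norm_num
  ring

/-- On the subcritical part of the 1-shock curve with `u ≤ 0`, the highest level that can be reached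
decreases. -/
theorem aMax_wave1State_lt {g x y : ℝ} {U : State} (hg : 0 < g) (h0 : 0 < U.h) (hx : U.h ≤ x)
    (hxy : x < y) (hu : (wave1State g U x).u ≤ 0) (hl : 0 ≤ lambda2 g (wave1State g U y)) :
    aMax g (wave1State g U y) < aMax g (wave1State g U x) := by
  refine strictAntiOn_of_deriv_neg (convex_Icc x y) (continuous_aMax_wave1State h0).continuousOn
    (fun z hz => ?_) (left_mem_Icc.2 hxy.le) (right_mem_Icc.2 hxy.le) hxy
  rw [interior_Icc] at hz
  have hz0 : 0 < z := h0.trans_le (hx.trans hz.1.le)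
  have hUz : U.h < z := hx.trans_lt hz.1
  set v := (wave1State g U z).u with hv
  have hvneg : v < 0 := by
    have := velJump_strictMono hg h0 (h0.le.trans hx) hz.1
    rw [hv]; simp only [wave1State] at hu ⊢; linarith
  have hl2 : 0 < lambda2 g (wave1State g U z) :=
    hl.trans_lt (left_lambda2_lt hg h0 hz0.le hz.2)
  have hq : disc (wave1State g U z) ≠ 0 := (mul_neg_of_pos_of_neg hz0 hvneg).ne
  have hsub : v ^ 2 < g * z := by
    refine (mem_G2_iff.1 (show wave1State g U z ∈ G2 g from ⟨hz0, ?_, hl2⟩)).2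
    linarith [lambda1_lt_u hg (U := wave1State g U z) hz0]
  have hd : hcrit g (disc (wave1State g U z)) < z :=
    (hcrit_disc_lt_iff hg (U := wave1State g U z) hz0).2 hsub
  have hd0 := hcrit_pos hg hq
  have hcube := hcrit_cube' hg (disc (wave1State g U z))
  have hk := le_shockSlope hg h0 hUz.le
  have hud : HasDerivAt (fun s => (wave1State g U s).u) (-shockSlope g U.h z) z := by
    have h1 := (hasDerivAt_shockJump hg h0 hz0).const_sub U.u
    refine h1.congr_of_eventuallyEq ?_
    filter_upwards [lt_mem_nhds hUz] with s hs
    simp only [wave1State, velJump_of_lt hs]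
  have hqd : HasDerivAt (fun s => disc (wave1State g U s)) (1 * v + z * -shockSlope g U.h z) z :=
    (hasDerivAt_id z).mul hud
  have hA : HasDerivAt (fun s => aMax g (wave1State g U s))
      (1 + 2 * v * -shockSlope g U.h z / (2 * g) - 3 / 2 * (2 / 3 *
        hcrit g (disc (wave1State g U z)) / disc (wave1State g U z) *
        (1 * v + z * -shockSlope g U.h z))) z := by
    simp only [aMax_eq]
    have h1 : HasDerivAt (fun s => head g (wave1State g U s))
        (1 + 2 * v * -shockSlope g U.h z / (2 * g)) z := by
      have := (hasDerivAt_id z).add ((hud.pow 2).div_const (2 * g))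
      refine HasDerivAt.congr_deriv this ?_
      simp [hv]
    have h2 := (hasDerivAt_hcrit hg hq).comp z hqd
    exact (h1.const_add U.a).sub (h2.const_mul (3 / 2))
  rw [hA.deriv]
  have hdz : disc (wave1State g U z) = z * v := rfl
  rw [hdz] at hcube hd hd0 ⊢
  generalize hcrit g (z * v) = d at *
  generalize shockSlope g U.h z = k at *
  have hs : 0 < √(g * z) := Real.sqrt_pos.2 (by positivity)
  have hs2 : √(g * z) ^ 2 = g * z := sqrt_mul_sq hg hz0.le
  set s := √(g * z)
  have hks : g ≤ k * s := by rwa [div_le_iff₀ hs] at hk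
  have hkpos : 0 < k := (div_pos hg hs).trans_le hk
  -- the bracket `k d (z + d) + z v` is positive
  have hbr : 0 < k * d * (z + d) + z * v := by
    by_contra! hn
    have h1 : (k * d * (z + d)) ^ 2 ≤ (z * v) ^ 2 := by
      rw [← neg_sq (z * v)]
      exact pow_le_pow_left₀ (by positivity) (by linarith) 2
    -- With `k² z ≥ g` from the slope bound, a nonpositive bracket would lead to `(z + d)² ≤ z d`.
    rw [← hcube] at h1
    have h2 : g ^ 2 ≤ (k * s) ^ 2 := pow_le_pow_left₀ hg.le hks 2
    have h3 : g ≤ k ^ 2 * z := by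
      have : g * g ≤ g * (k ^ 2 * z) := by rw [mul_pow, hs2] at h2; linarith
      exact le_of_mul_le_mul_left this hg
    have h4 : g * d ^ 3 ≤ k ^ 2 * z * d ^ 3 := mul_le_mul_of_nonneg_right h3 (by positivity)
    have h5 : k ^ 2 * d ^ 2 * (z + d) ^ 2 ≤ k ^ 2 * d ^ 2 * (z * d) := by nlinarith
    have h6 := le_of_mul_le_mul_left h5 (by positivity)
    nlinarith
  -- The relation `g d³ = (z v)²` for the critical depth `d` factors the derivative; its sign is
  -- that of `v`.
  have e : 1 + 2 * v * -k / (2 * g) - 3 / 2 * (2 / 3 * d / (z * v) * (1 * v + z * -k))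
      = (z - d) * (k * d * (z + d) + z * v) / (z ^ 2 * v) := by
    have hv0 := hvneg.ne
    field_simp
    linear_combination k * hcube
  rw [e]
  exact div_neg_of_pos_of_neg (mul_pos (by linarith) hbr)
    (mul_neg_of_pos_of_neg (by positivity) hvneg)

section Existence

variable {g : ℝ} {UL R : State}

theorem IsLeftShock.links {U : State} (hUL : 0 < UL.h) (h : IsLeftShock g UL U) :
    Links g shock1 UL U ∧ shockSpeed UL U ≤ 0 := by
  have hl : Links g shock1 UL U := by
    rw [h.2.1]; exact links_shock1_wave1State hUL h.1
  refine ⟨hl, ?_⟩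
  rw [(shock1_speed hl).1]
  exact sub_nonpos.2 h.2.2

theorem IsLeftShock.aMax_lt {U U' : State} (hg : 0 < g) (hUL : 0 < UL.h)
    (h : IsLeftShock g UL U) (h' : IsLeftShock g UL U') (hlt : U.h < U'.h) (hu : 0 ≤ U'.u) :
    aMax g U < aMax g U' := by
  obtain ⟨c1, c2, -⟩ := h.compare hg hUL h' hlt
  have hq : 0 ≤ disc U' := mul_nonneg (hUL.trans h'.1).le hu
  have := hcrit_mono hg (pow_le_pow_left₀ hq c1.le 2)
  have ha : U.a = U'.a := by rw [h.2.1, h'.2.1]; rfl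
  rw [aMax_eq, aMax_eq]; linarith

/-- Along the 1-shock curve the reachable level rises up to the state at rest and falls afterwards,
so it is bounded below by its values at the two ends. -/
theorem IsLeftShock.le_aMax {X Y : State} {z aR : ℝ} (hg : 0 < g) (hUL : 0 < UL.h)
    (hX : IsLeftShock g UL X) (hY : IsLeftShock g UL Y) (hl : 0 ≤ lambda2 g Y) (hXz : X.h ≤ z)
    (hzY : z ≤ Y.h) (haX : aR ≤ aMax g X) (haY : aR ≤ aMax g Y) :
    aR ≤ aMax g (wave1State g UL z) := by
  have hz := isLeftShock_wave1State hg hUL hX hXz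
  rcases le_or_gt 0 (wave1State g UL z).u with hu | hu
  · rcases hXz.eq_or_lt with h | h
    · rw [← h, ← hX.2.1]; exact haX
    · exact haX.trans (hX.aMax_lt hg hUL hz h hu).le
  · rcases hzY.eq_or_lt with h | h
    · rw [h, ← hY.2.1]; exact haY
    · rw [hY.2.1] at haY hl
      exact haY.trans (aMax_wave1State_lt hg hUL hz.1.le h hu.le hl).le

theorem IsLeftShock.mem_closedG2 {X : State} (hg : 0 < g) (hUL : UL ∈ G1 g)
    (hX : IsLeftShock g UL X) (hl : 0 ≤ lambda2 g X) : X ∈ closedG2 g :=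
  have f := hX.facts hg hUL
  ⟨f.1, f.2.1.le, hl⟩

/-- The composite curve meets the backward 2-wave curve between two states on opposite sides. -/
theorem exists_mem_W1a_inter {X Y : State} (hg : 0 < g) (hUL : UL ∈ G1 g) (hR : 0 < R.h)
    (hX : IsLeftShock g UL X) (hY : IsLeftShock g UL Y) (hXY : X.h ≤ Y.h) (hl : 0 ≤ lambda2 g Y)
    (haX : R.a ≤ aMax g X) (haY : R.a ≤ aMax g Y) (he : 0 < head g X + X.a - R.a)
    (hpX : 0 ≤ phi2 g (contactTo g R.a X) R) (hpY : phi2 g (contactTo g R.a Y) R ≤ 0) :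
    ∃ V, V ∈ W1a g UL R.a ∩ W2B g R := by
  have hL0 := hUL.1
  have hhead : ∀ z, X.h ≤ z → 0 < head g (wave1State g UL z) + UL.a - R.a := by
    intro z hz
    have ha : X.a = UL.a := (hX.facts hg hUL).2.2.1
    rcases hz.eq_or_lt with h | h
    · rw [← h, ← hX.2.1, ← ha]; exact he
    · have := (hX.compare hg hL0 (isLeftShock_wave1State hg hL0 hX hz) h).2.1
      linarith
  have hspec : ∀ z ∈ Icc X.h Y.h, IsLeftShock g UL (wave1State g UL z) ∧
      wave1State g UL z ∈ closedG2 g ∧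
      StationaryContact g (wave1State g UL z) (contactTo g R.a (wave1State g UL z)) ∧
      contactTo g R.a (wave1State g UL z) ∈ closedG2 g := by
    intro z hz
    have h1 := isLeftShock_wave1State hg hL0 hX hz.1
    have h2 : wave1State g UL z ∈ closedG2 g := by
      refine h1.mem_closedG2 hg hUL ?_
      rcases hz.2.eq_or_lt with h | h
      · rw [h, ← hY.2.1]; exact hl
      · rw [hY.2.1] at hl
        exact hl.trans (left_lambda2_lt hg hL0 (hL0.trans h1.1).le h).le
    exact ⟨h1, h2, contactTo_spec hg h2 (hhead z hz.1)
      (hX.le_aMax hg hL0 hY hl hz.1 hz.2 haX haY)⟩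
  have hcont : ContinuousOn (fun z => phi2 g (contactTo g R.a (wave1State g UL z)) R)
      (Icc X.h Y.h) := by
    have hd : ContinuousOn (fun z => (contactTo g R.a (wave1State g UL z)).h) (Icc X.h Y.h) := by
      intro z hz
      refine ContinuousAt.continuousWithinAt ?_
      have c1 : Continuous fun z => ((disc (wave1State g UL z) ^ 2 / g,
          head g (wave1State g UL z) + UL.a - R.a) : ℝ × ℝ) :=
        (((continuous_disc_wave1State hL0).pow 2).div_const g).prodMk
          (((continuous_head_wave1State hL0).add continuous_const).sub continuous_const)
      exact ContinuousAt.comp (x := z) (f := fun z => ((disc (wave1State g UL z) ^ 2 / g,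
        head g (wave1State g UL z) + UL.a - R.a) : ℝ × ℝ))
        (continuousAt_subDepth (hhead z hz.1)) c1.continuousAt
    simp only [phi2_eq]
    refine ContinuousOn.sub (ContinuousOn.sub ?_ continuousOn_const)
      ((continuous_velJump hR).comp_continuousOn hd)
    exact (continuous_disc_wave1State hL0).continuousOn.div hd
      fun z hz => (hspec z hz).2.2.1.2.1.ne'
  obtain ⟨z, hz, hz0⟩ := exists_root hXY hcont (by rw [← hX.2.1]; exact hpX)
    (by rw [← hY.2.1]; exact hpY)
  obtain ⟨h1, h2, h3, h4⟩ := hspec z hz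
  refine ⟨contactTo g R.a (wave1State g UL z), ⟨rfl, h4, wave1State g UL z, mem_W1_iff.2 ⟨h2.1, rfl⟩, h1.1, h2, ?_, h3⟩, h3.2.1, rfl, hz0⟩
  exact (h1.links hL0).2

/-- `K` has nonpositive velocity and `U_L^#` a positive one, so `K` lies deeper on the decreasing
1-wave curve and its shock moves to the left. -/
theorem IsLowerLimit.facts {aR : ℝ} {K : State} (hg : 0 < g) (hUL : UL ∈ G1 g)
    (h : IsLowerLimit g UL aR K) : IsLeftShock g UL K ∧ 0 ≤ lambda2 g K ∧ aR ≤ aMax g K ∧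
      K.u ≤ 0 ∧ (UL.a < aR → aMax g K = aR) := by
  obtain ⟨hK, hK'⟩ := h
  obtain ⟨h0, hKe⟩ := mem_W1_iff.1 hK
  have hL0 := hUL.1
  have hu : K.u ≤ 0 := by
    rcases hK' with ⟨-, hc⟩ | ⟨-, -, hc, -⟩
    · rw [hc.2]; exact neg_nonpos.2 (Real.sqrt_nonneg _)
    · exact hc
  have hl : 0 ≤ lambda2 g K := by
    rcases hK' with ⟨-, hc⟩ | ⟨-, hc, -⟩
    · unfold lambda2; rw [hc.2]; simp
    · exact hc.2.2.le
  obtain ⟨s1, -, s3, s4⟩ := isLeftShock_hash hg hUL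
  have hHu : 0 < (hash g UL).u := by
    rw [← s3] at s4
    exact pos_of_mul_pos_right s4 (hL0.trans s1.1).le
  have hle : (hash g UL).h ≤ K.h := by
    by_contra! hn
    have := velJump_mono hg hL0 h0.le hn.le
    rw [s1.2.1] at hHu
    rw [hKe] at hu
    simp only [wave1State] at hHu hu
    linarith
  refine ⟨?_, hl, ?_, hu, ?_⟩
  · rw [hKe]; exact isLeftShock_wave1State hg hL0 s1 hle
  · rcases hK' with ⟨ha, hc⟩ | ⟨-, -, -, hc⟩
    · have hz : lambda2 g K = 0 := by unfold lambda2; rw [hc.2]; simp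
      obtain ⟨-, e1, -, e2⟩ := critical_of_lambda2_zero hg h0 hz
      rw [aMax_eq, e1, ← e2, hK.2.1]; linarith
    · exact hc.ge
  · rcases hK' with ⟨ha, -⟩ | ⟨-, -, -, hc⟩
    · intro h; linarith
    · exact fun _ => hc

theorem exists_supercritical_contact (hg : 0 < g) (hUL : UL ∈ G1 g)
    (ha : R.a ≤ aMax g UL) : ∃ O, StationaryContact g UL O ∧ O.a = R.a := by
  obtain ⟨h0, hu, hs⟩ := (mem_G1_iff hg).1 hUL
  have hq : disc UL ≠ 0 := (mul_pos h0 hu).ne'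
  rw [aMax_eq] at ha
  obtain ⟨x, hx0, hxc, hx⟩ := exists_supercritical_depth (e := head g UL + UL.a - R.a) hg hq
    (by linarith)
  have hd : disc ⟨x, disc UL / x, R.a⟩ = disc UL := mul_div_cancel₀ _ hx0.ne'
  refine ⟨⟨x, disc UL / x, R.a⟩, (stationaryContact_iff hg).2 ⟨h0, hx0, hd.symm, ?_,
    .inr ⟨(le_hcrit_disc_iff hg h0).2 hs.le, hxc⟩⟩, rfl⟩
  rw [head_eq_specHead (U := ⟨x, disc UL / x, R.a⟩) hx0, hd, hx]; ring

/-- Existence of a solution when the lower limit state lies below the backward 2-wave curve. -/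
theorem exists_solution {K Ko : State} (hg : 0 < g) (hUL : UL ∈ G1 g) (hR : 0 < R.h)
    (hK : IsContactOfLowerLimit g UL R.a K Ko) (hp : phi2 g Ko R ≤ 0)
    (hsp : ∀ V ∈ W1a g UL R.a ∩ W2B g R, V.u ≤ 0 → R.h < V.h → 0 ≤ shockSpeed V R) :
    ∃ F, IsRiemannSolution g UL R F := by
  have hL0 := hUL.1
  rcases eq_or_ne UL.a R.a with hne | hne
  · obtain ⟨F, hF⟩ := exists_pureFan (V := UL) hg hL0 hR hne
    exact ⟨F, solution_of_pureFan hg hL0 hR hF⟩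
  obtain ⟨hKl, hKoa, hKoG, hKc⟩ := hK
  obtain ⟨k1, k2, k3, k4, k5⟩ := hKl.facts hg hUL
  have hKG := k1.mem_closedG2 hg hUL k2
  have hpK : phi2 g (contactTo g R.a K) R ≤ 0 := by
    rw [← hKoa, ← eq_contactTo hg hKG hKc hKoG]; exact hp
  have hthird : ∀ V, V ∈ W1a g UL R.a ∩ W2B g R → ∃ F, IsRiemannSolution g UL R F := by
    intro V hV
    obtain ⟨F, hF, -⟩ := exists_shockContact hg hUL hR hne hV (by
      intro hlt
      rcases le_or_gt V.u 0 with hu | hu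
      · exact hsp V hV hu hlt
      · have := (shock2_lax hg (links_shock2_of_phi2 hR hlt hV.2.2.2 hV.1.1.symm)).2.2.1
        linarith)
    exact ⟨F, hF⟩
  obtain ⟨s1, s2, s3, s4⟩ := isLeftShock_hash hg hUL
  have hHG := s1.mem_closedG2 hg hUL s2.le
  have hHK : (hash g UL).h ≤ K.h := (k1.facts hg hUL).2.2.2.1
  have hHa : (hash g UL).a = UL.a := rfl
  have hHc := hcrit_pos hg s4.ne'
  -- Either the composite curve begins at `U_L^#`, or the level `R.a` is out of reach from there and
  -- the curve begins at the first state from which it can just be reached.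
  rcases le_or_gt R.a (aMax g (hash g UL)) with hA | hA
  · have he : 0 < head g (hash g UL) + (hash g UL).a - R.a := by
      rw [aMax_eq, s3] at hA; linarith
    obtain ⟨c1, c2⟩ := contactTo_spec hg hHG he hA
    rcases le_or_gt 0 (phi2 g (contactTo g R.a (hash g UL)) R) with hS | hS
    · obtain ⟨V, hV⟩ := exists_mem_W1a_inter hg hUL hR s1 k1 hHK k2 hA k3 he hS hpK
      exact hthird V hV
    -- `U_L` has the discharge of `U_L^#` and more head, so it reaches the level too.
    have hAL : R.a ≤ aMax g UL := by
      have h1 := head_hash hg hL0 s4.ne'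
      have h2 := jumpLoss_pos hg s4.ne' hL0
        ((lt_hcrit_disc_iff hg hL0).2 ((mem_G1_iff hg).1 hUL).2.2)
      rw [aMax_eq, s3] at hA
      rw [aMax_eq]; linarith
    obtain ⟨O, hO, hOa⟩ := exists_supercritical_contact hg hUL hAL
    rcases le_or_gt (phi2 g (hash g O) R) 0 with hOp | hOp
    · obtain ⟨F, hF, -⟩ := exists_contactPure hg hUL hR hne hO hOa hOp
      exact ⟨F, hF⟩
    · obtain ⟨F, hF, -⟩ := exists_resonant hg hUL hR hO hOa c1 rfl (.inl ⟨hS, hOp⟩)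
      exact ⟨F, hF⟩
  · have hHu : 0 < (hash g UL).u := by
      rw [← s3] at s4
      exact pos_of_mul_pos_right s4 (hL0.trans s1.1).le
    have hlev : UL.a < R.a := by
      have := specHead_ge (q := disc (hash g UL)) hg hHG.1
      rw [← head_eq_specHead hHG.1] at this
      rw [aMax_eq] at hA; linarith
    have hKA := k5 hlev
    -- the state at rest
    have hcu : Continuous fun z => (wave1State g UL z).u := continuous_wave1State hL0
    obtain ⟨z, hz, hz0⟩ := exists_root hHK hcu.continuousOn (by rw [← s1.2.1]; exact hHu.le)
      (by rw [← k1.2.1]; exact k4)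
    have hzl := isLeftShock_wave1State hg hL0 s1 hz.1
    have hzq : disc (wave1State g UL z) = 0 := mul_eq_zero_of_right _ hz0
    have hzA : R.a < aMax g (wave1State g UL z) := by
      rcases hz.2.eq_or_lt with h | h
      -- If `K` were at rest, a contact to its highest level would leave no head for `Ko`.
      · exfalso
        rw [h, ← k1.2.1] at hzq
        obtain ⟨d1, d2⟩ := contact_disc_head hg hKc
        have : 0 < head g Ko := by
          have h2 := hKc.2.1
          have : 0 ≤ Ko.u ^ 2 / (2 * g) := by positivity
          unfold head colHead; linarith
        rw [aMax_eq, hzq] at hKA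
        have h0 : hcrit g 0 = 0 := by simp [hcrit]
        rw [h0] at hKA
        linarith
      · have := aMax_wave1State_lt hg hL0 hzl.1.le h hz0.le (by rw [← k1.2.1]; exact k2)
        rw [← k1.2.1, hKA] at this
        exact this
    -- the state from which the contact is just possible
    obtain ⟨b, hb, hb0⟩ := exists_root (f := fun x => R.a - aMax g (wave1State g UL x)) hz.1
      (continuous_const.sub (continuous_aMax_wave1State hL0)).continuousOn
      (by rw [← s1.2.1]; linarith) (by linarith)
    have hbA : aMax g (wave1State g UL b) = R.a := by linarith
    have hbz : b < z := by
      rcases hb.2.eq_or_lt with h | h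
      · rw [h] at hbA; linarith
      · exact h
    have hbl := isLeftShock_wave1State hg hL0 s1 hb.1
    have hb00 : 0 < b := hL0.trans hbl.1
    have hbu : 0 < (wave1State g UL b).u := by
      have := velJump_strictMono hg hL0 hb00.le hbz
      simp only [wave1State] at hz0 ⊢; linarith
    have hbq : 0 < disc (wave1State g UL b) := mul_pos hb00 hbu
    have hbG := hbl.mem_closedG2 hg hUL (hbu.trans (u_lt_lambda2 hg hb00)).le
    have hbe : head g (wave1State g UL b) + (wave1State g UL b).a - R.a =
        3 / 2 * hcrit g (disc (wave1State g UL b)) := by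
      rw [aMax_eq] at hbA; linarith
    have hbc := hcrit_pos hg hbq.ne'
    obtain ⟨c1, c2⟩ := contactTo_spec (a := R.a) hg hbG (by linarith) hbA.ge
    rcases le_or_gt 0 (phi2 g (contactTo g R.a (wave1State g UL b)) R) with hS | hS
    · obtain ⟨V, hV⟩ := exists_mem_W1a_inter hg hUL hR hbl k1 (hb.2.trans hz.2) k2 hbA.ge k3
        (by linarith) hS hpK
      exact hthird V hV
    set B := wave1State g UL b
    set V := contactTo g R.a B with hVdef
    obtain ⟨d1, d2⟩ := contact_disc_head hg c1
    have hVu : 0 < V.u := by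
      rw [d1] at hbq
      exact pos_of_mul_pos_right hbq c1.2.1.le
    -- The head left after the contact is the least one for the discharge, so `V` is critical; then
    -- `hash g V = V`, and the sign of `Φ₂` at `V` itself makes the remaining fan solvable.
    have hVh : V.h = hcrit g (disc V) := by
      by_contra! hn
      have h1 := specHead_gt hg c1.2.1 hn
      rw [← head_eq_specHead c1.2.1, ← d1] at h1
      have : V.a = R.a := rfl
      linarith
    have hVs : V.u ^ 2 = g * V.h := le_antisymm ((hcrit_disc_le_iff hg c1.2.1).1 hVh.ge)
      ((le_hcrit_disc_iff hg c1.2.1).1 hVh.le)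
    have hVl : 0 ≤ lambda1 g V :=
      (lambda1_nonneg_iff (mul_pos hg c1.2.1).le).2 ⟨hVu.le, hVs.ge⟩
    have hVq : disc V ≠ 0 := by rw [← d1]; exact hbq.ne'
    obtain ⟨F, hF, hf⟩ := exists_pureFan_follows (U := B) (V := V) hg c1.2.1 hR hVu hVl rfl
      (by rw [hash_of_critical hg c1.2.1 hVq hVs]; exact hS.le)
    obtain ⟨hl, hs⟩ := hbl.links hL0
    exact ⟨(shock1, B) :: (contact, V) :: F, solution_cons_wave hl rfl
      ⟨by simp, hs⟩
      (solution_cons_contact' c1 hne rfl hf (solution_of_pureFan hg c1.2.1 hR hF))⟩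

end Existence

/-! ### The third solution -/

section Third

variable {g : ℝ} {UL R O S : State}

theorem exists_shockContact_of_lowerLimit {K Ko : State} (hg : 0 < g) (hUL : UL ∈ G1 g)
    (hR : 0 < R.h) (hR2 : 0 < lambda2 g R) (hne : UL.a ≠ R.a)
    (hS : StationaryContact g (hash g UL) S) (hSa : S.a = R.a) (hp : 0 ≤ phi2 g S R)
    (hK : IsContactOfLowerLimit g UL R.a K Ko) (hpK : phi2 g Ko R ≤ 0) :
    ∃ F, IsRiemannSolution g UL R F ∧ IsShockContact g UL R F ∧ IsA3 F := by
  obtain ⟨hKl, hKoa, hKoG, hKc⟩ := hK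
  obtain ⟨k1, k2, k3, k4, k5⟩ := hKl.facts hg hUL
  have hKG := k1.mem_closedG2 hg hUL k2
  obtain ⟨s1, s2, s3, s4⟩ := isLeftShock_hash hg hUL
  have hHG := s1.mem_closedG2 hg hUL s2.le
  obtain ⟨b1, b2, b3, -⟩ := contact_hash_facts hg hUL hS
  have hSG : S ∈ closedG2 g :=
    (mem_closedG2_iff hg).2 ⟨b1, (hcrit_disc_le_iff hg b1).1 (by rw [b2]; exact b3)⟩
  have hA : R.a ≤ aMax g (hash g UL) := hSa ▸ level_le_aMax hg hS
  have he : 0 < head g (hash g UL) + (hash g UL).a - R.a := by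
    have := hcrit_pos hg s4.ne'
    rw [aMax_eq, s3] at hA; linarith
  obtain ⟨V, hV⟩ := exists_mem_W1a_inter hg hUL hR s1 k1 (k1.facts hg hUL).2.2.2.1 k2 hA k3 he
    (by rw [← hSa, ← eq_contactTo hg hHG hS hSG]; exact hp)
    (by rw [← hKoa, ← eq_contactTo hg hKG hKc hKoG]; exact hpK)
  exact exists_shockContact hg hUL hR hne hV
    (shockSpeed_nonneg_of_lambda2 hg hR hR2 hV.2.2.2 hV.1.1)

/-! ### Solutions that end their last contact at a critical state -/

/-- The critical state on the backward 2-wave curve. -/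
theorem exists_critical_right (hg : 0 < g) (hR : 0 < R.h) (hR2 : 0 < lambda2 g R)
    (hu : R.u < 2 * √(g * R.h)) :
    ∃ W : State, 0 < W.h ∧ W.h < R.h ∧ W.a = R.a ∧ lambda2 g W = 0 ∧ phi2 g W R = 0 := by
  -- `c` is `√(g h)` at the critical state: equating the invariant `u - 2√(g h)` there, `-3c`, with
  -- its value at `R`.
  set c := (2 * √(g * R.h) - R.u) / 3 with hc
  have hc0 : 0 < c := by rw [hc]; linarith
  have hcR : c < √(g * R.h) := by unfold lambda2 at hR2; rw [hc]; linarith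
  have e : √(g * (c ^ 2 / g)) = c := by
    rw [mul_div_cancel₀ _ hg.ne']; exact Real.sqrt_sq hc0.le
  have hlt : c ^ 2 / g < R.h := by
    rw [div_lt_iff₀ hg]
    have := pow_lt_pow_left₀ hcR hc0.le (n := 2) two_ne_zero
    rw [sqrt_mul_sq hg hR.le] at this; linarith
  refine ⟨⟨c ^ 2 / g, -c, R.a⟩, by positivity, hlt, rfl, ?_, ?_⟩
  · unfold lambda2; simp only; rw [e]; ring
  · rw [phi2_eq, velJump_of_le hlt.le, rarJump_eq hg]
    simp only; rw [e, hc]; ring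

/-- The inequality says that the rarefaction branch reaches `λ₂ = 0` before the water depth
vanishes. -/
theorem right_u_lt (hg : 0 < g) (hS : 0 < S.h) (hs : S.u ^ 2 ≤ g * S.h)
    (hR : 0 < R.h) (hp : 0 < phi2 g S R) : R.u < 2 * √(g * R.h) := by
  have h1 : rarJump g R.h S.h ≤ velJump g R.h S.h := by
    rcases le_total R.h S.h with h | h
    · have := rarJump_le_velJump_sub hg hR h
      rwa [velJump_self, sub_zero] at this
    · rw [velJump_of_le h]
  have h2 : S.u ≤ √(g * S.h) := Real.le_sqrt_of_sq_le hs
  have h3 : 0 < √(g * S.h) := Real.sqrt_pos.2 (by positivity)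
  rw [rarJump_eq hg] at h1
  rw [phi2_eq] at hp
  linarith

/-- The 1-shock curve reaches a state with `λ₂ = 0`. -/
theorem exists_critical_left (hg : 0 < g) (hUL : UL ∈ G1 g) :
    ∃ K, IsLeftShock g UL K ∧ lambda2 g K = 0 := by
  have hL0 := hUL.1
  obtain ⟨s1, s2, -, -⟩ := isLeftShock_hash hg hUL
  -- At depth `m` the slope bound gives `λ₂ ≤ UL.u + 2√(g UL.h) - √(g m) ≤ 0`.
  set m := max (hash g UL).h ((UL.u + 2 * √(g * UL.h)) ^ 2 / g) with hm
  have hHm : (hash g UL).h ≤ m := le_max_left _ _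
  have hml := rarJump_le_velJump_sub hg hL0 (s1.1.le.trans hHm)
  have hsm : UL.u + 2 * √(g * UL.h) ≤ √(g * m) := by
    refine Real.le_sqrt_of_sq_le ?_
    have := (div_le_iff₀ hg).1 (le_max_right (hash g UL).h ((UL.u + 2 * √(g * UL.h)) ^ 2 / g))
    rw [← hm] at this; linarith
  obtain ⟨z, hz, hz0⟩ := exists_root hHm
    (continuous_lambda2_wave1State (g := g) (U := UL) hL0).continuousOn
    (by rw [← s1.2.1]; exact s2.le) (by
      rw [velJump_self, rarJump_eq hg] at hml
      unfold lambda2; simp only [wave1State]; linarith)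
  exact ⟨_, isLeftShock_wave1State hg hL0 s1 hz.1, hz0⟩

/-- The momentum balance on the backward 2-shock curve. -/
theorem mul_phi2_of_lt {U Q : State} (h : Q.h < U.h) :
    U.h * phi2 g U Q = disc U - disc Q - (U.h - Q.h) * (Q.u + U.h * kap g Q.h U.h) := by
  rw [phi2_eq, velJump_of_lt h, shockJump_eq]
  unfold disc; ring

/-- Solvability with a supercritical contact. -/
theorem exists_waveContact {U Q W : State} (hg : 0 < g) (hUL : UL ∈ G1 g)
    (hlev : UL.a < R.a) (hR : 0 < R.h)
    (hU : IsLeftShock g UL U) (hQ0 : 0 < Q.h) (hp : phi2 g U Q = 0) (hQa : Q.a = UL.a)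
    (hs : Q.h < U.h → Q.u + U.h * kap g Q.h U.h ≤ 0) (hQ : lambda2 g Q < 0)
    (hc : StationaryContact g Q W) (hWa : W.a = R.a) (hW : lambda2 g W = 0)
    (hWR : W.h < R.h) (hpW : phi2 g W R = 0) :
    ∃ F, IsRiemannSolution g UL R F ∧ IsWaveContact g UL R F := by
  have hL0 := hUL.1
  have hUa : U.a = UL.a := (hU.facts hg hUL).2.2.1
  have hU0 : 0 < U.h := hL0.trans hU.1
  obtain ⟨hl, hsp⟩ := hU.links hL0
  have tail : IsRiemannSolution g Q R ((contact, W) :: wave2Fan W R) :=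
    solution_cons_contact' hc (by rw [hQa]; exact hlev.ne) hWa
      (follows_contact_wave2Fan (fun _ => hW.ge) (fun h => absurd h hWR.not_gt))
      (solution_wave2Fan hc.2.1.le hR hpW hWa)
  refine ⟨_, ?_, U, Q, W, hlev, hU, hQ0, hp, hQa.trans hUa.symm, hs, hQ, hc, hWa, hW, hpW, rfl⟩
  rcases lt_trichotomy U.h Q.h with h | h | h
  · have hl2 := links_rar2_of_phi2 hU0.le h hp (hQa.trans hUa.symm)
    rw [wave2Fan_rar h]
    refine solution_cons_wave hl hUa ⟨by simp, ?_⟩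
      (solution_cons_wave hl2 (hQa.trans hUa.symm) ⟨by simp, hQ.le⟩ tail)
    exact (shock1_lax hg hl).2.2.le.trans (u_lt_lambda2 hg hU0).le
  · have e : U = Q := by
      rw [phi2_eq, h, velJump_self] at hp
      exact State.ext h (by linarith) (hUa.trans hQa.symm)
    subst e
    rw [wave2Fan_self]
    exact solution_cons_wave hl hUa ⟨by simp, hsp⟩ tail
  · have hl2 := links_shock2_of_phi2 hQ0 h hp (hQa.trans hUa.symm)
    have hsp2 : shockSpeed U Q ≤ 0 := by
      rw [(shock2_speed hl2).2]; exact hs h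
    rw [wave2Fan_shock h]
    refine solution_cons_wave hl hUa ⟨by simp, ?_⟩
      (solution_cons_wave hl2 (hQa.trans hUa.symm) ⟨by simp, hsp2⟩ tail)
    exact (shock1_lax hg hl).2.2.le.trans (shock2_lax hg hl2).2.2.1.le

/-- Solvability with a stationary 2-shock between two contacts. -/
theorem exists_backResonant {U Z W : State} (hg : 0 < g) (hUL : UL ∈ G1 g) (hR : 0 < R.h)
    (hU : IsLeftShock g UL U) (hU2 : 0 ≤ lambda2 g U)
    (hLZ : UL.a < Z.a) (hZR : Z.a < R.a) (hc : StationaryContact g U (hash g Z)) (hZ0 : 0 < Z.h)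
    (hZ : lambda2 g Z < 0) (hc' : StationaryContact g Z W) (hWa : W.a = R.a)
    (hW : lambda2 g W = 0) (hWR : W.h < R.h) (hpW : phi2 g W R = 0) :
    ∃ F, IsRiemannSolution g UL R F ∧ IsBackResonant g UL R F := by
  have hUa : U.a = UL.a := (hU.facts hg hUL).2.2.1
  obtain ⟨hl, hsp⟩ := hU.links hUL.1
  obtain ⟨hl2, hsp2⟩ := links_shock2_hash hg hZ0 hZ
  have hHa : (hash g Z).a = Z.a := rfl
  refine ⟨_, ?_, U, Z, W, hLZ, hZR, hU, hU2, hc, hZ0, hZ, hc', hWa, hW, hpW, rfl⟩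
  refine solution_cons_wave hl hUa ⟨by simp, hsp⟩ ?_
  refine solution_cons_contact hc (by rw [hUa, hHa]; exact hLZ.ne) ⟨by simp, hsp2.ge⟩ ?_ ?_
  · refine solution_cons_wave hl2 rfl ⟨by simp, hsp2.le⟩ ?_
    exact solution_cons_contact' hc' hZR.ne hWa
      (follows_contact_wave2Fan (fun _ => hW.ge) (fun h => absurd h hWR.not_gt))
      (solution_wave2Fan hc'.2.1.le hR hpW hWa)
  · rw [hUa, hHa, abs_of_pos (by linarith), abs_of_neg (by linarith), abs_of_neg (by linarith)]
    linarith

/-- The supercritical state at level `a` in front of the critical state `W`. -/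
theorem exists_supercritical_left {W : State} {a : ℝ} (hg : 0 < g) (hW0 : 0 < W.h)
    (hW : lambda2 g W = 0) (ha : a < W.a) :
    ∃ Q : State, 0 < Q.h ∧ Q.h < W.h ∧ Q.a = a ∧ lambda2 g Q < 0 ∧ disc Q = disc W ∧
      StationaryContact g Q W := by
  obtain ⟨w1, w2, w3, w4⟩ := critical_of_lambda2_zero hg hW0 hW
  obtain ⟨x, hx0, hxc, hx⟩ := exists_supercritical_depth (e := head g W + W.a - a) hg w3.ne
    (by rw [← w4, w2]; linarith)
  have hd : disc ⟨x, disc W / x, a⟩ = disc W := mul_div_cancel₀ _ hx0.ne'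
  have hh : head g ⟨x, disc W / x, a⟩ = head g W + W.a - a := by
    rw [head_eq_specHead (U := ⟨x, disc W / x, a⟩) hx0, hd]; exact hx
  have hxW : x < W.h := by
    rw [w4]
    refine lt_of_le_of_ne hxc ?_
    rintro rfl
    rw [specHead_hcrit hg w3.ne, ← w4] at hx
    linarith
  refine ⟨⟨x, disc W / x, a⟩, hx0, hxW, rfl, ?_, hd, ?_⟩
  · refine (lambda2_neg_iff (mul_pos hg hx0).le).2 ⟨div_neg_of_neg_of_pos w3 hx0, ?_⟩
    refine (lt_hcrit_disc_iff hg (U := ⟨x, disc W / x, a⟩) hx0).1 ?_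
    rw [hd, ← w4]; exact hxW
  · refine (stationaryContact_iff hg).2 ⟨hx0, hW0, hd, ?_, .inr ?_⟩
    · rw [hh]; change a + _ = _; ring
    · rw [hd]; exact ⟨hxc, w4.le⟩

/-- The 1-shock curve meets the backward 2-wave curve of `Q` beyond a state above that curve. -/
theorem exists_left_root {X Q : State} (hg : 0 < g) (hUL : UL ∈ G1 g) (hX : IsLeftShock g UL X)
    (hQ0 : 0 < Q.h) (hp : 0 ≤ phi2 g X Q) :
    ∃ U, IsLeftShock g UL U ∧ X.h ≤ U.h ∧ phi2 g U Q = 0 := by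
  have hL0 := hUL.1
  obtain ⟨y, hy, -, hyu⟩ := exists_velJump_gt hg hL0 (max X.h Q.h) Q.u
  have hc : Continuous fun z => phi2 g (wave1State g UL z) Q := by
    simp only [phi2_eq]
    exact ((continuous_wave1State hL0).sub continuous_const).sub (continuous_velJump hQ0)
  obtain ⟨z, hz, hz0⟩ := exists_root ((le_max_left _ _).trans hy) hc.continuousOn
    (by rw [← hX.2.1]; exact hp) (by
      have := velJump_mono hg hQ0 hQ0.le ((le_max_right _ _).trans hy)
      rw [velJump_self] at this
      rw [phi2_eq]
      change (wave1State g UL y).u - Q.u - velJump g Q.h y ≤ 0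
      linarith)
  exact ⟨_, isLeftShock_wave1State hg hL0 hX hz.1, hz.1, hz0⟩

/-- The left side is the speed of the 2-shock ending at `Q`, which vanishes at the depth of `hash g
Q`. -/
theorem add_mul_kap_nonpos {Q : State} {x : ℝ} (hg : 0 < g) (hQ0 : 0 < Q.h)
    (hQ : lambda2 g Q < 0) (hx : 0 < x) :
    Q.u + x * kap g Q.h x ≤ 0 ↔ x ≤ (hash g Q).h := by
  obtain ⟨hu, hs⟩ := (lambda2_neg_iff (mul_pos hg hQ0).le).1 hQ
  have h1 := (hash_mul_kap hg hQ0 hu.ne).1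
  have h2 := (hQ0.trans (lt_hash_h hg hQ0 hs).1)
  rw [← mul_kap_le_iff hg hQ0 hx h2, h1, abs_of_neg hu]
  constructor <;> intro h <;> linarith

/-- By `hh` the level `R.a` is reachable from `P`, but not from the critical state `K`, so it is the
highest reachable level at some `M` in between. The contact from `M` ends at a critical state at
least as deep as `W` and with no larger velocity, hence on or below the 2-wave curve. -/
theorem exists_lowerLimit_of_head_le {K P W : State} (hg : 0 < g) (hUL : UL ∈ G1 g)
    (hR : 0 < R.h) (hlev : UL.a < R.a) (hK : IsLeftShock g UL K) (hK2 : lambda2 g K = 0)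
    (hP : IsLeftShock g UL P) (hPK : P.h < K.h) (hW0 : 0 < W.h) (hW : lambda2 g W = 0)
    (hpW : phi2 g W R = 0) (hd : disc P = disc W)
    (hh : head g W + R.a ≤ head g P + UL.a) :
    ∃ K Ko, IsContactOfLowerLimit g UL R.a K Ko ∧ phi2 g Ko R ≤ 0 := by
  have hL0 := hUL.1
  obtain ⟨w1, w2, w3, w4⟩ := critical_of_lambda2_zero hg hW0 hW
  have hK0 := hL0.trans hK.1
  have hP0 := hL0.trans hP.1
  have hKA : aMax g K = UL.a := by
    obtain ⟨-, e1, -, e2⟩ := critical_of_lambda2_zero hg hK0 hK2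
    rw [aMax_eq, e1, ← e2, (hK.facts hg hUL).2.2.1]; ring
  have hPA : R.a ≤ aMax g P := by
    rw [aMax_eq, hd, ← w4, (hP.facts hg hUL).2.2.1]; linarith
  obtain ⟨k, hk, hk0⟩ := exists_root (f := fun z => aMax g (wave1State g UL z) - R.a) hPK.le
    ((continuous_aMax_wave1State hL0).sub continuous_const).continuousOn
    (by rw [← hP.2.1]; linarith) (by rw [← hK.2.1, hKA]; linarith)
  have hkl := isLeftShock_wave1State hg hL0 hP hk.1
  have hkh : (wave1State g UL k).h = k := rfl
  have hkK : k < K.h := by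
    rcases hk.2.eq_or_lt with h | h
    · rw [h, ← hK.2.1] at hk0; linarith
    · exact h
  have hk2 := (hkl.compare hg hL0 hK hkK).2.2
  generalize hM : wave1State g UL k = M at *
  rw [hK2] at hk2
  have hkA : aMax g M = R.a := by linarith
  have hM0 : 0 < M.h := hL0.trans hkl.1
  have hkd : disc M ≤ disc W := by
    rw [← hd]
    rcases hk.1.eq_or_lt with h | h
    · rw [hP.eq_of_h hkl (h.trans hkh.symm)]
    · exact (hP.compare hg hL0 hkl (h.trans_eq hkh.symm)).1.le
  have hkd0 : disc M < 0 := hkd.trans_lt w3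
  have hku : M.u < 0 := neg_of_mul_neg_right hkd0 hM0.le
  have hkc := hcrit_pos hg hkd0.ne
  have hkG := hkl.mem_closedG2 hg hUL hk2.le
  have hke : head g M + M.a - R.a = 3 / 2 * hcrit g (disc M) := by
    rw [aMax_eq] at hkA; linarith
  obtain ⟨c1, c2⟩ := contactTo_spec (a := R.a) hg hkG (by linarith) hkA.ge
  refine ⟨M, contactTo g R.a M, ⟨⟨mem_W1_iff.2 ⟨hM0, hkl.2.1⟩, .inr ⟨hlev,
    ⟨hM0, (hkl.facts hg hUL).2.1, hk2⟩, hku.le, hkA⟩⟩, rfl, c2, c1⟩, ?_⟩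
  have hVa : (contactTo g R.a M).a = R.a := rfl
  generalize contactTo g R.a M = V at *
  obtain ⟨d1, d2⟩ := contact_disc_head hg c1
  have hV0 := c1.2.1
  have hVh : V.h = hcrit g (disc V) := by
    by_contra! hn
    have h1 := specHead_gt hg hV0 hn
    rw [← head_eq_specHead hV0, ← d1] at h1
    linarith
  have hVs : g * V.h ≤ V.u ^ 2 := (le_hcrit_disc_iff hg hV0).1 hVh.le
  have hVu : V.u < 0 := by
    rw [d1] at hkd0; exact neg_of_mul_neg_right hkd0 hV0.le
  have hWV : W.h ≤ V.h := by
    rw [w4, hVh, ← d1]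
    refine hcrit_mono hg ?_
    nlinarith
  have hWu : W.u < 0 := neg_of_mul_neg_right w3 hW0.le
  have hWs := sq_eq_of_lambda2_zero (mul_pos hg hW0).le hW
  have hVW : V.u ≤ W.u := by
    by_contra! hn
    have := mul_le_mul_of_nonneg_left hWV hg.le
    nlinarith
  have := velJump_mono hg hR hW0.le hWV
  rw [phi2_eq] at hpW ⊢
  linarith

/-- The stationary 2-shock has to lose the head `head g Q - head g P`. The loss runs continuously
from its value at `Q` to `0` at the critical depth of `W`; the total head then determines the level
of the shock. -/
theorem exists_backResonant_of_head {P Q W : State} (hg : 0 < g) (hUL : UL ∈ G1 g) (hR : 0 < R.h)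
    (hP : IsLeftShock g UL P) (hP2 : 0 ≤ lambda2 g P) (hW0 : 0 < W.h) (hWR : W.h < R.h)
    (hWa : W.a = R.a) (hW : lambda2 g W = 0) (hpW : phi2 g W R = 0) (hd : disc P = disc W)
    (hQ0 : 0 < Q.h) (hQW : Q.h < W.h) (hQa : Q.a = UL.a)
    (hc : StationaryContact g Q W) (hlt : head g P < head g Q)
    (hl : head g Q - head g P < jumpLoss g (disc W) Q.h) :
    ∃ F, IsRiemannSolution g UL R F ∧ IsBackResonant g UL R F := by
  obtain ⟨w1, w2, w3, w4⟩ := critical_of_lambda2_zero hg hW0 hW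
  obtain ⟨hQd, hQh⟩ := contact_disc_head hg hc
  obtain ⟨hP0, -, hPa, -⟩ := hP.facts hg hUL
  have hPc : hcrit g (disc W) ≤ P.h := by
    rw [← hd]
    exact (hcrit_disc_le_iff hg hP0).2 ((mem_closedG2_iff hg).1 (hP.mem_closedG2 hg hUL hP2)).2
  have hQs := head_eq_specHead (g := g) hQ0
  rw [hQd] at hQs
  rw [hQa, hWa] at hQh
  have hWh := head_eq_specHead (g := g) hW0
  obtain ⟨z, hz, hzb⟩ := exists_strict_between
    ((continuousOn_jumpLoss hg w3.ne).mono fun z hz => (lt_min hQ0 hW0).trans_le hz.1)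
    (y := head g Q - head g P)
    (.inr ⟨show jumpLoss g (disc W) W.h < _ by
      rw [w4, jumpLoss_hcrit hg w3.ne]; linarith, hl⟩)
  obtain ⟨z1, z2⟩ : Q.h < z ∧ z < W.h := by
    rcases hzb with h | h
    · exact h
    · linarith
  have hz0 := hQ0.trans z1
  have hzc : z < hcrit g (disc W) := by rw [← w4]; exact z2
  have m1 := specHead_lt_of_le_hcrit hg hQ0 hzc.le z1
  have m2 := specHead_lt_of_le_hcrit hg hz0 w4.le z2
  obtain ⟨Z, hZh', hZu, hZa⟩ : ∃ Z : State, Z.h = z ∧ Z.u = disc W / z ∧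
    Z.a = head g W + R.a - specHead g (disc W) z := ⟨⟨_, _, _⟩, rfl, rfl, rfl⟩
  have hZ0 : 0 < Z.h := hZh' ▸ hz0
  have hZd : disc Z = disc W := by
    unfold disc; rw [hZh', hZu]; exact mul_div_cancel₀ _ hz0.ne'
  have hZh : head g Z = specHead g (disc W) z := by
    rw [head_eq_specHead hZ0, hZd, hZh']
  rw [← hZh'] at hzc
  have hZs : g * Z.h < Z.u ^ 2 := (lt_hcrit_disc_iff hg hZ0).1 (by rw [hZd]; exact hzc)
  have hZ2 : lambda2 g Z < 0 :=
    (lambda2_neg_iff (mul_pos hg hZ0).le).2 ⟨hZu ▸ div_neg_of_neg_of_pos w3 hz0, hZs⟩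
  obtain ⟨j1, j2, j3⟩ := lt_hash_h hg hZ0 hZs
  have hZhd := disc_hash hg hZ0 j3
  have hZhh := head_hash hg hZ0 j3
  rw [hZd] at hZhd hZhh j2
  refine exists_backResonant hg hUL hR hP hP2 (Z := Z) (by linarith) (by linarith) ?_ hZ0 hZ2 ?_
    hWa hW hWR hpW
  · refine (stationaryContact_iff hg).2 ⟨hP0, hZ0.trans j1, hd.trans hZhd.symm, ?_,
      .inl ⟨by rw [hd]; exact hPc, by rw [hd]; exact j2.le⟩⟩
    rw [hZhh, hZh, hash_a, hZa, hZh', hPa]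
    linarith
  · refine (stationaryContact_iff hg).2 ⟨hZ0, hW0, hZd, ?_,
      .inr ⟨by rw [hZd]; exact hzc.le, by rw [hZd]; exact w4.le⟩⟩
    rw [hZh, hWa, hZa]
    ring

/-- Even after a jump at `Q` the head is at least that of `P`, so `P.h ≤ (hash g Q).h`. The momentum
balance `mul_phi2_of_lt` then puts `P` on or above the 2-wave curve of `Q`, which the 1-shock curve
meets farther down. -/
theorem exists_waveContact_of_head {P Q W : State} (hg : 0 < g) (hUL : UL ∈ G1 g) (hR : 0 < R.h)
    (hlev : UL.a < R.a) (hP : IsLeftShock g UL P) (hP2 : 0 ≤ lambda2 g P) (hW0 : 0 < W.h)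
    (hWR : W.h < R.h) (hWa : W.a = R.a) (hW : lambda2 g W = 0) (hpW : phi2 g W R = 0)
    (hd : disc P = disc W) (hQ0 : 0 < Q.h) (hQW : Q.h < W.h) (hQa : Q.a = UL.a)
    (hQ : lambda2 g Q < 0) (hc : StationaryContact g Q W)
    (hl : jumpLoss g (disc W) Q.h ≤ head g Q - head g P) :
    ∃ F, IsRiemannSolution g UL R F ∧ IsWaveContact g UL R F := by
  have hL0 := hUL.1
  obtain ⟨w1, w2, w3, w4⟩ := critical_of_lambda2_zero hg hW0 hW
  obtain ⟨hQd, -⟩ := contact_disc_head hg hc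
  have hP0 := (hP.facts hg hUL).1
  have hPc : hcrit g (disc W) ≤ P.h := by
    rw [← hd]
    exact (hcrit_disc_le_iff hg hP0).2 ((mem_closedG2_iff hg).1 (hP.mem_closedG2 hg hUL hP2)).2
  have hPh := head_eq_specHead (g := g) hP0
  obtain ⟨j1, j2, j3⟩ := lt_hash_h hg hQ0 ((lambda2_neg_iff (mul_pos hg hQ0).le).1 hQ).2
  have hH0 := hQ0.trans j1
  have hQhd := disc_hash hg hQ0 j3
  have hQhh := head_hash hg hQ0 j3
  have hHh := head_eq_specHead (g := g) hH0
  rw [hQd] at hQhd hQhh j2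
  rw [hQhd] at hHh
  rw [hd] at hPh
  have hPH : P.h ≤ (hash g Q).h := by
    by_contra! hn
    have := specHead_lt_of_hcrit_le hg hH0 j2.le hn
    linarith
  have hQP : Q.h < P.h := by rw [← w4] at hPc; linarith
  have hmul := mul_phi2_of_lt (g := g) hQP
  have hsp := (add_mul_kap_nonpos hg hQ0 hQ hP0).2 hPH
  obtain ⟨U, hU, hPU, hU0⟩ := exists_left_root (Q := Q) hg hUL hP hQ0 (by
    refine nonneg_of_mul_nonneg_right ?_ hP0
    rw [hmul, hd, hQd]
    nlinarith)
  have hdU : disc U ≤ disc W := by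
    rw [← hd]
    rcases hPU.eq_or_lt with h | h
    · rw [hP.eq_of_h hU h]
    · exact (hP.compare hg hL0 hU h).1.le
  refine exists_waveContact hg hUL hlev hR hU hQ0 hU0 hQa ?_ hQ hc hWa hW hWR hpW
  intro hlt
  have := mul_phi2_of_lt (g := g) hlt
  rw [hU0, mul_zero, hQd] at this
  -- A positive shock speed would make the right side of the momentum balance negative, because
  -- `disc U ≤ disc W`.
  by_contra! hn
  nlinarith

/-- `P` has the discharge of `W`, and the head missing between `P` and `W` decides: none missing
would produce a state `Ko` against `hno`; otherwise a stationary 2-shock at an intermediate level or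
a 2-wave at the level of `U_L` supplies it. -/
theorem exists_lower_of_disc_lt {K W : State} (hg : 0 < g) (hUL : UL ∈ G1 g) (hR : 0 < R.h)
    (hlev : UL.a < R.a)
    (hK : IsLeftShock g UL K) (hK2 : lambda2 g K = 0) (hW0 : 0 < W.h) (hWR : W.h < R.h)
    (hWa : W.a = R.a) (hW : lambda2 g W = 0) (hpW : phi2 g W R = 0) (hd : disc K < disc W)
    (hno : ∀ K Ko, IsContactOfLowerLimit g UL R.a K Ko → 0 < phi2 g Ko R) :
    ∃ F, IsRiemannSolution g UL R F ∧ IsLower g UL R F := by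
  have hL0 := hUL.1
  obtain ⟨s1, s2, s3, s4⟩ := isLeftShock_hash hg hUL
  have w3 := (critical_of_lambda2_zero hg hW0 hW).2.2.1
  -- the state on the 1-shock curve with the discharge of `W`
  obtain ⟨p, hp, hp0⟩ := exists_root (f := fun z => disc (wave1State g UL z) - disc W)
    (hK.facts hg hUL).2.2.2.1
    ((continuous_disc_wave1State hL0).sub continuous_const).continuousOn
    (by rw [← s1.2.1, s3]; linarith) (by rw [← hK.2.1]; linarith)
  have hP := isLeftShock_wave1State hg hL0 s1 hp.1
  have hPK : p < K.h := by
    rcases hp.2.eq_or_lt with h | h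
    · rw [h, ← hK.2.1] at hp0; linarith
    · exact h
  have hP2 := (hP.compare hg hL0 hK hPK).2.2
  rw [hK2] at hP2
  have hPd := sub_eq_zero.1 hp0
  obtain ⟨Q, q1, q2, q3, q4, q5, q6⟩ := exists_supercritical_left hg hW0 hW
    (show UL.a < W.a by rw [hWa]; exact hlev)
  obtain ⟨-, q7⟩ := contact_disc_head hg q6
  rw [q3, hWa] at q7
  rcases le_or_gt (head g W + R.a) (head g (wave1State g UL p) + UL.a) with h | h
  · obtain ⟨K, Ko, h1, h2⟩ :=
      exists_lowerLimit_of_head_le hg hUL hR hlev hK hK2 hP hPK hW0 hW hpW hPd h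
    exact absurd (hno K Ko h1) h2.not_gt
  rcases lt_or_ge (head g Q - head g (wave1State g UL p)) (jumpLoss g (disc W) Q.h) with hl | hl
  · obtain ⟨F, h1, h2⟩ := exists_backResonant_of_head hg hUL hR hP hP2.le hW0 hWR hWa hW hpW hPd
      q1 q2 q3 q6 (by linarith) hl
    exact ⟨F, h1, .inr (.inr (.inr h2))⟩
  · obtain ⟨F, h1, h2⟩ := exists_waveContact_of_head hg hUL hR hlev hP hP2.le hW0 hWR hWa hW hpW
      hPd q1 q2 q3 q4 q6 hl
    exact ⟨F, h1, .inr (.inr (.inl h2))⟩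

/-- Now the critical state `W` is at least as deep as the critical state `K` of the 1-shock curve.
So `K` lies on or above the 2-wave curve of `Q`, and the intersection is found beyond `K`. -/
theorem exists_lower_of_le_disc {K W : State} (hg : 0 < g) (hUL : UL ∈ G1 g) (hR : 0 < R.h)
    (hlev : UL.a < R.a)
    (hK : IsLeftShock g UL K) (hK2 : lambda2 g K = 0) (hW0 : 0 < W.h) (hWR : W.h < R.h)
    (hWa : W.a = R.a) (hW : lambda2 g W = 0) (hpW : phi2 g W R = 0) (hd : disc W ≤ disc K) :
    ∃ F, IsRiemannSolution g UL R F ∧ IsLower g UL R F := by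
  have hL0 := hUL.1
  obtain ⟨w1, w2, w3, w4⟩ := critical_of_lambda2_zero hg hW0 hW
  have hK0 := hL0.trans hK.1
  have hKW : K.h ≤ W.h := by
    by_contra! hn
    exact absurd (critical_compare hg hW0 hW hK2 hn).1 hd.not_gt
  obtain ⟨Q, q1, q2, q3, q4, q5, q6⟩ := exists_supercritical_left hg hW0 hW
    (show UL.a < W.a by rw [hWa]; exact hlev)
  have hQs := ((lambda2_neg_iff (mul_pos hg q1).le).1 q4).2
  obtain ⟨j1, j2, j3⟩ := lt_hash_h hg q1 hQs
  rw [q5, ← w4] at j2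
  obtain ⟨U, hU, hKU, hU0⟩ := exists_left_root (Q := Q) hg hUL hK q1 (by
    rcases le_or_gt K.h Q.h with h | h
    · have h1 := Real.sqrt_le_sqrt (mul_le_mul_of_nonneg_left h hg.le)
      rw [phi2_eq, velJump_of_le h, rarJump_eq hg]
      unfold lambda2 at hK2 q4
      linarith
    · have hmul := mul_phi2_of_lt (g := g) h
      have hsp := (add_mul_kap_nonpos hg q1 q4 hK0).2 (hKW.trans j2.le)
      refine nonneg_of_mul_nonneg_right ?_ hK0
      rw [hmul]
      nlinarith)
  obtain ⟨F, hF, hF'⟩ := exists_waveContact hg hUL hlev hR hU q1 hU0 q3 (by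
    intro hlt
    by_contra! hn
    have hUh0 := hL0.trans hU.1
    have h1 : (hash g Q).h < U.h := by
      by_contra! hle
      exact absurd ((add_mul_kap_nonpos hg q1 q4 hUh0).2 hle) hn.not_ge
    have h2 := mul_phi2_of_lt (g := g) hlt
    rw [hU0, mul_zero, q5] at h2
    -- A positive shock speed would give `U` a larger discharge than `W`. But beyond `K` the flow is
    -- no longer subcritical, so `U` would be at most as deep as `W`, hence shallower than `hash g
    -- Q`.
    have h3 : disc W < disc U := by nlinarith
    have h4 : lambda2 g U ≤ 0 := by
      rcases hKU.eq_or_lt with h | h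
      · rw [← hK.eq_of_h hU h, hK2]
      · exact hK2 ▸ (hK.compare hg hL0 hU h).2.2.le
    obtain ⟨h5, h6⟩ := (lambda2_nonpos_iff (mul_pos hg hUh0).le).1 h4
    have h7 := (le_hcrit_disc_iff hg hUh0).2 h6
    have h8 : disc U ≤ 0 := mul_nonpos_of_nonneg_of_nonpos hUh0.le h5
    have h9 : hcrit g (disc U) ≤ hcrit g (disc W) := hcrit_mono hg (by nlinarith)
    linarith) q4 q6 hWa hW hWR hpW
  exact ⟨F, hF, .inr (.inr (.inl hF'))⟩

/-- The solution that begins with a 1-shock. -/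
theorem exists_lower (hg : 0 < g) (hUL : UL ∈ G1 g) (hR : 0 < R.h) (hR2 : 0 < lambda2 g R)
    (hlev : UL.a < R.a) (hS : StationaryContact g (hash g UL) S) (hSa : S.a = R.a)
    (hp : 0 < phi2 g S R) :
    ∃ F, IsRiemannSolution g UL R F ∧ IsLower g UL R F ∧
      ∀ K Ko, IsContactOfLowerLimit g UL R.a K Ko → phi2 g Ko R ≤ 0 → IsA3 F := by
  -- If some `Ko` lies on or below the curve, the solution is of type (A3); otherwise that clause is
  -- void and a solution through the critical state of the 2-wave curve is constructed.
  by_cases hno : ∀ K Ko, IsContactOfLowerLimit g UL R.a K Ko → 0 < phi2 g Ko R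
  · obtain ⟨b1, b2, b3, -⟩ := contact_hash_facts hg hUL hS
    have hSs := (hcrit_disc_le_iff hg b1).1 (by rw [b2]; exact b3)
    obtain ⟨W, W0, WR, Wa, W2, Wp⟩ := exists_critical_right hg hR hR2 (right_u_lt hg b1 hSs hR hp)
    obtain ⟨K, hK, hK2⟩ := exists_critical_left hg hUL
    have key : ∃ F, IsRiemannSolution g UL R F ∧ IsLower g UL R F := by
      rcases lt_or_ge (disc K) (disc W) with h | h
      · exact exists_lower_of_disc_lt hg hUL hR hlev hK hK2 W0 WR Wa W2 Wp h hno
      · exact exists_lower_of_le_disc hg hUL hR hlev hK hK2 W0 WR Wa W2 Wp h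
    obtain ⟨F, h1, h2⟩ := key
    exact ⟨F, h1, h2, fun K Ko h h' => absurd (hno K Ko h) h'.not_gt⟩
  · push Not at hno
    obtain ⟨K, Ko, hK, hpK⟩ := hno
    obtain ⟨F, h1, h2, h3⟩ :=
      exists_shockContact_of_lowerLimit hg hUL hR hR2 hlev.ne hS hSa hp.le hK hpK
    exact ⟨F, h1, .inl h2, fun _ _ _ _ => h3⟩

end Third

/-! ### Distinctness of the three forms and the exact count -/

theorem IsA1.not_isA2 {F : Fan} (h : IsA1 F) : ¬ IsA2 F := by
  rintro ⟨k, -, h2⟩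
  rcases h with ⟨k₁, k₂, h₁, h₂, h⟩ | h
  · rw [h2] at h
    rcases h₁ with rfl | rfl | rfl <;> rcases h₂ with rfl | rfl | rfl <;> simp at h
  · rw [h2] at h
    simp at h

theorem IsLower.head_kind {g : ℝ} {UL R : State} {F : Fan} (h : IsLower g UL R F) :
    ∃ U F', F = (shock1, U) :: F' := by
  rcases h with ⟨U, V, -, -, -, -, -, -, -, rfl⟩ | ⟨U, Q, V, -, -, -, -, -, -, -, -, -, rfl⟩ |
    ⟨U, Q, W, -, -, -, -, -, -, -, -, -, -, -, rfl⟩ |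
    ⟨U, Z, W, -, -, -, -, -, -, -, -, -, -, -, rfl⟩ <;> exact ⟨_, _, rfl⟩

theorem IsA1.not_isLower {g : ℝ} {UL R : State} {F : Fan} (h : IsA1 F) : ¬ IsLower g UL R F := by
  intro h'
  obtain ⟨U, F', rfl⟩ := h'.head_kind
  rcases h with ⟨k₁, k₂, -, -, h⟩ | h <;> simp at h

theorem IsA2.not_isLower {g : ℝ} {UL R : State} {F : Fan} (h : IsA2 F) : ¬ IsLower g UL R F := by
  intro h'
  obtain ⟨U, F', rfl⟩ := h'.head_kind
  obtain ⟨k, -, h⟩ := h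
  simp at h

/-- The Riemann problem with exactly three solutions. -/
theorem exists_three_solutions {g : ℝ} {UL R O S : State} (hg : 0 < g) (hUL : UL ∈ G1 g)
    (hR : 0 < R.h) (hR2 : 0 < lambda2 g R)
    (hO : StationaryContact g UL O) (hOa : O.a = R.a) (hS : StationaryContact g (hash g UL) S)
    (hSa : S.a = R.a) (hlt : S.h < (hash g O).h) (hpS : 0 < phi2 g S R)
    (hpO : phi2 g (hash g O) R < 0) :
    ∃ F₁ F₂ F₃ : Fan,
      (∀ F : Fan, IsRiemannSolution g UL R F ↔ F = F₁ ∨ F = F₂ ∨ F = F₃) ∧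
      F₁ ≠ F₂ ∧ F₁ ≠ F₃ ∧ F₂ ≠ F₃ ∧ IsA1 F₁ ∧ IsA2 F₂ ∧
      (∀ K Ko : State, IsContactOfLowerLimit g UL R.a K Ko → phi2 g Ko R ≤ 0 → IsA3 F₃) := by
  have hlev := level_lt_of_lt hg hUL hO hOa hS hSa hlt
  obtain ⟨F₁, s₁, c₁, a₁⟩ := exists_contactPure hg hUL hR hlev.ne hO hOa hpO.le
  obtain ⟨F₂, s₂, c₂, a₂⟩ := exists_resonant hg hUL hR hO hOa hS hSa (.inr ⟨hpO, hpS⟩)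
  obtain ⟨F₃, s₃, c₃, a₃⟩ := exists_lower hg hUL hR hR2 hlev hS hSa hpS
  refine ⟨F₁, F₂, F₃, fun F => ⟨fun h => ?_, ?_⟩, ?_, ?_, ?_, a₁, a₂, a₃⟩
  · rcases solution_cases hg hUL hR hR2 hlev.ne hS hSa (.inr hpS) h with h | h | h
    · exact .inl (contactPure_unique hg hUL hR hO hOa h c₁)
    · exact .inr (.inl (resonant_unique hg hUL hR hO hOa hS hSa h c₂))
    · exact .inr (.inr (lower_unique hg hUL hR hR2 h c₃))
  · rintro (rfl | rfl | rfl) <;> assumption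
  · rintro rfl; exact a₁.not_isA2 a₂
  · rintro rfl; exact a₁.not_isLower c₃
  · rintro rfl; exact a₂.not_isLower c₃

end ShallowWater
end

open ShallowWater in
theorem theorem3p1 (g : ℝ) (hg : 0 < g) (UL UR : State) (hUL : UL ∈ G1 g) (hUR : 0 < UR.h) :
    -- (a) existence
    (∀ K Ko : State, IsContactOfLowerLimit g UL UR.a K Ko →
      phi2 g Ko UR ≤ 0 →
      (∀ V ∈ W1a g UL UR.a ∩ W2B g UR, V.u ≤ 0 → UR.h < V.h → 0 ≤ shockSpeed V UR) →
      ∃ F : Fan, IsRiemannSolution g UL UR F) ∧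
    -- (b) and (c), for right-hand states with `λ₂(U_R) > 0`; `ULo` is the state `U_L^o` and
    -- `ULso` is the state `U_L^{#o}`
    (0 < lambda2 g UR → ∀ ULo ULso : State,
      StationaryContact g UL ULo → ULo.a = UR.a →
      StationaryContact g (hash g UL) ULso → ULso.a = UR.a →
      -- (b) uniqueness, first regime
      ((hash g ULo).h ≤ ULso.h →
        ∀ F F' : Fan, IsRiemannSolution g UL UR F → IsRiemannSolution g UL UR F' → F = F') ∧
      -- (b) uniqueness, second regime
      (ULso.h < (hash g ULo).h → ULso ∈ G2 g →
        0 < phi2 g ULso UR * phi2 g (hash g ULo) UR →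
        ∀ F F' : Fan, IsRiemannSolution g UL UR F → IsRiemannSolution g UL UR F' → F = F') ∧
      -- (c) exactly three solutions
      (ULso.h < (hash g ULo).h → 0 < phi2 g ULso UR → phi2 g (hash g ULo) UR < 0 →
        ∃ F₁ F₂ F₃ : Fan,
          (∀ F : Fan, IsRiemannSolution g UL UR F ↔ F = F₁ ∨ F = F₂ ∨ F = F₃) ∧
          F₁ ≠ F₂ ∧ F₁ ≠ F₃ ∧ F₂ ≠ F₃ ∧ IsA1 F₁ ∧ IsA2 F₂ ∧
          (∀ K Ko : State, IsContactOfLowerLimit g UL UR.a K Ko → phi2 g Ko UR ≤ 0 →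
            IsA3 F₃))) := by
  refine ⟨fun K Ko hK hp hs => exists_solution hg hUL hUR hK hp hs,
    fun hR2 ULo ULso hO hOa hS hSa => ⟨fun hle F F' hF hF' => ?_,
      fun hlt hG hside F F' hF hF' => ?_, fun hlt hpS hpO => ?_⟩⟩
  · exact solution_unique_of_le hg hUL hUR hR2 hO hOa hS hSa hle hF hF'
  · exact solution_unique_of_same_side hg hUL hUR hR2 hO hOa hS hSa hlt hG hside hF hF'
  · exact exists_three_solutions hg hUL hUR hR2 hO hOa hS hSa hlt hpS hpO
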